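/- Let $\mathbf{FMn}$ be the category of foliated manifolds: objects are pairs $(M,\mathcal F)$ with $M$ a smooth (finite-dimensional, Hausdorff, second countable) manifold and $\mathcal F\subseteq TM$ an involutive smooth linear subbundle of constant rank; morphisms $(M,\mathcal F)\to(M',\mathcal F')$ are smooth maps $f\colon M\to M'$ with $d_pf(\mathcal F_p)=\mathcal F'_{f(p)}$ for all $p\in M$. A foliated manifold is irreducible if it has a dense leaf. For a morphism $\pi\colon M\to B$ in a category with a terminal object $\star$, let $\mathrm{KP}_\pi=M\times_BM\rightrightarrows M$ be its kernel pair, a groupoid object whose source and target are the first and second projections, and let $\mathrm{Aut}_B(M)$ be the group of automorphisms $\sigma$ of $M$ with $\pi\sigma=\pi$. A splitting action of $\mathrm{KP}_\pi$ is an action $\alpha\colon G\times M\to M$ of a group object $G$ such that the action groupoid $G\ltimes M$ is isomorphic to $\mathrm{KP}_\pi$ as a groupoid object over $M$; $\mathrm{KP}_\pi$ splits if the kernel pair exists and has a splitting action. A splitting action is a Galois structure if the induced homomorphism $G(\star)\to\mathrm{Aut}_B(M)$, $g\mapsto\alpha_g$, is an isomorphism. An epimorphism $\pi$ is Galois if it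 is the categorical quotient of $M$ by the action of $\mathrm{Aut}_B(M)$ and it admits a Galois structure that is unique up to isomorphism (an isomorphism of group objects conjugating the actions). Let $(M,\mathcal F)$ and $(B,TB)$ be irreducible foliated manifolds with $\operatorname{rank}\mathcal F=\dim B$, and let $\pi\colon(M,\mathcal F)\to(B,TB)$ be a surjective morphism in $\mathbf{FMn}$ (in particular an epimorphism). The following are equivalent. (a) $\mathrm{KP}_\pi$ splits in $\mathbf{FMn}$. (b) $\pi$ is Galois in $\mathbf{FMn}$. (c) There is a Lie group $G$ with a smooth (left) action on $M$ such that $\pi$ is a principal $G$-bundle and $\mathcal F$ is a $G$-invariant flat Ehresmann connection (that is, $d_p\pi\colon\mathcal F_p\to T_{\pi(p)}B$ is an isomorphism and $d_pL_g(\mathcal F_p)=\mathcal F_{gp}$ for all $p\in M$, $g\in G$, where $L_g(p)=gp$). (d) There is such a $G$ as in (c), with its action, and it is unique: for any other Lie group $H$ with an action on $M$ as in (c) there is a Lie group isomorphism $\psi\colon G\to H$ with $\psi(g)\cdot x=g\cdot x$ for all $g\in G$, $x\in M$. Moreover, for every Lie group $G$ acting as in (c), the map $g\mapsto L_g$ is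 an isomorphism of groups from $G$ onto $\mathrm{Aut}_{(B,TB)}(M,\mathcal F)$. -/

import Mathlib

open CategoryTheory CategoryTheory.Limits
open scoped Manifold ContDiff Topology

universe u v w

namespace GaloisFol

/-! ## Groups, actions and groupoids internal to a category

Binary products and pullbacks need not all exist in the category of foliated manifolds, so internal
algebraic structures are given on generalized elements `Z ⟶ X`, naturally in `Z`. By the Yoneda
lemma this is the usual definition whenever the products (or pullbacks) involved exist. -/

section Categorical

variable {C : Type w} [Category.{v} C]

/-- A group object: each set `Hom(Z, X)` is a group, naturally in `Z`. -/
structure GroupObj (C : Type w) [Category.{v} C] where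
  X : C
  grp : ∀ Z : C, Group (Z ⟶ X)
  comp_mul : ∀ {Z Z' : C} (f : Z' ⟶ Z) (a b : Z ⟶ X), f ≫ (a * b) = (f ≫ a) * (f ≫ b)

instance (G : GroupObj C) (Z : C) : Group (Z ⟶ G.X) := G.grp Z

theorem GroupObj.comp_one (G : GroupObj C) {Z Z' : C} (f : Z' ⟶ Z) :
    f ≫ (1 : Z ⟶ G.X) = 1 := by
  have h := G.comp_mul f (1 : Z ⟶ G.X) 1
  rw [mul_one] at h
  exact (left_eq_mul (a := f ≫ (1 : Z ⟶ G.X))).mp h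

theorem GroupObj.comp_inv (G : GroupObj C) {Z Z' : C} (f : Z' ⟶ Z) (a : Z ⟶ G.X) :
    f ≫ a⁻¹ = (f ≫ a)⁻¹ := by
  rw [eq_inv_iff_mul_eq_one, ← G.comp_mul, inv_mul_cancel, G.comp_one]

/-- An action `act : G × M ⟶ M` of a group object; `prod` with projections `fst`, `snd` is the
product of `G` and `M`. -/
structure ActionObj (G : GroupObj C) (M : C) where
  prod : C
  fst : prod ⟶ G.X
  snd : prod ⟶ M
  isLimit : IsLimit (BinaryFan.mk fst snd)
  act : prod ⟶ M
  /-- `1 · x = x` -/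
  one_act : ∀ {Z : C} (x : Z ⟶ M), BinaryFan.IsLimit.lift isLimit (1 : Z ⟶ G.X) x ≫ act = x
  /-- `(g * h) · x = g · (h · x)` -/
  mul_act : ∀ {Z : C} (g h : Z ⟶ G.X) (x : Z ⟶ M),
    BinaryFan.IsLimit.lift isLimit (g * h) x ≫ act =
      BinaryFan.IsLimit.lift isLimit g (BinaryFan.IsLimit.lift isLimit h x ≫ act) ≫ act

namespace ActionObj

variable {G : GroupObj C} {M : C} (A : ActionObj G M)

/-- The generalized element `(g, x)` of `G × M`. -/
def pair {Z : C} (g : Z ⟶ G.X) (x : Z ⟶ M) : Z ⟶ A.prod := BinaryFan.IsLimit.lift A.isLimit g x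

/-- The generalized element `g · x` of `M`. -/
def app {Z : C} (g : Z ⟶ G.X) (x : Z ⟶ M) : Z ⟶ M := A.pair g x ≫ A.act

@[simp] theorem pair_fst {Z : C} (g : Z ⟶ G.X) (x : Z ⟶ M) : A.pair g x ≫ A.fst = g :=
  BinaryFan.IsLimit.lift_fst A.isLimit g x

@[simp] theorem pair_snd {Z : C} (g : Z ⟶ G.X) (x : Z ⟶ M) : A.pair g x ≫ A.snd = x :=
  BinaryFan.IsLimit.lift_snd A.isLimit g x

theorem hom_ext {Z : C} {f g : Z ⟶ A.prod} (h₁ : f ≫ A.fst = g ≫ A.fst)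
    (h₂ : f ≫ A.snd = g ≫ A.snd) : f = g :=
  BinaryFan.IsLimit.hom_ext A.isLimit h₁ h₂

theorem comp_pair {Z Z' : C} (f : Z' ⟶ Z) (g : Z ⟶ G.X) (x : Z ⟶ M) :
    f ≫ A.pair g x = A.pair (f ≫ g) (f ≫ x) :=
  A.hom_ext (by simp) (by simp)

theorem pair_eta {Z : C} (f : Z ⟶ A.prod) : A.pair (f ≫ A.fst) (f ≫ A.snd) = f :=
  A.hom_ext (by simp) (by simp)

theorem comp_app {Z Z' : C} (f : Z' ⟶ Z) (g : Z ⟶ G.X) (x : Z ⟶ M) :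
    f ≫ A.app g x = A.app (f ≫ g) (f ≫ x) := by
  rw [app, app, ← Category.assoc, comp_pair]

theorem app_one {Z : C} (x : Z ⟶ M) : A.app 1 x = x := A.one_act x

theorem app_mul {Z : C} (g h : Z ⟶ G.X) (x : Z ⟶ M) : A.app (g * h) x = A.app g (A.app h x) :=
  A.mul_act g h x

theorem comp_act {Z : C} (f : Z ⟶ A.prod) : f ≫ A.act = A.app (f ≫ A.fst) (f ≫ A.snd) := by
  rw [app, pair_eta]

/-- The group morphism `G(⋆) → Aut(M)`, `g ↦ (x ↦ g · x)`, on global elements. -/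
noncomputable def toAut [HasTerminal C] : (⊤_ C ⟶ G.X) →* Aut M where
  toFun g :=
    { hom := A.app (terminal.from M ≫ g) (𝟙 M)
      inv := A.app (terminal.from M ≫ g⁻¹) (𝟙 M)
      hom_inv_id := by
        rw [comp_app, Category.comp_id, ← Category.assoc, terminal.comp_from, ← app_mul,
          ← G.comp_mul, inv_mul_cancel, G.comp_one, app_one]
      inv_hom_id := by
        rw [comp_app, Category.comp_id, ← Category.assoc, terminal.comp_from, ← app_mul,
          ← G.comp_mul, mul_inv_cancel, G.comp_one, app_one] }
  map_one' := by
    apply Aut.ext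
    change A.app (terminal.from M ≫ 1) (𝟙 M) = 𝟙 M
    rw [G.comp_one, app_one]
  map_mul' g h := by
    apply Aut.ext
    change A.app (terminal.from M ≫ (g * h)) (𝟙 M) =
      A.app (terminal.from M ≫ h) (𝟙 M) ≫ A.app (terminal.from M ≫ g) (𝟙 M)
    rw [comp_app, Category.comp_id, ← Category.assoc, terminal.comp_from, ← app_mul, G.comp_mul]

end ActionObj

/-- A groupoid object with object of objects `M`. Here `comp b a` is `b ∘ a`, defined when the
target of `a` is the source of `b`. -/
structure GroupoidObj (M : C) where
  arr : C
  src : arr ⟶ M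
  tgt : arr ⟶ M
  unit : M ⟶ arr
  inv : arr ⟶ arr
  comp : ∀ {Z : C} (b a : Z ⟶ arr), a ≫ tgt = b ≫ src → (Z ⟶ arr)
  comp_src : ∀ {Z : C} (b a : Z ⟶ arr) (h : a ≫ tgt = b ≫ src), comp b a h ≫ src = a ≫ src
  comp_tgt : ∀ {Z : C} (b a : Z ⟶ arr) (h : a ≫ tgt = b ≫ src), comp b a h ≫ tgt = b ≫ tgt
  comp_natural : ∀ {Z Z' : C} (f : Z' ⟶ Z) (b a : Z ⟶ arr) (h : a ≫ tgt = b ≫ src),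
    f ≫ comp b a h =
      comp (f ≫ b) (f ≫ a) (by rw [Category.assoc, h, Category.assoc])
  comp_assoc : ∀ {Z : C} (c b a : Z ⟶ arr) (h₁ : a ≫ tgt = b ≫ src) (h₂ : b ≫ tgt = c ≫ src),
    comp c (comp b a h₁) ((comp_tgt b a h₁).trans h₂) =
      comp (comp c b h₂) a (h₁.trans (comp_src c b h₂).symm)
  unit_src : unit ≫ src = 𝟙 M
  unit_tgt : unit ≫ tgt = 𝟙 M
  unit_comp : ∀ {Z : C} (a : Z ⟶ arr),
    comp (a ≫ tgt ≫ unit) a (by simp only [Category.assoc, unit_src, Category.comp_id]) = a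
  comp_unit : ∀ {Z : C} (a : Z ⟶ arr),
    comp a (a ≫ src ≫ unit) (by simp only [Category.assoc, unit_tgt, Category.comp_id]) = a
  inv_src : inv ≫ src = tgt
  inv_tgt : inv ≫ tgt = src
  inv_comp : ∀ {Z : C} (a : Z ⟶ arr),
    comp (a ≫ inv) a (by rw [Category.assoc, inv_src]) = a ≫ src ≫ unit
  comp_inv : ∀ {Z : C} (a : Z ⟶ arr),
    comp a (a ≫ inv) (by rw [Category.assoc, inv_tgt]) = a ≫ tgt ≫ unit

/-- Isomorphism of groupoid objects over the same object of objects. -/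
structure GroupoidObj.Iso {M : C} (R S : GroupoidObj M) where
  iso : R.arr ≅ S.arr
  src : iso.hom ≫ S.src = R.src
  tgt : iso.hom ≫ S.tgt = R.tgt
  comp : ∀ {Z : C} (b a : Z ⟶ R.arr) (h : a ≫ R.tgt = b ≫ R.src),
    R.comp b a h ≫ iso.hom =
      S.comp (b ≫ iso.hom) (a ≫ iso.hom) (by rw [Category.assoc, tgt, h, Category.assoc, src])

/-- The action groupoid `G ⋉ M`: arrows are pairs `(g, x)` with source `x` and target `g · x`, and
`(h, g · x) ∘ (g, x) = (h * g, x)`. -/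
def ActionObj.groupoid {G : GroupObj C} {M : C} (A : ActionObj G M) : GroupoidObj M where
  arr := A.prod
  src := A.snd
  tgt := A.act
  unit := A.pair 1 (𝟙 M)
  inv := A.pair A.fst⁻¹ A.act
  comp b a _ := A.pair ((b ≫ A.fst) * (a ≫ A.fst)) (a ≫ A.snd)
  comp_src b a h := by simp
  comp_tgt b a h := by
    rw [A.comp_act b, ← h, A.comp_act a, ← A.app_mul]; rfl
  comp_natural f b a h := by
    rw [A.comp_pair, G.comp_mul]; simp only [Category.assoc]
  comp_assoc c b a h₁ h₂ := by
    simp only [ActionObj.pair_fst, ActionObj.pair_snd, mul_assoc]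
  unit_src := by simp
  unit_tgt := A.one_act (𝟙 M)
  unit_comp a := by
    simp only [Category.assoc, ActionObj.pair_fst, G.comp_one, one_mul]
    exact A.pair_eta a
  comp_unit a := by
    simp only [Category.assoc, ActionObj.pair_fst, ActionObj.pair_snd, G.comp_one, mul_one,
      Category.comp_id]
    exact A.pair_eta a
  inv_src := by simp
  inv_tgt := by
    have h : A.act = A.app A.fst A.snd := by simpa using A.comp_act (𝟙 A.prod)
    change A.app A.fst⁻¹ A.act = A.snd
    rw [h, ← A.app_mul, inv_mul_cancel, A.app_one]
  inv_comp a := by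
    simp only [ActionObj.pair_fst, G.comp_inv, inv_mul_cancel, A.comp_pair,
      G.comp_one, Category.comp_id]
  comp_inv a := by
    simp only [ActionObj.pair_fst, ActionObj.pair_snd, G.comp_inv, mul_inv_cancel,
      A.comp_pair, G.comp_one, Category.comp_id]

/-- A groupoid object splits if it is isomorphic to an action groupoid. -/
def Splits {M : C} (R : GroupoidObj M) : Prop :=
  ∃ (G : GroupObj C) (A : ActionObj G M), Nonempty (A.groupoid.Iso R)

/-- The kernel pair of `π`, as a groupoid object: the arrows are the pairs `(x, y)` with
`π x = π y`, with source `x` and target `y`, and `(y, z) ∘ (x, y) = (x, z)`. -/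
noncomputable def kernelPairGroupoid {M B K : C} {π : M ⟶ B} {s t : K ⟶ M}
    (hK : IsPullback s t π π) : GroupoidObj M where
  arr := K
  src := s
  tgt := t
  unit := hK.lift (𝟙 M) (𝟙 M) rfl
  inv := hK.lift t s hK.w.symm
  comp b a h := hK.lift (a ≫ s) (b ≫ t) (by
    rw [Category.assoc, hK.w, ← Category.assoc, h, Category.assoc, hK.w, Category.assoc])
  comp_src b a h := by simp
  comp_tgt b a h := by simp
  comp_natural f b a h := by apply hK.hom_ext <;> simp
  comp_assoc c b a h₁ h₂ := by apply hK.hom_ext <;> simp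
  unit_src := by simp
  unit_tgt := by simp
  unit_comp a := by apply hK.hom_ext <;> simp
  comp_unit a := by apply hK.hom_ext <;> simp
  inv_src := by simp
  inv_tgt := by simp
  inv_comp a := by apply hK.hom_ext <;> simp
  comp_inv a := by apply hK.hom_ext <;> simp

/-- The kernel pair of `π` exists and splits. -/
def KernelPairSplits {M B : C} (π : M ⟶ B) : Prop :=
  ∃ (K : C) (s t : K ⟶ M) (hK : IsPullback s t π π), Splits (kernelPairGroupoid hK)

/-- `A` is a splitting action of the kernel pair of `π`. -/
def IsSplittingAction {M B : C} (π : M ⟶ B) {G : GroupObj C} (A : ActionObj G M) : Prop :=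
  ∃ (K : C) (s t : K ⟶ M) (hK : IsPullback s t π π),
    Nonempty (A.groupoid.Iso (kernelPairGroupoid hK))

/-- `Aut_B(M)`, the automorphisms of `M` over `B`. Multiplication in `Aut M` is composition of
maps, `σ * τ = σ ∘ τ`. -/
def AutOver {M B : C} (π : M ⟶ B) : Subgroup (Aut M) where
  carrier := {σ | σ.hom ≫ π = π}
  one_mem' := Category.id_comp π
  mul_mem' {σ τ} hσ hτ := by
    change (τ.hom ≫ σ.hom) ≫ π = π
    rw [Category.assoc, show σ.hom ≫ π = π from hσ, show τ.hom ≫ π = π from hτ]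
  inv_mem' {σ} hσ := by
    change σ.inv ≫ π = π
    exact (Iso.inv_comp_eq (show M ≅ M from σ)).mpr (show π = σ.hom ≫ π from Eq.symm hσ)

/-- `q` is a categorical quotient of `X` by the action `φ` of the abstract group `Γ`. -/
def IsCategoricalQuotient {Γ : Type*} [Group Γ] {X Y : C} (φ : Γ →* Aut X) (q : X ⟶ Y) : Prop :=
  (∀ g, (φ g).hom ≫ q = q) ∧
    ∀ (Z : C) (f : X ⟶ Z), (∀ g, (φ g).hom ≫ f = f) → ∃! f' : Y ⟶ Z, q ≫ f' = f

/-- `π` is normal: it is the categorical quotient of `M` by `Aut_B(M)`. -/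
def IsNormal {M B : C} (π : M ⟶ B) : Prop :=
  IsCategoricalQuotient (AutOver π).subtype π

/-- A Galois structure for `π`: a splitting action of the kernel pair such that
`G(⋆) → Aut_B(M)` is an isomorphism of groups. -/
def IsGaloisStructure [HasTerminal C] {M B : C} (π : M ⟶ B) {G : GroupObj C}
    (A : ActionObj G M) : Prop :=
  IsSplittingAction π A ∧ Function.Injective A.toAut ∧ A.toAut.range = AutOver π

/-- Two actions on `M` are isomorphic if an isomorphism of group objects conjugates them. -/
def ActionObj.Isomorphic {M : C} {G H : GroupObj C} (A : ActionObj G M) (A' : ActionObj H M) :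
    Prop :=
  ∃ ψ : G.X ≅ H.X,
    (∀ {Z : C} (a b : Z ⟶ G.X), (a * b) ≫ ψ.hom = (a ≫ ψ.hom) * (b ≫ ψ.hom)) ∧
    ∀ {Z : C} (g : Z ⟶ G.X) (x : Z ⟶ M), A'.app (g ≫ ψ.hom) x = A.app g x

/-- `π` is Galois: it is a normal epimorphism with a Galois structure that is unique up to
isomorphism. -/
def IsGalois [HasTerminal C] {M B : C} (π : M ⟶ B) : Prop :=
  Epi π ∧ IsNormal π ∧
    ∃ (G : GroupObj C) (A : ActionObj G M), IsGaloisStructure π A ∧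
      ∀ (H : GroupObj C) (A' : ActionObj H M), IsGaloisStructure π A' → A.Isomorphic A'

end Categorical

/-! ## Foliated manifolds -/

/-- Smooth manifolds: Hausdorff, second countable, modelled on some `ℝⁿ`. -/
structure SmoothMfd : Type (u + 1) where
  carrier : Type u
  dim : ℕ
  [top : TopologicalSpace carrier]
  [t2 : T2Space carrier]
  [secondCountable : SecondCountableTopology carrier]
  [charted : ChartedSpace (EuclideanSpace ℝ (Fin dim)) carrier]
  [isManifold : IsManifold (𝓡 dim) ∞ carrier]

attribute [instance] SmoothMfd.top SmoothMfd.t2 SmoothMfd.secondCountable SmoothMfd.charted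
  SmoothMfd.isManifold

instance : CoeSort SmoothMfd.{u} (Type u) := ⟨SmoothMfd.carrier⟩

/-- The vector field `V` is smooth on the set `U`. -/
def SmoothFieldOn (M : SmoothMfd.{u}) (V : ∀ p : M, TangentSpace (𝓡 M.dim) p) (U : Set M) : Prop :=
  ContMDiffOn (𝓡 M.dim) (𝓡 M.dim).tangent ∞
    (fun p => (⟨p, V p⟩ : TangentBundle (𝓡 M.dim) M)) U

/-- A regular foliation: an involutive smooth linear subbundle (of constant rank) of the tangent
bundle. -/
structure Foliation (M : SmoothMfd.{u}) where
  /-- The fibre of the subbundle at each point. -/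
  space : ∀ p : M, Submodule ℝ (TangentSpace (𝓡 M.dim) p)
  /-- Around each point the subbundle has a smooth local frame. -/
  subbundle : ∃ r : ℕ, ∀ p : M, ∃ U : Set M, IsOpen U ∧ p ∈ U ∧
    ∃ X : Fin r → ∀ q : M, TangentSpace (𝓡 M.dim) q,
      (∀ i, SmoothFieldOn M (X i) U) ∧
      ∀ q ∈ U, LinearIndependent ℝ (fun i => X i q) ∧
        Submodule.span ℝ (Set.range fun i => X i q) = space q
  /-- The Lie bracket of two local sections is a local section. -/
  involutive : ∀ (U : Set M), IsOpen U → ∀ V W : ∀ q : M, TangentSpace (𝓡 M.dim) q,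
    SmoothFieldOn M V U → SmoothFieldOn M W U →
    (∀ q ∈ U, V q ∈ space q) → (∀ q ∈ U, W q ∈ space q) →
    ∀ q ∈ U, VectorField.mlieBracket (𝓡 M.dim) V W q ∈ space q

/-- The foliation `TB` of `B`. -/
noncomputable def Foliation.total (B : SmoothMfd.{u}) : Foliation B where
  space _ := ⊤
  subbundle := by
    refine ⟨B.dim, fun p => ?_⟩
    let b := (EuclideanSpace.basisFun (Fin B.dim) ℝ).toBasis
    let e := trivializationAt (EuclideanSpace ℝ (Fin B.dim)) (TangentSpace (𝓡 B.dim)) p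
    have h := e.isLocalFrameOn_localFrame_baseSet (𝓡 B.dim) ∞ b
    refine ⟨e.baseSet, e.open_baseSet, FiberBundle.mem_baseSet_trivializationAt' p,
      e.localFrame b, h.contMDiffOn, fun q hq => ⟨h.linearIndependent hq, ?_⟩⟩
    exact top_le_iff.mp (h.generating hq)
  involutive _ _ _ _ _ _ _ _ _ _ := trivial

/-- Foliated manifolds `(M, 𝓕)`. -/
structure FMn : Type (u + 1) where
  mfd : SmoothMfd.{u}
  fol : Foliation mfd

/-- A morphism of foliated manifolds: a smooth map whose differential maps `𝓓_p` onto `𝓓'_{f p}`. -/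
@[ext] structure FMn.Hom (M N : FMn.{u}) : Type u where
  toFun : M.mfd → N.mfd
  smooth : ContMDiff (𝓡 M.mfd.dim) (𝓡 N.mfd.dim) ∞ toFun
  map_space : ∀ p : M.mfd,
    (M.fol.space p).map (mfderiv (𝓡 M.mfd.dim) (𝓡 N.mfd.dim) toFun p).toLinearMap =
      N.fol.space (toFun p)

/-- The category of foliated manifolds. -/
instance : Category FMn.{u} where
  Hom := FMn.Hom
  id M :=
    { toFun := id
      smooth := contMDiff_id
      map_space := fun p => by rw [mfderiv_id]; exact Submodule.map_id _ }
  comp {M N P} f g :=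
    { toFun := g.toFun ∘ f.toFun
      smooth := g.smooth.comp f.smooth
      map_space := fun p => by
        rw [mfderiv_comp p (g.smooth.mdifferentiable (by simp) _)
          (f.smooth.mdifferentiable (by simp) _)]
        change _ = P.fol.space (g.toFun (f.toFun p))
        rw [← g.map_space, ← f.map_space]
        exact Submodule.map_comp _ _ _ }

/-- Surjective morphisms are epimorphisms. -/
theorem FMn.epi_of_surjective {M N : FMn.{u}} (f : M ⟶ N) (hf : Function.Surjective f.toFun) :
    Epi f where
  left_cancellation g h hgh := by
    apply FMn.Hom.ext
    exact hf.injective_comp_right (congrArg FMn.Hom.toFun hgh)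

/-- The foliated manifold `(B, TB)`. -/
@[reducible] noncomputable def FMn.total (B : SmoothMfd.{u}) : FMn.{u} := ⟨B, Foliation.total B⟩

/-- The one-point manifold. -/
noncomputable def SmoothMfd.point : SmoothMfd.{u} :=
  letI : ChartedSpace (EuclideanSpace ℝ (Fin 0)) PUnit.{u + 1} := ChartedSpace.ofDiscreteTopology
  haveI : IsManifold (𝓡 0) ∞ PUnit.{u + 1} := IsManifold.of_discreteTopology _
  { carrier := PUnit.{u + 1}
    dim := 0 }

theorem SmoothMfd.point_submodule_eq (p : SmoothMfd.point.{u})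
    (S T : Submodule ℝ (TangentSpace (𝓡 SmoothMfd.point.{u}.dim) p)) : S = T := by
  have h : Subsingleton (TangentSpace (𝓡 SmoothMfd.point.{u}.dim) p) :=
    inferInstanceAs (Subsingleton (EuclideanSpace ℝ (Fin 0)))
  exact Subsingleton.elim _ _

/-- The unique point of the one-point manifold. -/
noncomputable def SmoothMfd.star : SmoothMfd.point.{u} := PUnit.unit

/-- The terminal object `({⋆}, 0)`. -/
noncomputable def FMn.isTerminalPoint : IsTerminal (FMn.total SmoothMfd.point.{u}) :=
  IsTerminal.ofUniqueHom
    (fun M =>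
      { toFun := fun _ => SmoothMfd.star
        smooth := contMDiff_const
        map_space := fun _ => SmoothMfd.point_submodule_eq SmoothMfd.star _ _ })
    (fun M f => by apply FMn.Hom.ext; rfl)

instance : HasTerminal FMn.{u} := FMn.isTerminalPoint.hasTerminal

/-- `S` is a connected integral manifold of `𝓕`: the image of a connected manifold `N` under an
injective immersion `j` with `d_n j (T_n N) = 𝓕_{j n}` for all `n`. -/
def IsConnectedIntegralManifold (M : FMn.{u}) (S : Set M.mfd) : Prop :=
  ∃ (N : SmoothMfd.{u}) (j : N → M.mfd), ConnectedSpace N ∧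
    ContMDiff (𝓡 N.dim) (𝓡 M.mfd.dim) ∞ j ∧ Function.Injective j ∧
    (∀ n, Function.Injective (mfderiv (𝓡 N.dim) (𝓡 M.mfd.dim) j n)) ∧
    (∀ n, (mfderiv (𝓡 N.dim) (𝓡 M.mfd.dim) j n).toLinearMap.range = M.fol.space (j n)) ∧
    Set.range j = S

/-- The leaf through `p`: the maximal connected integral manifold through `p`, that is, the union of
all of them. -/
def leaf (M : FMn.{u}) (p : M.mfd) : Set M.mfd :=
  ⋃₀ {S | IsConnectedIntegralManifold M S ∧ p ∈ S}

/-- A foliated manifold is irreducible if it contains a dense leaf. -/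
def FMn.IsIrreducible (M : FMn.{u}) : Prop := ∃ p, Dense (leaf M p)

/-- A foliation is a flat Ehresmann connection in `π : M → B` if the differential of `π` maps each
`𝓕_p` isomorphically onto the tangent space of `B` at `π p`. -/
def IsFlatEhresmannConnection {M B : SmoothMfd.{u}} (π : M → B) (F : Foliation M) : Prop :=
  ∀ p, Function.Bijective
    ((mfderiv (𝓡 M.dim) (𝓡 B.dim) π p).toLinearMap.domRestrict (F.space p))

/-! ## Lie groups and principal bundles -/

/-- Lie groups. -/
structure LieGrp : Type (u + 1) extends SmoothMfd.{u} where
  [group : Group carrier]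
  [lieGroup : LieGroup (𝓡 dim) ∞ carrier]

attribute [instance] LieGrp.group LieGrp.lieGroup

instance : CoeSort LieGrp.{u} (Type u) := ⟨fun G => G.carrier⟩

/-- A smooth (left) action of a Lie group on a manifold. -/
structure LieAction (G : LieGrp.{u}) (M : SmoothMfd.{u}) where
  act : G → M → M
  one_act : ∀ x, act 1 x = x
  mul_act : ∀ g h x, act (g * h) x = act g (act h x)
  smooth : ContMDiff ((𝓡 G.dim).prod (𝓡 M.dim)) (𝓡 M.dim) ∞ (fun p : G × M => act p.1 p.2)

/-- `π : M → B` is a principal `G`-bundle: it is `G`-invariant, and `B` is covered by open sets `U`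
with `G`-equivariant diffeomorphisms `π⁻¹(U) ≃ U × G` over `U`. -/
def IsPrincipalBundle {G : LieGrp.{u}} {M B : SmoothMfd.{u}} (α : LieAction G M) (π : M → B) :
    Prop :=
  (∀ g x, π (α.act g x) = π x) ∧
  ∀ b : B, ∃ (U : Set B) (Φ : OpenPartialHomeomorph M (B × G)), IsOpen U ∧ b ∈ U ∧
    Φ.source = π ⁻¹' U ∧ Φ.target = U ×ˢ Set.univ ∧
    ContMDiffOn (𝓡 M.dim) ((𝓡 B.dim).prod (𝓡 G.dim)) ∞ Φ Φ.source ∧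
    ContMDiffOn ((𝓡 B.dim).prod (𝓡 G.dim)) (𝓡 M.dim) ∞ Φ.symm Φ.target ∧
    (∀ x ∈ Φ.source, (Φ x).1 = π x) ∧
    ∀ g, ∀ x ∈ Φ.source, (Φ (α.act g x)).2 = g * (Φ x).2

/-- The foliation is invariant under the action: `d_p L_g (𝓕_p) = 𝓕_{g p}`. -/
def IsInvariantFoliation {G : LieGrp.{u}} {M : SmoothMfd.{u}} (α : LieAction G M)
    (F : Foliation M) : Prop :=
  ∀ g p, (F.space p).map (mfderiv (𝓡 M.dim) (𝓡 M.dim) (α.act g) p).toLinearMap =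
    F.space (α.act g p)

/-- The action `α` makes `π` a principal `G`-bundle for which `F` is a `G`-invariant flat Ehresmann
connection. -/
def IsPrincipalWithConnection {G : LieGrp.{u}} {M B : SmoothMfd.{u}} (α : LieAction G M)
    (π : M → B) (F : Foliation M) : Prop :=
  IsPrincipalBundle α π ∧ IsFlatEhresmannConnection π F ∧ IsInvariantFoliation α F

/-- An isomorphism of Lie groups conjugating the two actions on `M`. -/
def LieAction.Conjugate {G H : LieGrp.{u}} {M : SmoothMfd.{u}} (α : LieAction G M)
    (β : LieAction H M) : Prop :=
  ∃ ψ : G ≃* H, ContMDiff (𝓡 G.dim) (𝓡 H.dim) ∞ ψ ∧ ContMDiff (𝓡 H.dim) (𝓡 G.dim) ∞ ψ.symm ∧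
    ∀ g x, β.act (ψ g) x = α.act g x

end GaloisFol

/-! The differential of `π` maps `𝓕` onto `TB` and the ranks agree, so `𝓕` is a flat Ehresmann
connection. Frobenius' theorem gives through each point of `M` a local section of `π` tangent to
`𝓕`, a plaque (`exists_isPlaque`). Uniqueness for differential equations shows that a map from a
connected manifold tangent to `𝓕` is determined by its projection to `B` and one value
(`eq_of_tangent`). Hence a morphism over `B` is determined by its value at a point with dense leaf
(`FMn.hom_ext_of_dense_leaf`).

Group objects of `FMn` are Lie groups: the unit is a morphism from the point, whose foliation is
zero, so the foliation of the group vanishes at the identity and, having constant rank, everywhere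
(`GroupObj.isDiscrete`). For such `G` the product with `M` is the manifold `G × M` with the
foliation `0 × 𝓕` (`FMn.isLimitProd`), and an action splits the kernel pair exactly when `(x, g ·
x)` exhibits this product as the kernel pair.

From a splitting action to a bundle: a point of `M` is not a morphism from the terminal object when
`𝓕 ≠ 0`, but a plaque is a morphism from an open subset of `B`. Over the domain `U` of a plaque `s`,
the inclusion of `π⁻¹(U)` and `x ↦ s (π x)` have the same projection, so the kernel pair yields a
smooth `δ` with `δ x · x = s (π x)`, which trivializes `π`. Freeness holds because an element fixing
a point fixes a piece of plaque, by unique lifting, and so acts on that generalized element as `1`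
does.

Conversely, in a principal bundle with invariant flat connection the group-valued map comparing two
morphisms with the same projection is smooth and has zero derivative along the leaves
(`mfderiv_division`), so `G × M` is the kernel pair. The group is transitive on fibres, so rigidity
along the dense leaf identifies it with `Aut_B(M)` (`translationHom_bijective`). This gives the
Galois structure and its uniqueness; morphisms constant on fibres descend through plaques
(`exists_descent`), which gives the quotient property. -/

namespace GaloisFol

/-! ### Frobenius' theorem and tangent brackets in normed spaces -/

section Analysis

open Set Metric

variable {E E' : Type*} [NormedAddCommGroup E] [NormedSpace ℝ E]
  [NormedAddCommGroup E'] [NormedSpace ℝ E']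

open scoped NNReal in
/-- Picard-Lindelöf, with control on the range of the solution. -/
theorem exists_solution_mem_closedBall [CompleteSpace E] {f : ℝ → E → E} {tmin tmax : ℝ}
    {t₀ : Icc tmin tmax} {x₀ : E} {a L K : ℝ≥0} (hf : IsPicardLindelof f t₀ x₀ a 0 L K) :
    ∃ α : ℝ → E, α t₀ = x₀ ∧ (∀ t, α t ∈ closedBall x₀ a) ∧
      ∀ t ∈ Icc tmin tmax, HasDerivWithinAt α (f t (α t)) (Icc tmin tmax) t := by
  obtain ⟨α, hα⟩ := ODE.FunSpace.exists_isFixedPt_next hf (mem_closedBall_self le_rfl)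
  refine ⟨α.compProj, by rw [ODE.FunSpace.compProj_val, ← hα, ODE.FunSpace.next_apply₀],
    fun _ => α.compProj_mem_closedBall hf.mul_max_le, fun t ht ↦ ?_⟩
  apply ODE.hasDerivWithinAt_picard_Icc t₀.2 hf.continuousOn_uncurry
    α.continuous_compProj.continuousOn (fun _ ht' ↦ α.compProj_mem_closedBall hf.mul_max_le)
    x₀ ht |>.congr_of_mem _ ht
  intro t' ht'
  nth_rw 1 [← hα]
  rw [ODE.FunSpace.compProj_of_mem ht', ODE.FunSpace.next_apply]

/-- Second order Taylor estimate for a map whose derivative is Lipschitz on a convex set. -/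
theorem norm_taylor_le {F : Type*} [NormedAddCommGroup F] [NormedSpace ℝ F] {h : E → F}
    {S : Set E} (hS : Convex ℝ S) {K : ℝ} (hK : 0 ≤ K)
    (hd : ∀ x ∈ S, HasFDerivAt h (fderiv ℝ h x) x)
    (hl : ∀ x ∈ S, ∀ y ∈ S, ‖fderiv ℝ h x - fderiv ℝ h y‖ ≤ K * ‖x - y‖)
    {x y : E} (hx : x ∈ S) (hy : y ∈ S) :
    ‖h y - h x - fderiv ℝ h x (y - x)‖ ≤ K * ‖y - x‖ ^ 2 := by
  have hsub : segment ℝ x y ⊆ S := hS.segment_subset hx hy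
  have := Convex.norm_image_sub_le_of_norm_hasFDerivWithin_le' (f := h) (f' := fderiv ℝ h)
    (φ := fderiv ℝ h x) (C := K * ‖y - x‖) (s := segment ℝ x y)
    (fun z hz => (hd z (hsub hz)).hasFDerivWithinAt)
    (fun z hz => (hl z (hsub hz) x hx).trans (by
      gcongr
      obtain ⟨a, b, ha, hb, hab, rfl⟩ := hz
      have : a • x + b • y - x = b • (y - x) := by
        rw [← eq_sub_iff_add_eq] at hab; subst hab; module
      rw [this, norm_smul, Real.norm_of_nonneg hb]
      exact mul_le_of_le_one_left (norm_nonneg _) (by linarith)))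
    (convex_segment x y) (left_mem_segment ℝ x y) (right_mem_segment ℝ x y)
  calc _ ≤ _ := this
    _ = _ := by ring

/-- Quantitative form of Frobenius' theorem: if `h` satisfies the integrability condition on a ball,
the time one map of the radial differential equations integrates `h`. -/
theorem exists_hasFDerivAt_of_integrable [CompleteSpace E] {h : E → E' →L[ℝ] E} {x₀ : E}
    {R C K K₂ : ℝ} (hR : 0 < R) (hC : 0 < C) (hK : 0 < K) (hK₂ : 0 < K₂)
    (hbd : ∀ x ∈ closedBall x₀ R, ‖h x‖ ≤ C)
    (hd : ∀ x ∈ closedBall x₀ R, HasFDerivAt h (fderiv ℝ h x) x)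
    (hbd' : ∀ x ∈ closedBall x₀ R, ‖fderiv ℝ h x‖ ≤ K)
    (hl : ∀ x ∈ closedBall x₀ R, ∀ y ∈ closedBall x₀ R,
      ‖fderiv ℝ h x - fderiv ℝ h y‖ ≤ K₂ * ‖x - y‖)
    (hint : ∀ x ∈ closedBall x₀ R, ∀ v w, fderiv ℝ h x (h x v) w = fderiv ℝ h x (h x w) v) :
    ∃ s : E' → E, s 0 = x₀ ∧ ∃ ε > 0, ∀ v ∈ ball (0 : E') ε,
      s v ∈ closedBall x₀ R ∧ HasFDerivAt s (h (s v)) v := by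
  have hconv : Convex ℝ (closedBall x₀ R) := convex_closedBall x₀ R
  have hlip : ∀ x ∈ closedBall x₀ R, ∀ y ∈ closedBall x₀ R, ‖h x - h y‖ ≤ K * ‖x - y‖ :=
    fun x hx y hy => hconv.norm_image_sub_le_of_norm_hasFDerivWithin_le
      (fun z hz => (hd z hz).hasFDerivWithinAt) hbd' hy hx
  -- For `‖v‖ ≤ ε` the speed is at most `C * ε = R / 2`, so on `[0, 1]` the solution uses half of
  -- the radius. The other half is left for the comparison curve `f` below.
  set ε : ℝ := R / 2 / C with hε
  have hε0 : 0 < ε := by positivity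
  have hlipv : ∀ v : E', LipschitzOnWith (K * ‖v‖).toNNReal (fun x => h x v)
      (closedBall x₀ R) := fun v => by
    refine LipschitzOnWith.of_dist_le_mul fun x hx y hy => ?_
    rw [dist_eq_norm, dist_eq_norm, Real.coe_toNNReal _ (by positivity),
      ← sub_apply]
    calc _ ≤ ‖h x - h y‖ * ‖v‖ := ContinuousLinearMap.le_opNorm _ _
      _ ≤ (K * ‖x - y‖) * ‖v‖ := by gcongr; exact hlip x hx y hy
      _ = _ := by ring
  -- The bound on `v` stands inside the existential so that `choose` gives one curve for every `v`;
  -- for large `v` the curve is a default.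
  have key : ∀ v : E', ∃ c : ℝ → E, ‖v‖ ≤ ε → c 0 = x₀ ∧ (∀ t, c t ∈ closedBall x₀ (R / 2)) ∧
      ∀ t ∈ Icc (0 : ℝ) 1, HasDerivWithinAt c (h (c t) v) (Icc 0 1) t := by
    intro v
    by_cases hv : ‖v‖ ≤ ε
    swap
    · exact ⟨fun _ => x₀, fun h => absurd h hv⟩
    have hsub : closedBall x₀ (R / 2) ⊆ closedBall x₀ R := closedBall_subset_closedBall (by linarith)
    have hPL : IsPicardLindelof (fun _ x => h x v) (tmin := 0) (tmax := 1)
        ⟨0, by simp⟩ x₀ (R / 2).toNNReal 0 (R / 2).toNNReal (K * ‖v‖).toNNReal := by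
      refine ⟨fun _ _ => ?_, fun _ _ => continuousOn_const, fun _ _ x hx => ?_, ?_⟩
      · rw [Real.coe_toNNReal _ (by positivity)]
        exact (hlipv v).mono hsub
      · rw [Real.coe_toNNReal _ (by positivity)] at hx ⊢
        calc _ ≤ ‖h x‖ * ‖v‖ := ContinuousLinearMap.le_opNorm _ _
          _ ≤ C * ε := by gcongr; exact hbd x (hsub hx)
          _ = R / 2 := by rw [hε]; field_simp
      · simp
    obtain ⟨c, hc0, hcb, hc⟩ := exists_solution_mem_closedBall hPL
    refine ⟨c, fun _ => ⟨hc0, fun t => ?_, hc⟩⟩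
    simpa [Real.coe_toNNReal _ (by positivity : 0 ≤ R / 2)] using hcb t
  choose c hc using key
  have hc00 : c 0 1 = x₀ := by
    obtain ⟨h0, -, hd0⟩ := hc 0 (by simpa using hε0.le)
    rw [← h0]
    exact constant_of_derivWithin_zero (fun t ht => (hd0 t ht).differentiableWithinAt)
      (fun t ht => by
        have := (hd0 t (Ico_subset_Icc_self ht)).derivWithin
          (uniqueDiffOn_Icc zero_lt_one t (Ico_subset_Icc_self ht))
        simpa using this) 1 (by simp)
  refine ⟨fun v => c v 1, hc00, ε, hε0, fun v hv => ⟨?_, ?_⟩⟩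
  · rw [mem_ball_zero_iff] at hv
    exact closedBall_subset_closedBall (by linarith) ((hc v hv.le).2.1 1)
  rw [mem_ball_zero_iff] at hv
  obtain ⟨hv0, hvb, hvd⟩ := hc v hv.le
  -- `D * ‖w‖ ^ 2` will bound the defect of the comparison curve, `L` the Lipschitz constant of the
  -- equation, and `G` is the resulting factor in Grönwall's inequality at time one.
  set D : ℝ := K * C + K₂ * C ^ 2 * ε with hD
  have hD0 : 0 < D := by positivity
  set L : ℝ := K * ε with hL
  have hL0 : 0 < L := by positivity
  set G : ℝ := D / L * (Real.exp L - 1) with hG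
  have hest : ∀ w : E', ‖v + w‖ ≤ ε → ‖w‖ ≤ ε →
      ‖c (v + w) 1 - c v 1 - h (c v 1) w‖ ≤ G * ‖w‖ ^ 2 := by
    intro w hvw hw
    obtain ⟨hw0, hwb, hwd⟩ := hc (v + w) hvw
    have hR2 : ∀ t, c v t ∈ closedBall x₀ R := fun t =>
      closedBall_subset_closedBall (by linarith) (hvb t)
    have hR3 : ∀ t, c (v + w) t ∈ closedBall x₀ R := fun t =>
      closedBall_subset_closedBall (by linarith) (hwb t)
    have hhw : ∀ t, ‖h (c v t) w‖ ≤ C * ‖w‖ := fun t =>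
      (ContinuousLinearMap.le_opNorm _ _).trans (by gcongr; exact hbd _ (hR2 t))
    -- First order prediction of `c (v + w)`: by `hint`, the variation `t • h (c v t) w` solves the
    -- equation linearized along `c v`.
    set f : ℝ → E := fun t => c v t + t • h (c v t) w with hf
    have hfd : ∀ t ∈ Icc (0 : ℝ) 1, HasDerivWithinAt f
        (h (c v t) v + (t • fderiv ℝ h (c v t) (h (c v t) v) w + (1 : ℝ) • h (c v t) w))
        (Icc 0 1) t := by
      intro t ht
      refine (hvd t ht).add ?_
      have h1 : HasDerivWithinAt (fun t => h (c v t)) (fderiv ℝ h (c v t) (h (c v t) v))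
          (Icc 0 1) t := (hd _ (hR2 t)).comp_hasDerivWithinAt t (hvd t ht)
      exact (hasDerivWithinAt_id t _).smul
        (((ContinuousLinearMap.apply ℝ E w).hasFDerivAt.comp_hasDerivWithinAt t h1))
    have hIci : ∀ {g : ℝ → E} {g' : E} {t : ℝ}, t ∈ Ico (0 : ℝ) 1 →
        HasDerivWithinAt g g' (Icc 0 1) t → HasDerivWithinAt g g' (Ici t) t :=
      fun {g g' t} ht hg => hg.mono_of_mem_nhdsWithin
        (Filter.mem_of_superset (Icc_mem_nhdsGE ht.2) (Icc_subset_Icc_left ht.1))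
    have hfR : ∀ t ∈ Icc (0 : ℝ) 1, f t ∈ closedBall x₀ R := by
      intro t ht
      rw [mem_closedBall_iff_norm]
      calc ‖f t - x₀‖ = ‖(c v t - x₀) + t • h (c v t) w‖ := by rw [hf]; congr 1; simp only; abel
        _ ≤ R / 2 + 1 * (C * ε) := by
          refine (norm_add_le _ _).trans (add_le_add (mem_closedBall_iff_norm.mp (hvb t)) ?_)
          rw [norm_smul, Real.norm_of_nonneg ht.1]
          have := hhw t
          have h1 : C * ‖w‖ ≤ C * ε := by gcongr
          exact mul_le_mul ht.2 (this.trans h1) (norm_nonneg _) zero_le_one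
        _ = R := by rw [hε]; field_simp; ring
    have hmain := dist_le_of_approx_trajectories_ODE_of_mem (v := fun _ x => h x (v + w))
      (s := fun _ => closedBall x₀ R) (K := L.toNNReal) (a := 0) (b := 1) (f := f) (g := c (v + w))
      (f' := fun t => h (c v t) v +
        (t • fderiv ℝ h (c v t) (h (c v t) v) w + (1 : ℝ) • h (c v t) w))
      (g' := fun t => h (c (v + w) t) (v + w)) (εf := D * ‖w‖ ^ 2) (εg := 0) (δ := 0)
      (fun t _ => (hlipv (v + w)).weaken (Real.toNNReal_le_toNNReal (by rw [hL]; gcongr)))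
      (fun t ht => (hfd t ht).continuousWithinAt)
      (fun t ht => hIci ht (hfd t (Ico_subset_Icc_self ht)))
      (fun t ht => ?_) (fun t ht => hfR t (Ico_subset_Icc_self ht))
      (fun t ht => (hwd t ht).continuousWithinAt)
      (fun t ht => hIci ht (hwd t (Ico_subset_Icc_self ht)))
      (fun t _ => by simp) (fun t _ => hR3 t) (by simp [hf, hv0, hw0])
    · have h1 := hmain 1 (by simp)
      rw [dist_comm, dist_eq_norm, gronwallBound_of_K_ne_0 (by simp [hL0])] at h1
      rw [Real.coe_toNNReal _ hL0.le] at h1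
      calc _ = ‖c (v + w) 1 - f 1‖ := by rw [hf]; congr 1; simp only [one_smul]; abel
        _ ≤ _ := h1
        _ = _ := by rw [hG]; simp; ring
    · have ht01 := Ico_subset_Icc_self ht
      have htay := norm_taylor_le hconv hK₂.le hd hl (hR2 t) (hfR t ht01)
      have hfc : f t - c v t = t • h (c v t) w := by simp [hf]
      rw [hfc] at htay
      have htw : ‖t • h (c v t) w‖ ≤ C * ‖w‖ := by
        rw [norm_smul, Real.norm_of_nonneg ht01.1]
        exact (mul_le_of_le_one_left (norm_nonneg _) ht01.2).trans (hhw t)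
      set r := h (f t) - h (c v t) - fderiv ℝ h (c v t) (t • h (c v t) w) with hr
      -- Integrability cancels the terms linear in `w`; what remains is quadratic in `w`.
      have e1 : h (c v t) v + (t • fderiv ℝ h (c v t) (h (c v t) v) w + (1 : ℝ) • h (c v t) w)
          - h (f t) (v + w) = -(fderiv ℝ h (c v t) (t • h (c v t) w) w + r (v + w)) := by
        have e2 : h (f t) = r + h (c v t) + fderiv ℝ h (c v t) (t • h (c v t) w) := by
          rw [hr]; abel
        rw [e2, hint _ (hR2 t) v w]
        simp only [map_add, map_smul, add_apply, smul_apply,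
          one_smul]
        abel
      rw [dist_eq_norm, e1, norm_neg]
      calc _ ≤ ‖fderiv ℝ h (c v t) (t • h (c v t) w) w‖ + ‖r (v + w)‖ := norm_add_le _ _
        _ ≤ (K * (C * ‖w‖)) * ‖w‖ + (K₂ * (C * ‖w‖) ^ 2) * ε := by
          refine add_le_add ?_ ?_
          · refine (ContinuousLinearMap.le_opNorm _ _).trans ?_
            gcongr
            refine (ContinuousLinearMap.le_opNorm _ _).trans ?_
            gcongr
            exact hbd' _ (hR2 t)
          · refine (ContinuousLinearMap.le_opNorm _ _).trans ?_
            refine mul_le_mul (htay.trans ?_) hvw (norm_nonneg _) (by positivity)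
            gcongr
        _ = D * ‖w‖ ^ 2 := by rw [hD]; ring
  rw [hasFDerivAt_iff_isLittleO_nhds_zero]
  have hO : (fun w => c (v + w) 1 - c v 1 - h (c v 1) w) =O[𝓝 0] fun w : E' => ‖w‖ ^ 2 := by
    refine Asymptotics.IsBigO.of_bound G ?_
    have hpos : 0 < ε - ‖v‖ := by linarith
    filter_upwards [ball_mem_nhds (0 : E') hpos] with w hw
    rw [mem_ball_zero_iff] at hw
    refine (hest w ((norm_add_le _ _).trans (by linarith)) (by linarith [norm_nonneg v])).trans ?_
    simp
  refine hO.trans_isLittleO ?_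
  have := Asymptotics.isLittleO_pow_id (𝕜 := ℝ) (n := 2) one_lt_two
  exact (this.comp_tendsto (tendsto_norm_zero (E := E'))).trans_isBigO
    ((Asymptotics.isBigO_refl _ _).norm_left)

/-- Frobenius' theorem for flat connections in local coordinates. -/
theorem exists_contDiffAt_of_integrable [CompleteSpace E] {h : E → E' →L[ℝ] E} {x₀ : E}
    (hh : ∀ᶠ x in 𝓝 x₀, ContDiffAt ℝ ∞ h x)
    (hint : ∀ᶠ x in 𝓝 x₀, ∀ v w, fderiv ℝ h x (h x v) w = fderiv ℝ h x (h x w) v) :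
    ∃ s : E' → E, s 0 = x₀ ∧ ∀ᶠ v in 𝓝 (0 : E'), ContDiffAt ℝ ∞ s v ∧ HasFDerivAt s (h (s v)) v := by
  have h0 : ContDiffAt ℝ ∞ h x₀ := hh.self_of_nhds
  have h1 : ContDiffAt ℝ 1 (fderiv ℝ h) x₀ :=
    h0.fderiv_right (m := 1) (by norm_cast)
  obtain ⟨K₂, t₂, ht₂, hl⟩ := h1.exists_lipschitzOnWith
  have hcont : ContinuousAt h x₀ := h0.continuousAt
  have hb : ∀ᶠ x in 𝓝 x₀, ‖h x‖ < ‖h x₀‖ + 1 :=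
    hcont.norm.eventually_lt continuousAt_const (lt_add_one _)
  have hb' : ∀ᶠ x in 𝓝 x₀, ‖fderiv ℝ h x‖ < ‖fderiv ℝ h x₀‖ + 1 := by
    filter_upwards [Metric.continuousAt_iff'.mp (hl.continuousOn.continuousAt ht₂) 1 one_pos] with x hx
    rw [dist_eq_norm] at hx
    have := norm_sub_norm_le (fderiv ℝ h x) (fderiv ℝ h x₀)
    linarith
  obtain ⟨R, hR, hball⟩ := nhds_basis_closedBall.eventually_iff.mp
    ((((hh.and hint).and hb).and hb').and (Filter.eventually_mem_set.mpr ht₂))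
  obtain ⟨s, hs0, ε, hε, hs⟩ := exists_hasFDerivAt_of_integrable (h := h) (x₀ := x₀) (R := R)
    (C := ‖h x₀‖ + 1) (K := ‖fderiv ℝ h x₀‖ + 1) (K₂ := K₂ + 1) hR (by positivity) (by positivity)
    (by positivity) (fun x hx => (hball hx).1.1.2.le)
    (fun x hx => ((hball hx).1.1.1.1.differentiableAt (by simp)).hasFDerivAt)
    (fun x hx => (hball hx).1.2.le)
    (fun x hx y hy => (hl.norm_sub_le (hball hx).2 (hball hy).2).trans (by gcongr; simp))
    (fun x hx => (hball hx).1.1.1.2)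
  refine ⟨s, hs0, ?_⟩
  -- Bootstrapping: the derivative of `s` is `h ∘ s`, so `s` gains one derivative at each step.
  have hsm : ∀ n : ℕ, ContDiffOn ℝ n s (ball 0 ε) := by
    intro n
    induction n with
    | zero =>
      exact contDiffOn_zero.mpr fun v hv => (hs v hv).2.continuousAt.continuousWithinAt
    | succ n ih =>
      have : ContDiffOn ℝ ((n : WithTop ℕ∞) + 1) s (ball 0 ε) := by
        refine (contDiffOn_succ_iff_fderiv_of_isOpen isOpen_ball).mpr
          ⟨fun v hv => (hs v hv).2.differentiableAt.differentiableWithinAt, by simp, ?_⟩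
        have : ContDiffOn ℝ n (fun v => h (s v)) (ball 0 ε) := fun v hv =>
          (((hball (hs v hv).1).1.1.1.1).of_le (by exact_mod_cast le_top)).comp_contDiffWithinAt v
            (ih v hv)
        exact this.congr fun v hv => (hs v hv).2.fderiv
      exact_mod_cast this
  filter_upwards [ball_mem_nhds (0 : E') hε] with v hv
  exact ⟨(contDiffOn_infty.mpr hsm).contDiffAt (isOpen_ball.mem_nhds hv), (hs v hv).2⟩

/-- Curves tangent to a connection with the same projection agree if they agree at one point. -/
theorem eqOn_of_hasDerivAt_connection {h : E → E' →L[ℝ] E} {S : Set E} {K : NNReal}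
    (hl : LipschitzOnWith K h S) {β : ℝ → E'} {C : ℝ} {a b t₀ : ℝ} (ht₀ : t₀ ∈ Ioo a b)
    (hβ : ∀ t ∈ Ioo a b, ‖β t‖ ≤ C) {f g : ℝ → E}
    (hfc : ContinuousOn f (Icc a b)) (hgc : ContinuousOn g (Icc a b))
    (hf : ∀ t ∈ Ioo a b, HasDerivAt f (h (f t) (β t)) t)
    (hg : ∀ t ∈ Ioo a b, HasDerivAt g (h (g t) (β t)) t)
    (hfs : ∀ t ∈ Ioo a b, f t ∈ S) (hgs : ∀ t ∈ Ioo a b, g t ∈ S)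
    (heq : f t₀ = g t₀) : EqOn f g (Icc a b) := by
  refine ODE_solution_unique_of_mem_Icc (v := fun t x => h x (β t)) (s := fun _ => S)
    (K := K * C.toNNReal) (fun t ht => ?_) ht₀ hfc hf hfs hgc hg hgs heq
  refine LipschitzOnWith.of_dist_le_mul fun x hx y hy => ?_
  rw [dist_eq_norm, dist_eq_norm, ← sub_apply]
  calc _ ≤ ‖h x - h y‖ * ‖β t‖ := ContinuousLinearMap.le_opNorm _ _
    _ ≤ (K * ‖x - y‖) * C.toNNReal := by
      gcongr
      · exact hl.norm_sub_le hx hy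
      · exact (hβ t ht).trans (Real.le_coe_toNNReal C)
    _ = _ := by push_cast; ring

/-- The Lie bracket of two vector fields tangent to an immersed manifold is tangent to it. -/
theorem lieBracket_mem_range {V W : E → E} {s : E' → E} {ρ : E → E'} {u₀ : E'}
    (hs : ContDiffAt ℝ 2 s u₀) (hρ : ContDiffAt ℝ 2 ρ (s u₀)) (hρs : ∀ᶠ u in 𝓝 u₀, ρ (s u) = u)
    (hV : DifferentiableAt ℝ V (s u₀)) (hW : DifferentiableAt ℝ W (s u₀))
    (hVs : ∀ᶠ u in 𝓝 u₀, V (s u) ∈ (fderiv ℝ s u).range)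
    (hWs : ∀ᶠ u in 𝓝 u₀, W (s u) ∈ (fderiv ℝ s u).range) :
    VectorField.lieBracket ℝ V W (s u₀) ∈ (fderiv ℝ s u₀).range := by
  have hsc : ContinuousAt s u₀ := hs.continuousAt
  have hsd : ∀ᶠ u in 𝓝 u₀, DifferentiableAt ℝ s u :=
    (hs.eventually (by simp)).mono fun u hu => hu.differentiableAt (by simp)
  have hρd : ∀ᶠ u in 𝓝 u₀, DifferentiableAt ℝ ρ (s u) :=
    hsc.eventually ((hρ.eventually (by simp)).mono fun u hu => hu.differentiableAt (by simp))
  have hs' : DifferentiableAt ℝ (fderiv ℝ s) u₀ :=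
    (hs.fderiv_right (m := 1) (by norm_num)).differentiableAt (by simp)
  have hρ' : DifferentiableAt ℝ (fderiv ℝ ρ) (s u₀) :=
    (hρ.fderiv_right (m := 1) (by norm_num)).differentiableAt (by simp)
  have hs0 := hsd.self_of_nhds
  have lift : ∀ X : E → E, DifferentiableAt ℝ X (s u₀) →
      (∀ᶠ u in 𝓝 u₀, X (s u) ∈ (fderiv ℝ s u).range) →
      ∃ X' : E' → E', DifferentiableAt ℝ X' u₀ ∧ ∀ᶠ u in 𝓝 u₀, X (s u) = fderiv ℝ s u (X' u) := by
    intro X hX hXs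
    -- The differential of the left inverse `ρ` inverts that of `s` on its range, so it recovers the
    -- field on `E'` related to `X`, differentiably in `u`.
    refine ⟨fun u => fderiv ℝ ρ (s u) (X (s u)),
      (hρ'.comp u₀ hs0).clm_apply (hX.comp u₀ hs0), ?_⟩
    filter_upwards [hXs, hρs.eventually_nhds, hsd, hρd] with u ⟨a, ha⟩ hu hsu hρu
    have : (fderiv ℝ ρ (s u)).comp (fderiv ℝ s u) = ContinuousLinearMap.id ℝ E' := by
      rw [← fderiv_comp u hρu hsu]
      have : ρ ∘ s =ᶠ[𝓝 u] id := hu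
      rw [this.fderiv_eq, fderiv_id]
    have h2 := congrArg (fun T => T a) this
    change fderiv ℝ ρ (s u) (fderiv ℝ s u a) = a at h2
    rw [← ha]
    change _ = fderiv ℝ s u (fderiv ℝ ρ (s u) (fderiv ℝ s u a))
    rw [h2]; rfl
  obtain ⟨V', hV', hVe⟩ := lift V hV hVs
  obtain ⟨W', hW', hWe⟩ := lift W hW hWs
  have deriv : ∀ X : E → E, ∀ X' : E' → E', DifferentiableAt ℝ X (s u₀) →
      DifferentiableAt ℝ X' u₀ → (∀ᶠ u in 𝓝 u₀, X (s u) = fderiv ℝ s u (X' u)) → ∀ v,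
      fderiv ℝ X (s u₀) (fderiv ℝ s u₀ v) =
        fderiv ℝ (fderiv ℝ s) u₀ v (X' u₀) + fderiv ℝ s u₀ (fderiv ℝ X' u₀ v) := by
    intro X X' hX hX' he v
    have h1 : fderiv ℝ (X ∘ s) u₀ = fderiv ℝ (fun u => fderiv ℝ s u (X' u)) u₀ :=
      Filter.EventuallyEq.fderiv_eq he
    rw [fderiv_comp u₀ hX hs0, fderiv_clm_apply hs' hX'] at h1
    have h2 := congrArg (fun T => T v) h1
    simp only [ContinuousLinearMap.comp_apply, add_apply,
      ContinuousLinearMap.flip_apply] at h2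
    rw [h2, add_comm]
  -- The second derivatives of `s` drop out of the bracket by symmetry, leaving the image under the
  -- differential of `s` of the bracket of `V'` and `W'`.
  have hsymm : ∀ v w, fderiv ℝ (fderiv ℝ s) u₀ v w = fderiv ℝ (fderiv ℝ s) u₀ w v :=
    fun v w => (hs.isSymmSndFDerivAt (by simp)).eq v w
  refine ⟨fderiv ℝ W' u₀ (V' u₀) - fderiv ℝ V' u₀ (W' u₀), ?_⟩
  rw [VectorField.lieBracket, hVe.self_of_nhds, hWe.self_of_nhds, deriv W W' hW hW' hWe,
    deriv V V' hV hV' hVe, hsymm (V' u₀)]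
  simp

end Analysis

/-! ### Flat connections read in charts -/

section Charts

/-- A map with a differentiable local left inverse has injective differential. -/
theorem mfderiv_mfderiv_of_leftInverse {E₁ H₁ M₁ E₂ H₂ M₂ : Type*} [NormedAddCommGroup E₁]
    [NormedSpace ℝ E₁] [TopologicalSpace H₁] {I₁ : ModelWithCorners ℝ E₁ H₁} [TopologicalSpace M₁]
    [ChartedSpace H₁ M₁] [NormedAddCommGroup E₂] [NormedSpace ℝ E₂] [TopologicalSpace H₂]
    {I₂ : ModelWithCorners ℝ E₂ H₂} [TopologicalSpace M₂] [ChartedSpace H₂ M₂]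
    {f : M₁ → M₂} {g : M₂ → M₁} {x : M₁} (hg : MDifferentiableAt I₂ I₁ g (f x))
    (hf : MDifferentiableAt I₁ I₂ f x) (h : ∀ᶠ z in 𝓝 x, g (f z) = z) (v : TangentSpace I₁ x) :
    (mfderiv I₂ I₁ g (f x) (mfderiv I₁ I₂ f x v) : E₁) = v := by
  have h1 := mfderiv_comp_apply x hg hf v
  have h2 : mfderiv I₁ I₁ (g ∘ f) x = mfderiv I₁ I₁ id x :=
    Filter.EventuallyEq.mfderiv_eq (I := I₁) (I' := I₁) (f₁ := g ∘ f) (f := id) h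
  have h3 : (mfderiv I₁ I₁ (g ∘ f) x v : E₁) = mfderiv I₁ I₁ id x v := 
    congrArg (fun T : E₁ →L[ℝ] E₁ => T v) h2
  exact (h1.symm.trans h3).trans (by rw [mfderiv_id]; rfl)

variable (M : SmoothMfd.{u}) (x : M)

theorem extChartAt_symm_contMDiffAt {y : EuclideanSpace ℝ (Fin M.dim)}
    (hy : y ∈ (extChartAt (𝓡 M.dim) x).target) :
    ContMDiffAt (𝓡 M.dim) (𝓡 M.dim) ∞ (extChartAt (𝓡 M.dim) x).symm y :=
  (contMDiffOn_extChartAt_symm x).contMDiffAt ((isOpen_extChartAt_target x).mem_nhds hy)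

theorem extChartAt_contMDiffAt {q : M} (hq : q ∈ (extChartAt (𝓡 M.dim) x).source) :
    ContMDiffAt (𝓡 M.dim) (𝓡 M.dim) ∞ (extChartAt (𝓡 M.dim) x) q :=
  contMDiffAt_extChartAt' (by simpa using hq)

theorem mfderiv_extChartAt_symm_mfderiv {q : M} (hq : q ∈ (extChartAt (𝓡 M.dim) x).source)
    (v : TangentSpace (𝓡 M.dim) q) :
    mfderiv (𝓡 M.dim) (𝓡 M.dim) (extChartAt (𝓡 M.dim) x).symm (extChartAt (𝓡 M.dim) x q)
      (mfderiv (𝓡 M.dim) (𝓡 M.dim) (extChartAt (𝓡 M.dim) x) q v) = v := by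
  refine mfderiv_mfderiv_of_leftInverse ?_ ?_ ?_ v
  · exact (extChartAt_symm_contMDiffAt M x ((extChartAt _ x).map_source hq)).mdifferentiableAt
      (by simp)
  · exact (extChartAt_contMDiffAt M x hq).mdifferentiableAt (by simp)
  · filter_upwards [(isOpen_extChartAt_source x).mem_nhds hq] with z hz
    exact (extChartAt _ x).left_inv hz

theorem mfderiv_extChartAt_mfderiv_symm {y : EuclideanSpace ℝ (Fin M.dim)}
    (hy : y ∈ (extChartAt (𝓡 M.dim) x).target) (v : TangentSpace (𝓡 M.dim) y) :
    mfderiv (𝓡 M.dim) (𝓡 M.dim) (extChartAt (𝓡 M.dim) x) ((extChartAt (𝓡 M.dim) x).symm y)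
      (mfderiv (𝓡 M.dim) (𝓡 M.dim) (extChartAt (𝓡 M.dim) x).symm y v) = v := by
  refine mfderiv_mfderiv_of_leftInverse ?_ ?_ ?_ v
  · exact (extChartAt_contMDiffAt M x ((extChartAt _ x).map_target hy)).mdifferentiableAt
      (by simp)
  · exact (extChartAt_symm_contMDiffAt M x hy).mdifferentiableAt (by simp)
  · filter_upwards [(isOpen_extChartAt_target x).mem_nhds hy] with z hz
    exact (extChartAt _ x).right_inv hz

theorem isInvertible_mfderiv_extChartAt_symm {y : EuclideanSpace ℝ (Fin M.dim)}
    (hy : y ∈ (extChartAt (𝓡 M.dim) x).target) :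
    (mfderiv (𝓡 M.dim) (𝓡 M.dim) (extChartAt (𝓡 M.dim) x).symm y).IsInvertible := by
  have := isInvertible_mfderivWithin_extChartAt_symm (I := 𝓡 M.dim) (x := x) hy
  simpa using this

theorem injective_mfderiv_extChartAt_symm {y : EuclideanSpace ℝ (Fin M.dim)}
    (hy : y ∈ (extChartAt (𝓡 M.dim) x).target) :
    Function.Injective (mfderiv (𝓡 M.dim) (𝓡 M.dim) (extChartAt (𝓡 M.dim) x).symm y) :=
  Function.LeftInverse.injective (mfderiv_extChartAt_mfderiv_symm M x hy)

/-- A smooth vector field read in a chart is smooth. -/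
theorem contDiffAt_mpullback_extChartAt_symm {V : ∀ q : M, TangentSpace (𝓡 M.dim) q} {U : Set M}
    (hU : IsOpen U) (hV : SmoothFieldOn M V U) {y : EuclideanSpace ℝ (Fin M.dim)}
    (hy : y ∈ (extChartAt (𝓡 M.dim) x).target) (hyU : (extChartAt (𝓡 M.dim) x).symm y ∈ U) :
    ContDiffAt ℝ ∞ (VectorField.mpullback (𝓡 M.dim) (𝓡 M.dim) (extChartAt (𝓡 M.dim) x).symm V) y := by
  rw [← contMDiffAt_vectorSpace_iff_contDiffAt]
  exact ContMDiffAt.mpullback_vectorField_preimage (hV.contMDiffAt (hU.mem_nhds hyU))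
    (extChartAt_symm_contMDiffAt M x hy) (isInvertible_mfderiv_extChartAt_symm M x hy) (by simp)

variable {M} {B : SmoothMfd.{u}}

/-- A map of manifolds read in the preferred charts at `x` and its image. -/
noncomputable def inCharts (π : M → B) (x : M) :
    EuclideanSpace ℝ (Fin M.dim) → EuclideanSpace ℝ (Fin B.dim) :=
  fun y => extChartAt (𝓡 B.dim) (π x) (π ((extChartAt (𝓡 M.dim) x).symm y))

/-- The set of coordinates of points whose image lies in the preferred chart at `π x`. -/
def chartDomain (π : M → B) (x : M) : Set (EuclideanSpace ℝ (Fin M.dim)) :=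
  (extChartAt (𝓡 M.dim) x).target ∩
    (extChartAt (𝓡 M.dim) x).symm ⁻¹' (π ⁻¹' (extChartAt (𝓡 B.dim) (π x)).source)

theorem chartDomain_mem_nhds {π : M → B} (hπ : Continuous π) (x : M) :
    chartDomain π x ∈ 𝓝 (extChartAt (𝓡 M.dim) x x) := by
  refine Filter.inter_mem (extChartAt_target_mem_nhds x) ?_
  have h1 : ContinuousAt (fun y => π ((extChartAt (𝓡 M.dim) x).symm y)) (extChartAt (𝓡 M.dim) x x) :=
    hπ.continuousAt.comp (continuousAt_extChartAt_symm x)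
  refine h1.preimage_mem_nhds ?_
  rw [extChartAt_to_inv]
  exact extChartAt_source_mem_nhds (I := 𝓡 B.dim) (π x)

theorem isOpen_chartDomain {π : M → B} (hπ : Continuous π) (x : M) :
    IsOpen (chartDomain π x) :=
  ((continuousOn_extChartAt_symm x).isOpen_inter_preimage (isOpen_extChartAt_target x)
    ((isOpen_extChartAt_source (π x)).preimage hπ))

theorem inCharts_contDiffAt {π : M → B} (hπ : ContMDiff (𝓡 M.dim) (𝓡 B.dim) ∞ π) {x : M}
    {y : EuclideanSpace ℝ (Fin M.dim)} (hy : y ∈ chartDomain π x) :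
    ContDiffAt ℝ ∞ (inCharts π x) y := by
  rw [← contMDiffAt_iff_contDiffAt]
  exact (extChartAt_contMDiffAt B (π x) hy.2).comp y
    (hπ.contMDiffAt.comp y (extChartAt_symm_contMDiffAt M x hy.1))

theorem fderiv_inCharts {π : M → B} (hπ : ContMDiff (𝓡 M.dim) (𝓡 B.dim) ∞ π) {x : M}
    {y : EuclideanSpace ℝ (Fin M.dim)} (hy : y ∈ chartDomain π x)
    (w : EuclideanSpace ℝ (Fin M.dim)) :
    fderiv ℝ (inCharts π x) y w =
      mfderiv (𝓡 B.dim) (𝓡 B.dim) (extChartAt (𝓡 B.dim) (π x))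
        (π ((extChartAt (𝓡 M.dim) x).symm y))
        (mfderiv (𝓡 M.dim) (𝓡 B.dim) π ((extChartAt (𝓡 M.dim) x).symm y)
          (mfderiv (𝓡 M.dim) (𝓡 M.dim) (extChartAt (𝓡 M.dim) x).symm y w)) := by
  have h1 := (extChartAt_symm_contMDiffAt M x hy.1).mdifferentiableAt (by simp)
  have h2 : MDifferentiableAt (𝓡 M.dim) (𝓡 B.dim) π ((extChartAt (𝓡 M.dim) x).symm y) :=
    hπ.mdifferentiable (by simp) _
  have h3 := (extChartAt_contMDiffAt B (π x) hy.2).mdifferentiableAt (by simp)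
  rw [← mfderiv_eq_fderiv]
  have h4 := mfderiv_comp_apply y h2 h1 w
  have h5 := mfderiv_comp_apply y (g := extChartAt (𝓡 B.dim) (π x))
    (f := π ∘ (extChartAt (𝓡 M.dim) x).symm) h3 (h2.comp y h1) w
  rw [h4] at h5
  exact h5

/-- A flat connection is locally the range of a smooth field of linear maps lifting tangent vectors
of the base. -/
theorem exists_local_lift {π : M → B} (hπ : ContMDiff (𝓡 M.dim) (𝓡 B.dim) ∞ π) (F : Foliation M)
    (hF : IsFlatEhresmannConnection π F) (x : M) :
    ∃ h : EuclideanSpace ℝ (Fin M.dim) →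
        EuclideanSpace ℝ (Fin B.dim) →L[ℝ] EuclideanSpace ℝ (Fin M.dim),
      ∀ᶠ y in 𝓝 (extChartAt (𝓡 M.dim) x x), y ∈ chartDomain π x ∧ ContDiffAt ℝ ∞ h y ∧
        (∀ v, mfderiv (𝓡 M.dim) (𝓡 M.dim) (extChartAt (𝓡 M.dim) x).symm y (h y v) ∈
          F.space ((extChartAt (𝓡 M.dim) x).symm y)) ∧
        (∀ v, fderiv ℝ (inCharts π x) y (h y v) = v) ∧
        ∀ w, mfderiv (𝓡 M.dim) (𝓡 M.dim) (extChartAt (𝓡 M.dim) x).symm y w ∈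
          F.space ((extChartAt (𝓡 M.dim) x).symm y) → w = h y (fderiv ℝ (inCharts π x) y w) := by
  obtain ⟨r, hr⟩ := F.subbundle
  obtain ⟨U, hU, hxU, X, hX, hspan⟩ := hr x
  let X' : Fin r → EuclideanSpace ℝ (Fin M.dim) → EuclideanSpace ℝ (Fin M.dim) := fun i =>
    VectorField.mpullback (𝓡 M.dim) (𝓡 M.dim) (extChartAt (𝓡 M.dim) x).symm (X i)
  -- `T y` sends coefficients to combinations of the frame of `F`, and `A y` projects them to the
  -- base. As the connection is flat, `A y` is invertible, and the lift is `T y` after its inverse.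
  let T : EuclideanSpace ℝ (Fin M.dim) → (Fin r → ℝ) →L[ℝ] EuclideanSpace ℝ (Fin M.dim) :=
    fun y => ∑ i, (ContinuousLinearMap.proj (R := ℝ) (φ := fun _ : Fin r => ℝ) i).smulRight (X' i y)
  let A : EuclideanSpace ℝ (Fin M.dim) → (Fin r → ℝ) →L[ℝ] EuclideanSpace ℝ (Fin B.dim) :=
    fun y => (fderiv ℝ (inCharts π x) y).comp (T y)
  have hT : ∀ y c, T y c = ∑ i, c i • X' i y := by
    intro y c; simp [T]
  refine ⟨fun y => (T y).comp (A y).inverse, ?_⟩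
  have hUn : ∀ᶠ y in 𝓝 (extChartAt (𝓡 M.dim) x x), (extChartAt (𝓡 M.dim) x).symm y ∈ U := by
    refine (continuousAt_extChartAt_symm x).preimage_mem_nhds ?_
    simpa using hU.mem_nhds hxU
  filter_upwards [chartDomain_mem_nhds hπ.continuous x, hUn] with y hy hyU
  set q := (extChartAt (𝓡 M.dim) x).symm y with hq
  have hX' : ∀ i, mfderiv (𝓡 M.dim) (𝓡 M.dim) (extChartAt (𝓡 M.dim) x).symm y (X' i y) = X i q := by
    intro i
    exact (isInvertible_mfderiv_extChartAt_symm M x hy.1).self_apply_inverse _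
  have hXs : ∀ i, ContDiffAt ℝ ∞ (X' i) y := fun i =>
    contDiffAt_mpullback_extChartAt_symm M x hU (hX i) hy.1 hyU
  have hTs : ContDiffAt ℝ ∞ T y := by
    refine ContDiffAt.sum fun i _ => ?_
    exact ContDiffAt.smulRight contDiffAt_const (hXs i)
  have hAs : ContDiffAt ℝ ∞ A y :=
    ((inCharts_contDiffAt hπ hy).fderiv_right (m := ∞) (by simp)).clm_comp hTs
  have hTX : ∀ c, mfderiv (𝓡 M.dim) (𝓡 M.dim) (extChartAt (𝓡 M.dim) x).symm y (T y c) =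
      ∑ i, c i • X i q := by
    intro c
    rw [hT]
    refine (map_sum _ _ _).trans (Finset.sum_congr rfl fun i _ => ?_)
    exact (map_smul _ _ _).trans (by rw [hX'])
  have hTF : ∀ c, mfderiv (𝓡 M.dim) (𝓡 M.dim) (extChartAt (𝓡 M.dim) x).symm y (T y c) ∈
      F.space q := by
    intro c
    rw [hTX, ← (hspan q hyU).2]
    exact Submodule.sum_mem _ fun i _ => Submodule.smul_mem _ _ (Submodule.subset_span ⟨i, rfl⟩)
  have hFT : ∀ w, mfderiv (𝓡 M.dim) (𝓡 M.dim) (extChartAt (𝓡 M.dim) x).symm y w ∈ F.space q →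
      ∃ c, T y c = w := by
    intro w hw
    rw [← (hspan q hyU).2, Submodule.mem_span_range_iff_exists_fun] at hw
    obtain ⟨c, hc⟩ := hw
    exact ⟨c, injective_mfderiv_extChartAt_symm M x hy.1 ((hTX c).trans hc)⟩
  have hker : ∀ w, mfderiv (𝓡 M.dim) (𝓡 M.dim) (extChartAt (𝓡 M.dim) x).symm y w ∈ F.space q →
      fderiv ℝ (inCharts π x) y w = 0 → w = 0 := by
    intro w hw h0
    replace h0 := (fderiv_inCharts hπ hy w).symm.trans h0
    have h1 := (mfderiv_extChartAt_symm_mfderiv B (π x) hy.2 _).symm.trans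
      ((congrArg _ h0).trans (map_zero _))
    have h2 := (hF q).1 (a₁ := ⟨_, hw⟩) (a₂ := 0) (h1.trans (map_zero _).symm)
    exact injective_mfderiv_extChartAt_symm M x hy.1
      ((congrArg Subtype.val h2).trans (map_zero _).symm)
  have hAinj : Function.Injective (A y) := by
    rw [injective_iff_map_eq_zero]
    intro c hc
    have h1 : T y c = 0 := hker _ (hTF c) hc
    have h2 := (hTX c).symm.trans ((congrArg _ h1).trans (map_zero _))
    have h3 := Fintype.linearIndependent_iff.mp (hspan q hyU).1 c h2
    exact funext h3
  have hAsurj : Function.Surjective (A y) := by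
    intro v
    obtain ⟨⟨w, hw⟩, hwv⟩ := (hF q).2
      (mfderiv (𝓡 B.dim) (𝓡 B.dim) (extChartAt (𝓡 B.dim) (π x)).symm
        (extChartAt (𝓡 B.dim) (π x) (π q)) v)
    have h3 := (isInvertible_mfderiv_extChartAt_symm M x hy.1).self_apply_inverse w
    obtain ⟨c, hc⟩ := hFT _ (h3 ▸ hw)
    refine ⟨c, ?_⟩
    change fderiv ℝ (inCharts π x) y (T y c) = v
    refine (congrArg _ hc).trans ((fderiv_inCharts hπ hy _).trans ?_)
    have h4 := mfderiv_extChartAt_mfderiv_symm B (π x)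
      ((extChartAt (𝓡 B.dim) (π x)).map_source hy.2) v
    rw [(extChartAt (𝓡 B.dim) (π x)).left_inv hy.2] at h4
    refine Eq.trans ?_ h4
    refine congrArg _ (Eq.trans ?_ hwv)
    exact congrArg _ h3
  let e : (Fin r → ℝ) ≃L[ℝ] EuclideanSpace ℝ (Fin B.dim) :=
    (LinearEquiv.ofBijective (A y).toLinearMap ⟨hAinj, hAsurj⟩).toContinuousLinearEquiv
  have he : (e : (Fin r → ℝ) →L[ℝ] EuclideanSpace ℝ (Fin B.dim)) = A y := by ext; rfl
  have hinv : (A y).IsInvertible := ⟨e, he⟩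
  refine ⟨hy, ?_, fun v => hTF _, fun v => ?_, fun w hw => ?_⟩
  · refine hTs.clm_comp ?_
    have h1 : ContDiffAt ℝ ∞ ContinuousLinearMap.inverse (A y) := he ▸ contDiffAt_map_inverse e
    exact h1.comp y hAs
  · exact hinv.self_apply_inverse v
  · obtain ⟨c, rfl⟩ := hFT w hw
    exact congrArg (T y) (hinv.inverse_apply_self c).symm

end Charts

/-! ### Involutivity as an integrability condition -/

section Plaques

variable {M B : SmoothMfd.{u}}

theorem isInvertible_mfderiv_extChartAt' (M : SmoothMfd.{u}) (x : M) {q : M}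
    (hq : q ∈ (extChartAt (𝓡 M.dim) x).source) :
    (mfderiv (𝓡 M.dim) (𝓡 M.dim) (extChartAt (𝓡 M.dim) x) q).IsInvertible :=
  isInvertible_mfderiv_extChartAt hq

theorem inverse_mfderiv_extChartAt (M : SmoothMfd.{u}) (x : M) {q : M}
    (hq : q ∈ (extChartAt (𝓡 M.dim) x).source) (a : EuclideanSpace ℝ (Fin M.dim)) :
    (mfderiv (𝓡 M.dim) (𝓡 M.dim) (extChartAt (𝓡 M.dim) x) q).inverse a =
      mfderiv (𝓡 M.dim) (𝓡 M.dim) (extChartAt (𝓡 M.dim) x).symm (extChartAt (𝓡 M.dim) x q) a := by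
  have h1 := (isInvertible_mfderiv_extChartAt' M x hq).self_apply_inverse a
  exact (mfderiv_extChartAt_symm_mfderiv M x hq _).symm.trans (congrArg _ h1)

theorem two_le_infty : (2 : WithTop ℕ∞) ≤ ∞ :=
  WithTop.coe_le_coe.mpr (le_top : (2 : ℕ∞) ≤ ⊤)

theorem mlieBracket_eq_lieBracket {E : Type*} [NormedAddCommGroup E] [NormedSpace ℝ E]
    (V W : E → E) : (VectorField.mlieBracket 𝓘(ℝ, E) (V : ∀ x : E, TangentSpace 𝓘(ℝ, E) x) W :
      ∀ x : E, TangentSpace 𝓘(ℝ, E) x) = VectorField.lieBracket ℝ V W := by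
  have h := VectorField.mlieBracketWithin_eq_lieBracketWithin (𝕜 := ℝ) (V := V) (W := W)
    (s := Set.univ)
  exact (VectorField.mlieBracketWithin_univ.symm.trans h).trans VectorField.lieBracketWithin_univ

/-- The bracket of two vector fields that are tangent to a foliation in coordinates is tangent to
it. -/
theorem lieBracket_mem_of_involutive (F : Foliation M) (x : M)
    {O : Set (EuclideanSpace ℝ (Fin M.dim))} (hO : IsOpen O)
    (hOt : O ⊆ (extChartAt (𝓡 M.dim) x).target)
    {V W : EuclideanSpace ℝ (Fin M.dim) → EuclideanSpace ℝ (Fin M.dim)}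
    (hV : ∀ y ∈ O, ContDiffAt ℝ ∞ V y) (hW : ∀ y ∈ O, ContDiffAt ℝ ∞ W y)
    (hVF : ∀ y ∈ O, mfderiv (𝓡 M.dim) (𝓡 M.dim) (extChartAt (𝓡 M.dim) x).symm y (V y) ∈
      F.space ((extChartAt (𝓡 M.dim) x).symm y))
    (hWF : ∀ y ∈ O, mfderiv (𝓡 M.dim) (𝓡 M.dim) (extChartAt (𝓡 M.dim) x).symm y (W y) ∈
      F.space ((extChartAt (𝓡 M.dim) x).symm y))
    {y : EuclideanSpace ℝ (Fin M.dim)} (hy : y ∈ O) :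
    mfderiv (𝓡 M.dim) (𝓡 M.dim) (extChartAt (𝓡 M.dim) x).symm y
      (VectorField.lieBracket ℝ (E := EuclideanSpace ℝ (Fin M.dim)) V W y) ∈ F.space ((extChartAt (𝓡 M.dim) x).symm y) := by
  set φ := extChartAt (𝓡 M.dim) x with hφ
  have hU : IsOpen (φ.source ∩ φ ⁻¹' O) :=
    (continuousOn_extChartAt x).isOpen_inter_preimage (isOpen_extChartAt_source x) hO
  have hsm : ∀ V : EuclideanSpace ℝ (Fin M.dim) → EuclideanSpace ℝ (Fin M.dim),
      (∀ y ∈ O, ContDiffAt ℝ ∞ V y) →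
      SmoothFieldOn M (VectorField.mpullback (𝓡 M.dim) (𝓡 M.dim) φ V) (φ.source ∩ φ ⁻¹' O) := by
    intro V hV q hq
    refine ContMDiffAt.contMDiffWithinAt ?_
    refine ContMDiffAt.mpullback_vectorField_preimage (n := ∞) ?_ (extChartAt_contMDiffAt M x hq.1)
      (isInvertible_mfderiv_extChartAt' M x hq.1) (by simp)
    exact contMDiffAt_vectorSpace_iff_contDiffAt.mpr (hV _ hq.2)
  have hmem : ∀ V : EuclideanSpace ℝ (Fin M.dim) → EuclideanSpace ℝ (Fin M.dim),
      (∀ y ∈ O, mfderiv (𝓡 M.dim) (𝓡 M.dim) φ.symm y (V y) ∈ F.space (φ.symm y)) →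
      ∀ q ∈ φ.source ∩ φ ⁻¹' O,
        VectorField.mpullback (𝓡 M.dim) (𝓡 M.dim) φ V q ∈ F.space q := by
    intro V hV q hq
    have h1 := hV _ hq.2
    rw [φ.left_inv hq.1] at h1
    have h2 := inverse_mfderiv_extChartAt M x hq.1 (V (φ q))
    exact Eq.mpr (congrArg (· ∈ F.space q) h2) h1
  have hyt := hOt hy
  have hqU : φ.symm y ∈ φ.source ∩ φ ⁻¹' O :=
    ⟨φ.map_target hyt, by rw [Set.mem_preimage, φ.right_inv hyt]; exact hy⟩
  have h1 := F.involutive _ hU _ _ (hsm V hV) (hsm W hW) (hmem V hVF) (hmem W hWF) _ hqU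
  have hdiff : ∀ V : EuclideanSpace ℝ (Fin M.dim) → EuclideanSpace ℝ (Fin M.dim),
      (∀ y ∈ O, ContDiffAt ℝ ∞ V y) →
      MDifferentiableAt (𝓡 M.dim) (𝓡 M.dim).tangent
        (fun z => (⟨z, V z⟩ : TangentBundle (𝓡 M.dim) (EuclideanSpace ℝ (Fin M.dim))))
        (φ (φ.symm y)) := by
    intro V hV
    refine ContMDiffAt.mdifferentiableAt (n := ∞) ?_ (by simp)
    exact contMDiffAt_vectorSpace_iff_contDiffAt.mpr (hV _ hqU.2)
  have : IsManifold (𝓡 M.dim) (minSmoothness ℝ 2) M := by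
    rw [minSmoothness_of_isRCLikeNormedField]; infer_instance
  have : IsManifold (𝓡 M.dim) (minSmoothness ℝ 2) (EuclideanSpace ℝ (Fin M.dim)) := by
    rw [minSmoothness_of_isRCLikeNormedField]; infer_instance
  have h2 := VectorField.mpullback_mlieBracket (n := ∞) (hdiff V hV) (hdiff W hW)
    (extChartAt_contMDiffAt M x hqU.1)
    (by rw [minSmoothness_of_isRCLikeNormedField]; exact two_le_infty)
  rw [← h2] at h1
  have h3 := mlieBracket_eq_lieBracket V W
  have h4 := inverse_mfderiv_extChartAt M x hqU.1 (VectorField.lieBracket ℝ (E := EuclideanSpace ℝ (Fin M.dim)) V W (φ (φ.symm y)))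
  have h5 : VectorField.mpullback (𝓡 M.dim) (𝓡 M.dim) φ
      (VectorField.mlieBracket (𝓡 M.dim) V W) (φ.symm y) =
      mfderiv (𝓡 M.dim) (𝓡 M.dim) φ.symm (φ (φ.symm y))
        (VectorField.lieBracket ℝ (E := EuclideanSpace ℝ (Fin M.dim)) V W (φ (φ.symm y))) := by
    rw [h3]; exact h4
  rw [h5] at h1
  rwa [φ.right_inv hyt] at h1

/-- Conditions on a field `h` of linear maps near `y`, expressing that it lifts tangent vectors of
the base to a foliation in the chart at `x`. -/
structure IsLocalLift (π : M → B) (F : Foliation M) (x : M)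
    (h : EuclideanSpace ℝ (Fin M.dim) →
      EuclideanSpace ℝ (Fin B.dim) →L[ℝ] EuclideanSpace ℝ (Fin M.dim))
    (y : EuclideanSpace ℝ (Fin M.dim)) : Prop where
  mem : y ∈ chartDomain π x
  contDiffAt : ContDiffAt ℝ ∞ h y
  tangent : ∀ v, mfderiv (𝓡 M.dim) (𝓡 M.dim) (extChartAt (𝓡 M.dim) x).symm y (h y v) ∈
    F.space ((extChartAt (𝓡 M.dim) x).symm y)
  right_inv : ∀ v, fderiv ℝ (inCharts π x) y (h y v) = v
  left_inv : ∀ w, mfderiv (𝓡 M.dim) (𝓡 M.dim) (extChartAt (𝓡 M.dim) x).symm y w ∈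
    F.space ((extChartAt (𝓡 M.dim) x).symm y) → w = h y (fderiv ℝ (inCharts π x) y w)

theorem exists_isLocalLift {π : M → B} (hπ : ContMDiff (𝓡 M.dim) (𝓡 B.dim) ∞ π) (F : Foliation M)
    (hF : IsFlatEhresmannConnection π F) (x : M) :
    ∃ h, ∀ᶠ y in 𝓝 (extChartAt (𝓡 M.dim) x x), IsLocalLift π F x h y := by
  obtain ⟨h, hh⟩ := exists_local_lift hπ F hF x
  exact ⟨h, hh.mono fun y ⟨h1, h2, h3, h4, h5⟩ => ⟨h1, h2, h3, h4, h5⟩⟩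

/-- The difference of the two sides is the bracket of the lifts of `v` and `w`, hence tangent to
`F`. Differentiating `d π (h w) = w` expresses its projection by second derivatives of `π`, which
cancel by symmetry. A vector of `F` with zero projection is zero. -/
theorem IsLocalLift.integrable {π : M → B} (hπ : ContMDiff (𝓡 M.dim) (𝓡 B.dim) ∞ π)
    {F : Foliation M} {x : M}
    {h : EuclideanSpace ℝ (Fin M.dim) →
      EuclideanSpace ℝ (Fin B.dim) →L[ℝ] EuclideanSpace ℝ (Fin M.dim)}
    {y : EuclideanSpace ℝ (Fin M.dim)} (hy : ∀ᶠ z in 𝓝 y, IsLocalLift π F x h z)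
    (v w : EuclideanSpace ℝ (Fin B.dim)) :
    fderiv ℝ h y (h y v) w = fderiv ℝ h y (h y w) v := by
  obtain ⟨O, hOs, hO, hyO⟩ := mem_nhds_iff.mp hy
  have hs : ∀ v, ∀ z ∈ O, ContDiffAt ℝ ∞ (fun z => h z v) z := fun v z hz =>
    (hOs hz).contDiffAt.clm_apply contDiffAt_const
  have h1 := lieBracket_mem_of_involutive F x hO (fun z hz => (hOs hz).mem.1) (hs v) (hs w)
    (fun z hz => (hOs hz).tangent v) (fun z hz => (hOs hz).tangent w) hyO
  have hd : DifferentiableAt ℝ h y := (hOs hyO).contDiffAt.differentiableAt (by simp)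
  have hfd : ∀ v a, fderiv ℝ (fun z => h z v) y a = fderiv ℝ h y a v := by
    intro v a
    rw [fderiv_clm_apply hd (differentiableAt_const v)]
    simp
  have hb : VectorField.lieBracket ℝ (fun z => h z v) (fun z => h z w) y =
      fderiv ℝ h y (h y v) w - fderiv ℝ h y (h y w) v := by
    rw [VectorField.lieBracket, hfd, hfd]
  have hp := inCharts_contDiffAt hπ (hOs hyO).mem
  have hpd : DifferentiableAt ℝ (fderiv ℝ (inCharts π x)) y :=
    (hp.fderiv_right (m := 1) (by norm_cast)).differentiableAt (by simp)
  have hsymm : ∀ a b, fderiv ℝ (fderiv ℝ (inCharts π x)) y a b =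
      fderiv ℝ (fderiv ℝ (inCharts π x)) y b a :=
    fun a b => (hp.isSymmSndFDerivAt
      (by rw [minSmoothness_of_isRCLikeNormedField]; exact two_le_infty)).eq a b
  have hz : ∀ w a, fderiv ℝ (inCharts π x) y (fderiv ℝ h y a w) =
      - fderiv ℝ (fderiv ℝ (inCharts π x)) y a (h y w) := by
    intro w a
    have e1 : (fun z => fderiv ℝ (inCharts π x) z (h z w)) =ᶠ[𝓝 y] fun _ => w := by
      filter_upwards [hO.mem_nhds hyO] with z hz using (hOs hz).right_inv w
    have e2 := e1.fderiv_eq (𝕜 := ℝ)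
    rw [fderiv_clm_apply hpd ((hs w y hyO).differentiableAt (by simp)), fderiv_fun_const] at e2
    have e3 := congrArg (fun T => T a) e2
    simp only [add_apply, ContinuousLinearMap.comp_apply, ContinuousLinearMap.flip_apply, hfd] at e3
    exact eq_neg_of_add_eq_zero_left e3
  rw [hb] at h1
  have h2 := (hOs hyO).left_inv _ h1
  rw [map_sub, hz, hz, hsymm (h y v), sub_self, map_zero] at h2
  exact sub_eq_zero.mp h2

end Plaques

/-! ### Plaques: tangent local sections -/

section Plaques

variable {M B : SmoothMfd.{u}}

/-- `s` is a smooth section of `π` over the open set `U`, tangent to the foliation. -/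
structure IsPlaque (π : M → B) (F : Foliation M) (s : B → M) (U : Set B) : Prop where
  isOpen : IsOpen U
  contMDiffAt : ∀ b ∈ U, ContMDiffAt (𝓡 B.dim) (𝓡 M.dim) ∞ s b
  section_eq : ∀ b ∈ U, π (s b) = b
  tangent : ∀ b ∈ U, ∀ v, mfderiv (𝓡 B.dim) (𝓡 M.dim) s b v ∈ F.space (s b)

/-- Through every point there is a plaque. -/
theorem exists_isPlaque {π : M → B} (hπ : ContMDiff (𝓡 M.dim) (𝓡 B.dim) ∞ π) (F : Foliation M)
    (hF : IsFlatEhresmannConnection π F) (x : M) :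
    ∃ s U, IsPlaque π F s U ∧ π x ∈ U ∧ s (π x) = x := by
  obtain ⟨h, hh⟩ := exists_isLocalLift hπ F hF x
  obtain ⟨σ, hσ0, hσ⟩ := exists_contDiffAt_of_integrable (hh.mono fun y hy => hy.contDiffAt)
    (hh.eventually_nhds.mono fun y hy => IsLocalLift.integrable hπ hy)
  have hσc : ContinuousAt σ 0 := hσ.self_of_nhds.1.continuousAt
  rw [← hσ0] at hh
  obtain ⟨ε, hε, hball⟩ := Metric.nhds_basis_ball.eventually_iff.mp (hσ.and (hσc.eventually hh))
  set φ := extChartAt (𝓡 M.dim) x with hφ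
  set ψ := extChartAt (𝓡 B.dim) (π x) with hψ
  -- By `right_inv`, `π ∘ σ` has in charts the identity as derivative, so on the ball it is a
  -- translation.
  have hsec : ∀ v ∈ Metric.ball (0 : EuclideanSpace ℝ (Fin B.dim)) ε,
      inCharts π x (σ v) = ψ (π x) + v := by
    have hd : ∀ v ∈ Metric.ball (0 : EuclideanSpace ℝ (Fin B.dim)) ε,
        HasFDerivAt (fun v => inCharts π x (σ v) - v)
          (0 : EuclideanSpace ℝ (Fin B.dim) →L[ℝ] EuclideanSpace ℝ (Fin B.dim)) v := by
      intro v hv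
      have h1 := ((inCharts_contDiffAt hπ (hball hv).2.mem).differentiableAt (by simp)).hasFDerivAt
      have h2 := (h1.comp v (hball hv).1.2).sub (hasFDerivAt_id v)
      have h3 : (fderiv ℝ (inCharts π x) (σ v)).comp (h (σ v)) -
          ContinuousLinearMap.id ℝ (EuclideanSpace ℝ (Fin B.dim)) = 0 := by
        ext1 a
        simp [(hball hv).2.right_inv a]
      rw [h3] at h2
      exact h2
    intro v hv
    have h0 : (0 : EuclideanSpace ℝ (Fin B.dim)) ∈ Metric.ball 0 ε := Metric.mem_ball_self hε
    have h1 := Metric.isOpen_ball.is_const_of_fderiv_eq_zero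
      (convex_ball (0 : EuclideanSpace ℝ (Fin B.dim)) ε).isPreconnected
      (fun v hv => (hd v hv).differentiableAt.differentiableWithinAt)
      (fun v hv => (hd v hv).fderiv) hv h0
    have h2 : inCharts π x (σ 0) = ψ (π x) := by
      rw [hσ0]
      change ψ (π (φ.symm (φ x))) = _
      rw [φ.left_inv (mem_extChartAt_source x)]
    simp only [h2, sub_zero] at h1
    exact eq_add_of_sub_eq h1
  -- Subtracting `ψ (π x)` undoes that translation and makes the map a section.
  refine ⟨fun b => φ.symm (σ (ψ b - ψ (π x))), ψ.source ∩ ψ ⁻¹' Metric.ball (ψ (π x)) ε,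
    ⟨?_, ?_, ?_, ?_⟩, ⟨mem_extChartAt_source _, Metric.mem_ball_self hε⟩, ?_⟩
  · exact (continuousOn_extChartAt (π x)).isOpen_inter_preimage (isOpen_extChartAt_source (π x))
      Metric.isOpen_ball
  · rintro b ⟨hb, hb'⟩
    have hb0 : ψ b - ψ (π x) ∈ Metric.ball (0 : EuclideanSpace ℝ (Fin B.dim)) ε := by
      rw [mem_ball_zero_iff]; exact mem_ball_iff_norm.mp hb'
    refine (extChartAt_symm_contMDiffAt M x (hball hb0).2.mem.1).comp b ?_
    refine (contMDiffAt_iff_contDiffAt.mpr (hball hb0).1.1).comp b ?_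
    exact (extChartAt_contMDiffAt B (π x) hb).sub contMDiffAt_const
  · rintro b ⟨hb, hb'⟩
    have hb0 : ψ b - ψ (π x) ∈ Metric.ball (0 : EuclideanSpace ℝ (Fin B.dim)) ε := by
      rw [mem_ball_zero_iff]; exact mem_ball_iff_norm.mp hb'
    have h1 := hsec _ hb0
    rw [add_sub_cancel] at h1
    exact ψ.injOn (hball hb0).2.mem.2 hb h1
  · rintro b ⟨hb, hb'⟩ v
    have hb0 : ψ b - ψ (π x) ∈ Metric.ball (0 : EuclideanSpace ℝ (Fin B.dim)) ε := by
      rw [mem_ball_zero_iff]; exact mem_ball_iff_norm.mp hb'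
    have e1 : MDifferentiableAt (𝓡 B.dim) (𝓡 B.dim) (fun b => ψ b - ψ (π x)) b :=
      ((extChartAt_contMDiffAt B (π x) hb).sub contMDiffAt_const).mdifferentiableAt
        (n := ∞) (by simp)
    have e2 : HasMFDerivAt (𝓡 B.dim) (𝓡 M.dim) σ (ψ b - ψ (π x)) (h (σ (ψ b - ψ (π x)))) :=
      (hball hb0).1.2.hasMFDerivAt
    have e3 := (extChartAt_symm_contMDiffAt M x (hball hb0).2.mem.1).mdifferentiableAt
      (n := ∞) (by simp)
    have e4 := (e3.hasMFDerivAt.comp b (e2.comp b e1.hasMFDerivAt)).mfderiv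
    have e5 := (hball hb0).2.tangent
      (mfderiv (𝓡 B.dim) (𝓡 B.dim) (fun b => ψ b - ψ (π x)) b v)
    exact Eq.mpr (congrArg (· ∈ F.space (φ.symm (σ (ψ b - ψ (π x))))) (congrArg (fun T => T v) e4)) e5
  · change φ.symm (σ (ψ (π x) - ψ (π x))) = x
    rw [sub_self, hσ0]
    exact φ.left_inv (mem_extChartAt_source x)

end Plaques

/-! ### Unique lifting along a flat connection -/

section Uniqueness

variable {M B N : SmoothMfd.{u}}

/-- A map tangent to a flat connection satisfies, in charts, a total differential equation. -/
theorem hasFDerivAt_inCharts_of_tangent {π : M → B} (hπ : ContMDiff (𝓡 M.dim) (𝓡 B.dim) ∞ π)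
    {F : Foliation M} {f : N → M} (hf : ContMDiff (𝓡 N.dim) (𝓡 M.dim) ∞ f)
    (hfF : ∀ n v, mfderiv (𝓡 N.dim) (𝓡 M.dim) f n v ∈ F.space (f n)) {n : N}
    {h : EuclideanSpace ℝ (Fin M.dim) →
      EuclideanSpace ℝ (Fin B.dim) →L[ℝ] EuclideanSpace ℝ (Fin M.dim)}
    {y : EuclideanSpace ℝ (Fin N.dim)} (hy : y ∈ chartDomain f n)
    (hh : IsLocalLift π F (f n) h (inCharts f n y)) :
    HasFDerivAt (inCharts f n)
      ((h (inCharts f n y)).comp (fderiv ℝ (inCharts (π ∘ f) n) y)) y := by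
  have hd := (inCharts_contDiffAt hf hy).differentiableAt (by simp)
  have hcomp : fderiv ℝ (inCharts (π ∘ f) n) y =
      (fderiv ℝ (inCharts π (f n)) (inCharts f n y)).comp (fderiv ℝ (inCharts f n) y) := by
    rw [← fderiv_comp y ((inCharts_contDiffAt hπ hh.mem).differentiableAt (by simp)) hd]
    refine Filter.EventuallyEq.fderiv_eq ?_
    filter_upwards [(isOpen_chartDomain hf.continuous n).mem_nhds hy] with z hz
    change _ = extChartAt (𝓡 B.dim) (π (f n)) (π ((extChartAt (𝓡 M.dim) (f n)).symm
      (extChartAt (𝓡 M.dim) (f n) (f ((extChartAt (𝓡 N.dim) n).symm z)))))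
    rw [(extChartAt (𝓡 M.dim) (f n)).left_inv hz.2]
    rfl
  -- Since `f` is tangent to `F`, its derivative is the lift of the derivative of its projection.
  convert! hd.hasFDerivAt using 1
  ext1 v
  rw [hcomp]
  refine (hh.left_inv _ ?_).symm
  have h1 := fderiv_inCharts hf hy v
  have h2 := mfderiv_extChartAt_symm_mfderiv M (f n) hy.2
    (mfderiv (𝓡 N.dim) (𝓡 M.dim) f ((extChartAt (𝓡 N.dim) n).symm y)
      (mfderiv (𝓡 N.dim) (𝓡 N.dim) (extChartAt (𝓡 N.dim) n).symm y v))
  have h3 := hfF ((extChartAt (𝓡 N.dim) n).symm y)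
    (mfderiv (𝓡 N.dim) (𝓡 N.dim) (extChartAt (𝓡 N.dim) n).symm y v)
  have h4 : (extChartAt (𝓡 M.dim) (f n)).symm (inCharts f n y) =
      f ((extChartAt (𝓡 N.dim) n).symm y) := (extChartAt (𝓡 M.dim) (f n)).left_inv hy.2
  rw [h4]
  exact Eq.mpr (congrArg (· ∈ F.space (f ((extChartAt (𝓡 N.dim) n).symm y)))
    ((congrArg _ h1).trans h2)) h3

/-- Two maps tangent to a flat connection, with the same projection, agree near every point where
they agree. -/
theorem eventuallyEq_of_tangent {π : M → B} (hπ : ContMDiff (𝓡 M.dim) (𝓡 B.dim) ∞ π)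
    {F : Foliation M} (hF : IsFlatEhresmannConnection π F) {f g : N → M}
    (hf : ContMDiff (𝓡 N.dim) (𝓡 M.dim) ∞ f) (hg : ContMDiff (𝓡 N.dim) (𝓡 M.dim) ∞ g)
    (hfF : ∀ n v, mfderiv (𝓡 N.dim) (𝓡 M.dim) f n v ∈ F.space (f n))
    (hgF : ∀ n v, mfderiv (𝓡 N.dim) (𝓡 M.dim) g n v ∈ F.space (g n))
    (hfg : π ∘ f = π ∘ g) {n : N} (hn : f n = g n) : ∀ᶠ m in 𝓝 n, f m = g m := by
  obtain ⟨h, hh⟩ := exists_isLocalLift hπ F hF (f n)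
  obtain ⟨K, S, hS, hl⟩ := (hh.self_of_nhds.contDiffAt.of_le (m := 1)
    (by norm_cast)).exists_lipschitzOnWith
  set θ := extChartAt (𝓡 N.dim) n with hθ
  have key : ∀ f' : N → M, ContMDiff (𝓡 N.dim) (𝓡 M.dim) ∞ f' → f' n = f n →
      ∀ᶠ y in 𝓝 (θ n), y ∈ chartDomain f' n ∧ inCharts f' n y ∈ S ∧
        IsLocalLift π F (f' n) h (inCharts f' n y) := by
    intro f' hf' he
    refine (Filter.eventually_mem_set.mpr (chartDomain_mem_nhds hf'.continuous n)).and ?_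
    have hc : ContinuousAt (inCharts f' n) (θ n) := (inCharts_contDiffAt hf'
      (mem_of_mem_nhds (chartDomain_mem_nhds hf'.continuous n))).continuousAt
    have h0 : inCharts f' n (θ n) = extChartAt (𝓡 M.dim) (f n) (f n) := by
      rw [inCharts, θ.left_inv (mem_extChartAt_source n), he]
    refine hc.eventually (p := fun z => z ∈ S ∧ IsLocalLift π F (f' n) h z) ?_
    rw [h0, he]
    exact (Filter.eventually_mem_set.mpr hS).and hh
  obtain ⟨ε, hε, hball⟩ := Metric.nhds_basis_ball.eventually_iff.mp
    ((key f hf rfl).and (key g hg hn.symm))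
  filter_upwards [extChartAt_source_mem_nhds (I := 𝓡 N.dim) n,
    (continuousAt_extChartAt (I := 𝓡 N.dim) n).preimage_mem_nhds (Metric.ball_mem_nhds _ hε)]
    with m hm hmε
  -- On the segment from `θ n` to `θ m` both maps solve the same ordinary differential equation. The
  -- segment is prolonged back to `t = -1` so that the initial time `0` is interior, as the
  -- uniqueness lemma requires.
  set w := θ m - θ n with hw
  have hline : ∀ t ∈ Set.Icc (-1 : ℝ) 1, θ n + t • w ∈ Metric.ball (θ n) ε := by
    intro t ht
    rw [mem_ball_iff_norm, add_sub_cancel_left, norm_smul]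
    refine lt_of_le_of_lt (mul_le_of_le_one_left (norm_nonneg _) ?_) (mem_ball_iff_norm.mp hmε)
    exact abs_le.mpr ht
  have hlined : ∀ t : ℝ, HasDerivAt (fun t : ℝ => θ n + t • w) w t := fun t => by
    simpa using ((hasDerivAt_id t).smul_const w).const_add (θ n)
  have hder : ∀ t ∈ Set.Icc (-1 : ℝ) 1, HasDerivAt (fun t : ℝ => inCharts f n (θ n + t • w))
      (h (inCharts f n (θ n + t • w)) (fderiv ℝ (inCharts (π ∘ f) n) (θ n + t • w) w)) t :=
    fun t ht => HasFDerivAt.comp_hasDerivAt (f := fun t : ℝ => θ n + t • w) t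
      (hasFDerivAt_inCharts_of_tangent hπ hf hfF (hball (hline t ht)).1.1
        (hball (hline t ht)).1.2.2) (hlined t)
  have hder' : ∀ t ∈ Set.Icc (-1 : ℝ) 1, HasDerivAt (fun t : ℝ => inCharts g n (θ n + t • w))
      (h (inCharts g n (θ n + t • w)) (fderiv ℝ (inCharts (π ∘ f) n) (θ n + t • w) w)) t := by
    intro t ht
    rw [hfg]
    exact HasFDerivAt.comp_hasDerivAt (f := fun t : ℝ => θ n + t • w) t
      (hasFDerivAt_inCharts_of_tangent hπ hg hgF (hball (hline t ht)).2.1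
        (hball (hline t ht)).2.2.2) (hlined t)
  have hdom : ∀ t ∈ Set.Icc (-1 : ℝ) 1, θ n + t • w ∈ chartDomain (π ∘ f) n := by
    intro t ht
    have h1 := (hball (hline t ht)).1
    refine ⟨h1.1.1, ?_⟩
    have h2 := h1.2.2.mem.2
    have h4 : (extChartAt (𝓡 M.dim) (f n)).symm (inCharts f n (θ n + t • w)) =
      f (θ.symm (θ n + t • w)) := (extChartAt (𝓡 M.dim) (f n)).left_inv h1.1.2
    simp only [Set.mem_preimage] at h2 ⊢
    rwa [h4] at h2
  have hβc : ContinuousOn (fun t : ℝ => fderiv ℝ (inCharts (π ∘ f) n) (θ n + t • w) w)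
      (Set.Icc (-1) 1) := by
    intro t ht
    have h1 := (inCharts_contDiffAt (hπ.comp hf) (hdom t ht)).fderiv_right (m := 1) (by norm_cast)
    have h2 : ContinuousAt (fun t : ℝ => fderiv ℝ (inCharts (π ∘ f) n) (θ n + t • w)) t :=
      ContinuousAt.comp (f := fun t : ℝ => θ n + t • w) h1.continuousAt (hlined t).continuousAt
    exact (h2.clm_apply continuousAt_const).continuousWithinAt
  obtain ⟨C, hC⟩ := isCompact_Icc.exists_bound_of_continuousOn hβc
  have h0 : f n = g n → inCharts f n (θ n + (0 : ℝ) • w) = inCharts g n (θ n + (0 : ℝ) • w) := by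
    intro he
    simp only [inCharts, zero_smul, add_zero, hθ, extChartAt_to_inv, he]
  have hio : Set.Ioo (-1 : ℝ) 1 ⊆ Set.Icc (-1) 1 := Set.Ioo_subset_Icc_self
  have heq := eqOn_of_hasDerivAt_connection hl (β := fun t =>
      fderiv ℝ (inCharts (π ∘ f) n) (θ n + t • w) w) (t₀ := 0) (a := -1) (b := 1) (by simp)
    (fun t ht => hC t (hio ht)) (fun t ht => (hder t ht).continuousAt.continuousWithinAt)
    (fun t ht => (hder' t ht).continuousAt.continuousWithinAt) (fun t ht => hder t (hio ht))
    (fun t ht => hder' t (hio ht)) (fun t ht => (hball (hline t (hio ht))).1.2.1)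
    (fun t ht => (hball (hline t (hio ht))).2.2.1) (h0 hn)
  have h1m : (1 : ℝ) ∈ Set.Icc (-1 : ℝ) 1 := by simp
  have h1 := heq h1m
  have hmw : θ n + (1 : ℝ) • w = θ m := by rw [one_smul, hw, add_sub_cancel]
  have hb1 := hball (hline 1 h1m)
  rw [hmw] at hb1
  simp only [hmw] at h1
  have hf2 := hb1.1.1.2
  have hg2 := hb1.2.1.2
  simp only [Set.mem_preimage, inCharts, ← hθ, θ.left_inv hm] at hf2 hg2 h1
  rw [← hn] at hg2 h1
  exact (extChartAt (𝓡 M.dim) (f n)).injOn hf2 hg2 h1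

/-- Unique lifting: two maps from a connected manifold tangent to a flat connection, with the same
projection, are equal if they agree at one point. -/
theorem eq_of_tangent [ConnectedSpace N] {π : M → B} (hπ : ContMDiff (𝓡 M.dim) (𝓡 B.dim) ∞ π)
    {F : Foliation M} (hF : IsFlatEhresmannConnection π F) {f g : N → M}
    (hf : ContMDiff (𝓡 N.dim) (𝓡 M.dim) ∞ f) (hg : ContMDiff (𝓡 N.dim) (𝓡 M.dim) ∞ g)
    (hfF : ∀ n v, mfderiv (𝓡 N.dim) (𝓡 M.dim) f n v ∈ F.space (f n))
    (hgF : ∀ n v, mfderiv (𝓡 N.dim) (𝓡 M.dim) g n v ∈ F.space (g n))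
    (hfg : π ∘ f = π ∘ g) {n : N} (hn : f n = g n) : f = g := by
  have hclopen : IsClopen {m | f m = g m} :=
    ⟨isClosed_eq hf.continuous hg.continuous, isOpen_iff_mem_nhds.mpr fun m hm =>
      eventuallyEq_of_tangent hπ hF hf hg hfF hgF hfg hm⟩
  have h1 := hclopen.eq_univ ⟨n, hn⟩
  exact funext fun m => (h1 ▸ Set.mem_univ m : m ∈ {m | f m = g m})

end Uniqueness

/-! ### Rigidity of morphisms over the base -/

section Morphisms

variable {M N P : FMn.{u}}

theorem FMn.Hom.mfderiv_mem (f : M ⟶ N) {p : M.mfd} {v : TangentSpace (𝓡 M.mfd.dim) p}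
    (hv : v ∈ M.fol.space p) :
    mfderiv (𝓡 M.mfd.dim) (𝓡 N.mfd.dim) f.toFun p v ∈ N.fol.space (f.toFun p) := by
  rw [← f.map_space]
  exact Submodule.mem_map_of_mem hv

theorem FMn.id_toFun : (𝟙 M : M ⟶ M).toFun = id := rfl

theorem FMn.Hom.mdifferentiableAt (f : M ⟶ N) (p : M.mfd) :
    MDifferentiableAt (𝓡 M.mfd.dim) (𝓡 N.mfd.dim) f.toFun p :=
  f.smooth.mdifferentiable (by simp) p

/-- Morphisms over the base with the same value at a point with dense leaf are equal. -/
theorem FMn.hom_ext_of_dense_leaf {B : SmoothMfd.{u}} {π : N ⟶ FMn.total B}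
    (hF : IsFlatEhresmannConnection π.toFun N.fol) {p : M.mfd} (hp : Dense (leaf M p))
    {σ τ : M ⟶ N} (h : σ ≫ π = τ ≫ π) (hpe : σ.toFun p = τ.toFun p) : σ = τ := by
  apply FMn.Hom.ext
  refine Continuous.ext_on hp σ.smooth.continuous τ.smooth.continuous ?_
  -- Each point of the leaf lies together with `p` on a connected integral manifold, where `σ` and
  -- `τ` restrict to tangent maps with the same projection.
  rintro q ⟨S, ⟨⟨L, j, hL, hj, -, -, hjr, rfl⟩, ⟨n₀, rfl⟩⟩, ⟨n, rfl⟩⟩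
  have ht : ∀ (ρ : M ⟶ N) n v, mfderiv (𝓡 L.dim) (𝓡 N.mfd.dim) (ρ.toFun ∘ j) n v ∈
      N.fol.space ((ρ.toFun ∘ j) n) := by
    intro ρ n v
    have h1 := mfderiv_comp_apply n (ρ.mdifferentiableAt (j n)) (hj.mdifferentiable (by simp) n) v
    rw [h1]
    refine ρ.mfderiv_mem ?_
    rw [← hjr n]
    exact ⟨v, rfl⟩
  have he := eq_of_tangent (N := L) π.smooth hF (σ.smooth.comp hj) (τ.smooth.comp hj) (ht σ) (ht τ)
    (by
      have := congrArg (fun f => f.toFun ∘ j) h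
      exact this) hpe
  exact congrFun he n

end Morphisms

/-! ### Open subsets of products as manifolds with a Euclidean model -/

section Rechart

variable {H H' : Type*} [TopologicalSpace H] [TopologicalSpace H'] {X : Type*} [TopologicalSpace X]

/-- Change the model space of a charted space along a homeomorphism. -/
@[reducible] def rechart (X : Type*) [TopologicalSpace X] [ChartedSpace H X] (e : H ≃ₜ H') :
    ChartedSpace H' X where
  atlas := (fun c : OpenPartialHomeomorph X H => c.transHomeomorph e) '' atlas H X
  chartAt x := (chartAt H x).transHomeomorph e
  mem_chart_source x := mem_chart_source H x
  chart_mem_atlas x := ⟨_, chart_mem_atlas H x, rfl⟩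

variable {a b d : ℕ}

/-- The homeomorphism of model spaces underlying a linear isomorphism. -/
def modelHomeomorph (L : (EuclideanSpace ℝ (Fin a) × EuclideanSpace ℝ (Fin b)) ≃L[ℝ]
      EuclideanSpace ℝ (Fin d)) :
    ModelProd (EuclideanSpace ℝ (Fin a)) (EuclideanSpace ℝ (Fin b)) ≃ₜ EuclideanSpace ℝ (Fin d) :=
  L.toHomeomorph

/-- Coordinate changes are conjugated by the linear map `L` and stay smooth. A `SmoothMfd` is
modelled on a single Euclidean space while a product has charts in a product of two, whence the
change of model. -/
theorem isManifold_rechart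
    (L : (EuclideanSpace ℝ (Fin a) × EuclideanSpace ℝ (Fin b)) ≃L[ℝ] EuclideanSpace ℝ (Fin d))
    [ChartedSpace (ModelProd (EuclideanSpace ℝ (Fin a)) (EuclideanSpace ℝ (Fin b))) X]
    [IsManifold ((𝓡 a).prod (𝓡 b)) ∞ X] :
    @IsManifold ℝ _ _ _ _ _ _ (𝓡 d) ∞ X _ (rechart X (modelHomeomorph L)) := by
  let := rechart X (modelHomeomorph L)
  refine isManifold_of_contDiffOn (𝓡 d) ∞ X ?_
  rintro _ _ ⟨c, hc, rfl⟩ ⟨c', hc', rfl⟩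
  have h1 := (contDiffGroupoid ∞ ((𝓡 a).prod (𝓡 b))).compatible hc hc'
  rw [contDiffGroupoid, mem_groupoid_of_pregroupoid] at h1
  let g : EuclideanSpace ℝ (Fin a) × EuclideanSpace ℝ (Fin b) →
    EuclideanSpace ℝ (Fin a) × EuclideanSpace ℝ (Fin b) := fun p => c' (c.symm p)
  let S : Set (EuclideanSpace ℝ (Fin a) × EuclideanSpace ℝ (Fin b)) := (c.symm ≫ₕ c').source
  have h3 : ContDiffOn ℝ ∞ g S :=
    ContDiffOn.congr_mono h1.1 (fun p hp => rfl) fun p hp => ⟨hp, by simp⟩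
  refine (L.contDiff.comp_contDiffOn (h3.comp L.symm.contDiff.contDiffOn
    (s := {p | L.symm p ∈ S}) (fun p hp => hp))).congr_mono
    (fun p hp => rfl) ?_
  rintro p ⟨hp, -⟩
  have h4 : p ∈ (c.transHomeomorph (modelHomeomorph L)).target ∧
    (c.transHomeomorph (modelHomeomorph L)).symm p ∈
      (c'.transHomeomorph (modelHomeomorph L)).source := by
    simpa using hp
  exact h4

theorem contMDiffAt_rechart_iff
    (L : (EuclideanSpace ℝ (Fin a) × EuclideanSpace ℝ (Fin b)) ≃L[ℝ] EuclideanSpace ℝ (Fin d))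
    [ChartedSpace (ModelProd (EuclideanSpace ℝ (Fin a)) (EuclideanSpace ℝ (Fin b))) X]
    {E₀ H₀ : Type*} [NormedAddCommGroup E₀] [NormedSpace ℝ E₀] [TopologicalSpace H₀]
    (I₀ : ModelWithCorners ℝ E₀ H₀) {N : Type*} [TopologicalSpace N] [ChartedSpace H₀ N]
    {f : N → X} {n : N} :
    (@ContMDiffAt ℝ _ _ _ _ _ _ I₀ N _ _ _ _ _ _ _ (𝓡 d) X _ (rechart X (modelHomeomorph L))
      ∞ f n) ↔ ContMDiffAt I₀ ((𝓡 a).prod (𝓡 b)) ∞ f n := by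
  let := rechart X (modelHomeomorph L)
  rw [contMDiffAt_iff_target (I' := 𝓡 d), contMDiffAt_iff_target (I' := (𝓡 a).prod (𝓡 b))]
  refine and_congr_right fun _ => ⟨fun h => ?_, fun h => ?_⟩
  · have h1 := L.symm.contDiff.contMDiff.contMDiffAt.comp n h
    refine h1.congr_of_eventuallyEq (Filter.Eventually.of_forall fun z => ?_)
    exact (L.symm_apply_apply _).symm
  · have h1 := L.contDiff.contMDiff.contMDiffAt.comp n h
    exact h1

end Rechart

section OpenProd

variable (T M : SmoothMfd.{u}) (O : TopologicalSpace.Opens (T × M))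

/-- A linear isomorphism `ℝᵃ × ℝᵇ ≃ ℝᵃ⁺ᵇ`. -/
noncomputable def euclideanProdEquiv (a b : ℕ) :
    (EuclideanSpace ℝ (Fin a) × EuclideanSpace ℝ (Fin b)) ≃L[ℝ] EuclideanSpace ℝ (Fin (a + b)) :=
  ContinuousLinearEquiv.ofFinrankEq (by simp)

/-- An open subset of the product of two manifolds, as a manifold. -/
noncomputable def SmoothMfd.openProd : SmoothMfd.{u} :=
  letI := rechart O (modelHomeomorph (euclideanProdEquiv T.dim M.dim))
  haveI : IsManifold (𝓡 (T.dim + M.dim)) ∞ O := isManifold_rechart _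
  { carrier := O
    dim := T.dim + M.dim }

variable {T M O}

namespace SmoothMfd.openProd

/-- The underlying point of the product. -/
def val (z : SmoothMfd.openProd T M O) : T × M := Subtype.val (p := fun z => z ∈ O) z

/-- The first projection. -/
noncomputable def fst (z : SmoothMfd.openProd T M O) : T := (val z).1

/-- The second projection. -/
noncomputable def snd (z : SmoothMfd.openProd T M O) : M := (val z).2

/-- The point of the open set with given components. -/
noncomputable def mk (t : T) (m : M) (h : (t, m) ∈ O) : SmoothMfd.openProd T M O :=
  (⟨(t, m), h⟩ : O)

theorem mem (z : SmoothMfd.openProd T M O) : (fst z, snd z) ∈ O :=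
  Subtype.prop (p := fun z => z ∈ O) z

theorem ext {z z' : SmoothMfd.openProd T M O} (h₁ : fst z = fst z') (h₂ : snd z = snd z') :
    z = z' :=
  Subtype.ext (p := fun z => z ∈ O) (Prod.ext h₁ h₂)

variable {E₀ H₀ : Type*} [NormedAddCommGroup E₀] [NormedSpace ℝ E₀] [TopologicalSpace H₀]
  {I₀ : ModelWithCorners ℝ E₀ H₀} {N : Type*} [TopologicalSpace N] [ChartedSpace H₀ N]

/-- From here on smoothness into `openProd` is tested on components, and the changed model need not
be unfolded again. -/
theorem contMDiffAt_iff {f : N → SmoothMfd.openProd T M O} {n : N} :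
    ContMDiffAt I₀ (𝓡 (SmoothMfd.openProd T M O).dim) ∞ f n ↔
      ContMDiffAt I₀ (𝓡 T.dim) ∞ (fun z => fst (f z)) n ∧
        ContMDiffAt I₀ (𝓡 M.dim) ∞ (fun z => snd (f z)) n := by
  have h1 : ContMDiffAt I₀ (𝓡 (SmoothMfd.openProd T M O).dim) ∞ f n ↔
      ContMDiffAt (M' := O) I₀ ((𝓡 T.dim).prod (𝓡 M.dim)) ∞ f n :=
    contMDiffAt_rechart_iff (X := O) (euclideanProdEquiv T.dim M.dim) I₀
  have h2 : ContMDiffAt I₀ ((𝓡 T.dim).prod (𝓡 M.dim)) ∞ (fun z => val (f z)) n ↔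
      ContMDiffAt (M' := O) I₀ ((𝓡 T.dim).prod (𝓡 M.dim)) ∞ f n :=
    ContMDiffAt.subtypeVal_comp_iff O f n
  rw [h1, ← h2]
  exact contMDiffAt_prod_iff (fun z => val (f z))

theorem contMDiff_iff {f : N → SmoothMfd.openProd T M O} :
    ContMDiff I₀ (𝓡 (SmoothMfd.openProd T M O).dim) ∞ f ↔
      ContMDiff I₀ (𝓡 T.dim) ∞ (fun z => fst (f z)) ∧
        ContMDiff I₀ (𝓡 M.dim) ∞ (fun z => snd (f z)) :=
  ⟨fun h => ⟨fun n => (contMDiffAt_iff.mp (h n)).1, fun n => (contMDiffAt_iff.mp (h n)).2⟩,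
    fun h n => contMDiffAt_iff.mpr ⟨h.1 n, h.2 n⟩⟩

theorem contMDiff_fst : ContMDiff (𝓡 (SmoothMfd.openProd T M O).dim) (𝓡 T.dim) ∞
    (fst : SmoothMfd.openProd T M O → T) := (contMDiff_iff.mp contMDiff_id).1

theorem contMDiff_snd : ContMDiff (𝓡 (SmoothMfd.openProd T M O).dim) (𝓡 M.dim) ∞
    (snd : SmoothMfd.openProd T M O → M) := (contMDiff_iff.mp contMDiff_id).2

end SmoothMfd.openProd

end OpenProd

/-! ### Brackets of fields tangent to an immersed manifold -/

section Bracket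

variable {Z : SmoothMfd.{u}}

theorem mpullback_extChartAt_symm_apply {z₀ q : Z}
    (hq : q ∈ (extChartAt (𝓡 Z.dim) z₀).source) (V : ∀ q : Z, TangentSpace (𝓡 Z.dim) q) :
    VectorField.mpullback (𝓡 Z.dim) (𝓡 Z.dim) (extChartAt (𝓡 Z.dim) z₀).symm V
        (extChartAt (𝓡 Z.dim) z₀ q) =
      mfderiv (𝓡 Z.dim) (𝓡 Z.dim) (extChartAt (𝓡 Z.dim) z₀) q (V q) := by
  have hy := (extChartAt (𝓡 Z.dim) z₀).map_source hq
  apply injective_mfderiv_extChartAt_symm Z z₀ hy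
  have h1 := (isInvertible_mfderiv_extChartAt_symm Z z₀ hy).self_apply_inverse
    (V ((extChartAt (𝓡 Z.dim) z₀).symm (extChartAt (𝓡 Z.dim) z₀ q)))
  have h2 := mfderiv_extChartAt_symm_mfderiv Z z₀ hq (V q)
  have h3 : ∀ q', q' = q → (V q' : EuclideanSpace ℝ (Fin Z.dim)) = V q := by rintro _ rfl; rfl
  exact h1.trans ((h3 _ ((extChartAt (𝓡 Z.dim) z₀).left_inv hq)).trans h2.symm)

/-- The bracket of two vector fields tangent to an immersed manifold is tangent to it. -/
theorem mlieBracket_mem_range {d : ℕ} {σ : EuclideanSpace ℝ (Fin d) → Z}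
    {ρ : Z → EuclideanSpace ℝ (Fin d)} {u₀ : EuclideanSpace ℝ (Fin d)}
    (hσ : ∀ᶠ u in 𝓝 u₀, ContMDiffAt (𝓡 d) (𝓡 Z.dim) ∞ σ u)
    (hρ : ContMDiffAt (𝓡 Z.dim) (𝓡 d) ∞ ρ (σ u₀)) (hρσ : ∀ᶠ u in 𝓝 u₀, ρ (σ u) = u)
    {V W : ∀ q : Z, TangentSpace (𝓡 Z.dim) q} {U : Set Z} (hU : IsOpen U) (hu₀ : σ u₀ ∈ U)
    (hV : SmoothFieldOn Z V U) (hW : SmoothFieldOn Z W U)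
    (hVσ : ∀ᶠ u in 𝓝 u₀, V (σ u) ∈ (mfderiv (𝓡 d) (𝓡 Z.dim) σ u).range)
    (hWσ : ∀ᶠ u in 𝓝 u₀, W (σ u) ∈ (mfderiv (𝓡 d) (𝓡 Z.dim) σ u).range) :
    VectorField.mlieBracket (𝓡 Z.dim) V W (σ u₀) ∈ (mfderiv (𝓡 d) (𝓡 Z.dim) σ u₀).range := by
  set φ := extChartAt (𝓡 Z.dim) (σ u₀) with hφ
  have hσc : ContinuousAt σ u₀ := hσ.self_of_nhds.continuousAt
  have hsrc : ∀ᶠ u in 𝓝 u₀, σ u ∈ φ.source := hσc.preimage_mem_nhds (extChartAt_source_mem_nhds _)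
  have hz₀ : σ u₀ ∈ φ.source := mem_extChartAt_source _
  have hy₀ : φ (σ u₀) ∈ φ.target := mem_extChartAt_target _
  let s : EuclideanSpace ℝ (Fin d) → EuclideanSpace ℝ (Fin Z.dim) := fun u => φ (σ u)
  have hs : ContDiffAt ℝ ∞ s u₀ := by
    rw [← contMDiffAt_iff_contDiffAt]
    exact (extChartAt_contMDiffAt Z _ hz₀).comp u₀ hσ.self_of_nhds
  have hds : ∀ᶠ u in 𝓝 u₀, ∀ w, fderiv ℝ s u w =
      mfderiv (𝓡 Z.dim) (𝓡 Z.dim) φ (σ u) (mfderiv (𝓡 d) (𝓡 Z.dim) σ u w) := by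
    filter_upwards [hsrc, hσ] with u hu hσu w
    rw [← mfderiv_eq_fderiv]
    exact mfderiv_comp_apply u ((extChartAt_contMDiffAt Z _ hu).mdifferentiableAt (by simp))
      (hσu.mdifferentiableAt (by simp)) w
  have hrange : ∀ V : (∀ q : Z, TangentSpace (𝓡 Z.dim) q),
      (∀ᶠ u in 𝓝 u₀, V (σ u) ∈ (mfderiv (𝓡 d) (𝓡 Z.dim) σ u).range) →
      ∀ᶠ u in 𝓝 u₀, VectorField.mpullback (𝓡 Z.dim) (𝓡 Z.dim) φ.symm V (s u) ∈
        (fderiv ℝ s u).range := by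
    intro V hV
    filter_upwards [hV, hds, hsrc] with u ⟨w, hw⟩ hu hsu
    refine ⟨w, ?_⟩
    exact (hu w).trans ((congrArg _ hw).trans (mpullback_extChartAt_symm_apply hsu V).symm)
  have hdiff : ∀ V : (∀ q : Z, TangentSpace (𝓡 Z.dim) q), SmoothFieldOn Z V U →
      DifferentiableAt ℝ (VectorField.mpullback (𝓡 Z.dim) (𝓡 Z.dim) φ.symm V) (s u₀) :=
    fun V hV => (contDiffAt_mpullback_extChartAt_symm Z _ hU hV hy₀
      (by rw [φ.left_inv hz₀]; exact hu₀)).differentiableAt (by simp)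
  -- In the chart the immersion becomes `φ ∘ σ`, with left inverse `ρ ∘ φ.symm`, and the vector
  -- space version applies.
  have hmem := lieBracket_mem_range (s := s) (ρ := fun y => ρ (φ.symm y))
    (V := VectorField.mpullback (𝓡 Z.dim) (𝓡 Z.dim) φ.symm V)
    (W := VectorField.mpullback (𝓡 Z.dim) (𝓡 Z.dim) φ.symm W) (hs.of_le two_le_infty) (by
      rw [← contMDiffAt_iff_contDiffAt]
      refine (ContMDiffAt.comp (φ (σ u₀)) (g := ρ) ?_
        (extChartAt_symm_contMDiffAt Z _ hy₀)).of_le two_le_infty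
      rw [φ.left_inv hz₀]
      exact hρ) (by
      filter_upwards [hρσ, hsrc] with u hu hsu
      change ρ (φ.symm (φ (σ u))) = u
      rw [φ.left_inv hsu, hu]) (hdiff V hV) (hdiff W hW) (hrange V hVσ) (hrange W hWσ)
  obtain ⟨w, hw⟩ := hmem
  refine ⟨w, ?_⟩
  have h1 : VectorField.mlieBracket (𝓡 Z.dim) V W (σ u₀) =
      (mfderiv (𝓡 Z.dim) (𝓡 Z.dim) φ (σ u₀)).inverse
        (VectorField.lieBracket ℝ (E := EuclideanSpace ℝ (Fin Z.dim))
          (VectorField.mpullback (𝓡 Z.dim) (𝓡 Z.dim) φ.symm V)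
          (VectorField.mpullback (𝓡 Z.dim) (𝓡 Z.dim) φ.symm W) (φ (σ u₀))) := by
    rw [← VectorField.mlieBracketWithin_univ, VectorField.mlieBracketWithin_apply]
    have e1 : ∀ V' W' : EuclideanSpace ℝ (Fin Z.dim) → EuclideanSpace ℝ (Fin Z.dim),
        VectorField.lieBracketWithin ℝ V' W' (φ.symm ⁻¹' Set.univ ∩ Set.range (𝓡 Z.dim))
          (φ (σ u₀)) = VectorField.lieBracket ℝ V' W' (φ (σ u₀)) := by
      intro V' W'
      rw [ModelWithCorners.range_eq_univ, Set.preimage_univ, Set.univ_inter,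
        VectorField.lieBracketWithin_univ]
    have e2 : ∀ V : (∀ q : Z, TangentSpace (𝓡 Z.dim) q),
        VectorField.mpullbackWithin (𝓡 Z.dim) (𝓡 Z.dim) φ.symm V (Set.range (𝓡 Z.dim)) =
          VectorField.mpullback (𝓡 Z.dim) (𝓡 Z.dim) φ.symm V := by
      intro V
      rw [ModelWithCorners.range_eq_univ, VectorField.mpullbackWithin_univ]
    refine congrArg _ ((e1 _ _).trans ?_)
    exact congrArg₂ (fun A B : EuclideanSpace ℝ (Fin Z.dim) → EuclideanSpace ℝ (Fin Z.dim) =>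
      VectorField.lieBracket ℝ A B (φ (σ u₀))) (e2 V) (e2 W)
  have h2 := inverse_mfderiv_extChartAt Z (σ u₀) hz₀
    (VectorField.lieBracket ℝ (E := EuclideanSpace ℝ (Fin Z.dim))
          (VectorField.mpullback (𝓡 Z.dim) (𝓡 Z.dim) φ.symm V)
          (VectorField.mpullback (𝓡 Z.dim) (𝓡 Z.dim) φ.symm W) (φ (σ u₀)))
  have h3 := mfderiv_extChartAt_symm_mfderiv Z (σ u₀) hz₀ (mfderiv (𝓡 d) (𝓡 Z.dim) σ u₀ w)
  have h4 := (hds.self_of_nhds w).symm.trans hw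
  exact (h3.symm.trans (congrArg _ h4)).trans (h2.symm.trans h1.symm)

/-- The foliation by points. -/
noncomputable def Foliation.zero (X : SmoothMfd.{u}) : Foliation X where
  space _ := ⊥
  subbundle := ⟨0, fun p => ⟨Set.univ, isOpen_univ, trivial, fun i => i.elim0, fun i => i.elim0,
    fun q _ => ⟨linearIndependent_empty_type, by simp⟩⟩⟩
  involutive U hU V W hV hW hV0 hW0 q hq := by
    rw [Submodule.mem_bot, ← VectorField.mlieBracketWithin_univ]
    exact VectorField.mlieBracketWithin_eq_zero_of_eq_zero ((Submodule.mem_bot ℝ).mp (hV0 q hq))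
      ((Submodule.mem_bot ℝ).mp (hW0 q hq))

end Bracket

/-! ### Tangent vectors and vector fields on open subsets of products -/

section OpenProdFoliation

namespace SmoothMfd.openProd

variable {T M : SmoothMfd.{u}} {O : TopologicalSpace.Opens (T × M)}

theorem mdifferentiableAt_fst (z : SmoothMfd.openProd T M O) :
    MDifferentiableAt (𝓡 (SmoothMfd.openProd T M O).dim) (𝓡 T.dim) fst z :=
  contMDiff_fst.mdifferentiable (by simp) z

theorem mdifferentiableAt_snd (z : SmoothMfd.openProd T M O) :
    MDifferentiableAt (𝓡 (SmoothMfd.openProd T M O).dim) (𝓡 M.dim) snd z :=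
  contMDiff_snd.mdifferentiable (by simp) z

open Classical in
/-- A map on the product extending the identity of the open set. -/
noncomputable def extend (z₀ : SmoothMfd.openProd T M O) (p : T × M) : SmoothMfd.openProd T M O :=
  -- `z₀` is a default value off `O`; only the values on `O` matter.
  if h : p ∈ O then mk p.1 p.2 h else z₀

theorem extend_eq (z₀ : SmoothMfd.openProd T M O) {t : T} {m : M} (h : (t, m) ∈ O) :
    extend z₀ (t, m) = mk t m h := dif_pos h

theorem extend_fst_snd (z₀ z : SmoothMfd.openProd T M O) : extend z₀ (fst z, snd z) = z :=
  (extend_eq z₀ (mem z)).trans rfl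

theorem eventually_extend_eq (z₀ : SmoothMfd.openProd T M O) {p : T × M} (hp : p ∈ O) :
    ∀ᶠ p in 𝓝 p, fst (extend z₀ p) = p.1 ∧ snd (extend z₀ p) = p.2 := by
  filter_upwards [O.isOpen.mem_nhds hp] with p' (hp' : p' ∈ O)
  rw [show p' = (p'.1, p'.2) from rfl, extend_eq z₀ hp']
  exact ⟨rfl, rfl⟩

theorem contMDiffAt_extend (z₀ : SmoothMfd.openProd T M O) {p : T × M} (hp : p ∈ O) :
    ContMDiffAt ((𝓡 T.dim).prod (𝓡 M.dim)) (𝓡 (SmoothMfd.openProd T M O).dim) ∞ (extend z₀) p :=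
  contMDiffAt_iff.mpr
    ⟨_root_.contMDiffAt_fst.congr_of_eventuallyEq ((eventually_extend_eq z₀ hp).mono fun _ h => h.1),
      _root_.contMDiffAt_snd.congr_of_eventuallyEq ((eventually_extend_eq z₀ hp).mono fun _ h => h.2)⟩

/-- The inclusion of the open set in the product. -/
noncomputable def toProd (z : SmoothMfd.openProd T M O) : T × M := (fst z, snd z)

theorem contMDiff_toProd : ContMDiff (𝓡 (SmoothMfd.openProd T M O).dim)
    ((𝓡 T.dim).prod (𝓡 M.dim)) ∞ (toProd : SmoothMfd.openProd T M O → T × M) :=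
  contMDiff_fst.prodMk contMDiff_snd

theorem mfderiv_toProd (z : SmoothMfd.openProd T M O)
    (v : TangentSpace (𝓡 (SmoothMfd.openProd T M O).dim) z) :
    (mfderiv (𝓡 (SmoothMfd.openProd T M O).dim) ((𝓡 T.dim).prod (𝓡 M.dim)) toProd z v :
      EuclideanSpace ℝ (Fin T.dim) × EuclideanSpace ℝ (Fin M.dim)) =
      (mfderiv (𝓡 (SmoothMfd.openProd T M O).dim) (𝓡 T.dim) fst z v,
        mfderiv (𝓡 (SmoothMfd.openProd T M O).dim) (𝓡 M.dim) snd z v) := by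
  have h := mfderiv_prodMk (mdifferentiableAt_fst z) (mdifferentiableAt_snd z)
  exact congrArg (fun L => L v) h

theorem injective_mfderiv_toProd (z : SmoothMfd.openProd T M O) :
    Function.Injective (mfderiv (𝓡 (SmoothMfd.openProd T M O).dim)
      ((𝓡 T.dim).prod (𝓡 M.dim)) toProd z) :=
  Function.LeftInverse.injective (g := mfderiv ((𝓡 T.dim).prod (𝓡 M.dim))
      (𝓡 (SmoothMfd.openProd T M O).dim) (extend z) (toProd z)) fun v =>
    mfderiv_mfderiv_of_leftInverse
      ((contMDiffAt_extend z (mem z)).mdifferentiableAt (by simp))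
      (contMDiff_toProd.mdifferentiable (by simp) z)
      (Filter.Eventually.of_forall fun z' => extend_fst_snd z z') v

/-- Tangent vectors are determined by their components. -/
theorem tangent_ext {z : SmoothMfd.openProd T M O}
    {v w : TangentSpace (𝓡 (SmoothMfd.openProd T M O).dim) z}
    (h₁ : mfderiv (𝓡 (SmoothMfd.openProd T M O).dim) (𝓡 T.dim) fst z v =
      mfderiv (𝓡 (SmoothMfd.openProd T M O).dim) (𝓡 T.dim) fst z w)
    (h₂ : mfderiv (𝓡 (SmoothMfd.openProd T M O).dim) (𝓡 M.dim) snd z v =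
      mfderiv (𝓡 (SmoothMfd.openProd T M O).dim) (𝓡 M.dim) snd z w) : v = w := by
  apply injective_mfderiv_toProd z
  refine (mfderiv_toProd z v).trans (Eq.trans ?_ (mfderiv_toProd z w).symm)
  exact Prod.ext h₁ h₂

/-- Injectivity suffices, the dimensions being equal. The inverse provides tangent vectors with
prescribed components. -/
theorem isInvertible_mfderiv_toProd (z : SmoothMfd.openProd T M O) :
    (mfderiv (𝓡 (SmoothMfd.openProd T M O).dim) ((𝓡 T.dim).prod (𝓡 M.dim)) toProd z).IsInvertible := by
  let A : EuclideanSpace ℝ (Fin (T.dim + M.dim)) →L[ℝ]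
    EuclideanSpace ℝ (Fin T.dim) × EuclideanSpace ℝ (Fin M.dim) :=
    mfderiv (𝓡 (SmoothMfd.openProd T M O).dim) ((𝓡 T.dim).prod (𝓡 M.dim)) toProd z
  have h1 : Function.Injective A := injective_mfderiv_toProd z
  have h2 : Function.Surjective A :=
    (LinearMap.injective_iff_surjective_of_finrank_eq_finrank (f := A.toLinearMap)
      (by simp)).mp h1
  let e := (LinearEquiv.ofBijective A.toLinearMap ⟨h1, h2⟩).toContinuousLinearEquiv
  have he : (e : _ →L[ℝ] _) = A := by ext1; rfl
  exact ⟨e, he⟩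

/-- The lift of a vector field on the second factor. -/
noncomputable def liftField (X : ∀ q : M, TangentSpace (𝓡 M.dim) q)
    (z : SmoothMfd.openProd T M O) : TangentSpace (𝓡 (SmoothMfd.openProd T M O).dim) z :=
  VectorField.mpullback (𝓡 (SmoothMfd.openProd T M O).dim) ((𝓡 T.dim).prod (𝓡 M.dim)) toProd
    (fun p : T × M => ((0 : TangentSpace (𝓡 T.dim) p.1), X p.2)) z

theorem mfderiv_liftField (X : ∀ q : M, TangentSpace (𝓡 M.dim) q)
    (z : SmoothMfd.openProd T M O) :
    mfderiv (𝓡 (SmoothMfd.openProd T M O).dim) (𝓡 T.dim) fst z (liftField X z) = 0 ∧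
      mfderiv (𝓡 (SmoothMfd.openProd T M O).dim) (𝓡 M.dim) snd z (liftField X z) =
        X (snd z) := by
  have h1 := (isInvertible_mfderiv_toProd z).self_apply_inverse
    ((0 : TangentSpace (𝓡 T.dim) (fst z)), X (snd z))
  have h2 := (mfderiv_toProd z (liftField X z)).symm.trans h1
  exact ⟨congrArg Prod.fst h2, congrArg Prod.snd h2⟩

theorem smoothFieldOn_liftField {X : ∀ q : M, TangentSpace (𝓡 M.dim) q} {U : Set M}
    (hU : IsOpen U) (hX : SmoothFieldOn M X U) :
    SmoothFieldOn (SmoothMfd.openProd T M O) (liftField X) (snd ⁻¹' U) := by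
  intro z hz
  refine ContMDiffAt.contMDiffWithinAt ?_
  refine ContMDiffAt.mpullback_vectorField_preimage (n := ∞) ?_ contMDiff_toProd.contMDiffAt
    (isInvertible_mfderiv_toProd z) (by simp)
  have h1 : ContMDiffAt ((𝓡 T.dim).prod (𝓡 M.dim)) (𝓡 T.dim).tangent ∞
      (fun p : T × M => (⟨p.1, 0⟩ : TangentBundle (𝓡 T.dim) T)) (toProd z) :=
    (Bundle.contMDiff_zeroSection ℝ (TangentSpace (𝓡 T.dim) : T → Type _)).contMDiffAt.comp
      (toProd z) _root_.contMDiffAt_fst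
  have h2 : ContMDiffAt ((𝓡 T.dim).prod (𝓡 M.dim)) (𝓡 M.dim).tangent ∞
      (fun p : T × M => (⟨p.2, X p.2⟩ : TangentBundle (𝓡 M.dim) M)) (toProd z) :=
    ContMDiffAt.comp (toProd z) (hX.contMDiffAt (hU.mem_nhds hz)) _root_.contMDiffAt_snd
  exact (contMDiff_equivTangentBundleProd_symm (I := 𝓡 T.dim) (I' := 𝓡 M.dim)
    (M := T) (M' := M)).contMDiffAt.comp (toProd z) (h1.prodMk h2)

end SmoothMfd.openProd

end OpenProdFoliation

/-! ### The foliation `0 × F` on open subsets of products -/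

section OpenProdFoliation

variable {M B : SmoothMfd.{u}}

theorem IsPlaque.mfderiv_section {π : M → B} (hπ : ContMDiff (𝓡 M.dim) (𝓡 B.dim) ∞ π)
    {F : Foliation M} {s : B → M} {U : Set B} (hs : IsPlaque π F s U) {b : B} (hb : b ∈ U)
    (v : TangentSpace (𝓡 B.dim) b) :
    (mfderiv (𝓡 M.dim) (𝓡 B.dim) π (s b) (mfderiv (𝓡 B.dim) (𝓡 M.dim) s b v) :
      EuclideanSpace ℝ (Fin B.dim)) = v :=
  mfderiv_mfderiv_of_leftInverse (hπ.mdifferentiable (by simp) _)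
    ((hs.contMDiffAt b hb).mdifferentiableAt (by simp))
    (Filter.mem_of_superset (hs.isOpen.mem_nhds hb) fun z hz => hs.section_eq z hz) v

/-- A vector of `F` and the lift of its projection through the plaque both lie in `F` and project
alike, so they agree by flatness. -/
theorem IsPlaque.exists_mfderiv_eq {π : M → B} (hπ : ContMDiff (𝓡 M.dim) (𝓡 B.dim) ∞ π)
    {F : Foliation M} (hF : IsFlatEhresmannConnection π F) {s : B → M} {U : Set B}
    (hs : IsPlaque π F s U) {b : B} (hb : b ∈ U) {q : M} (hq : q = s b)
    {w : TangentSpace (𝓡 M.dim) q} (hw : w ∈ F.space q) :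
    ∃ v : TangentSpace (𝓡 B.dim) b,
      (mfderiv (𝓡 B.dim) (𝓡 M.dim) s b v : EuclideanSpace ℝ (Fin M.dim)) = w := by
  subst hq
  refine ⟨mfderiv (𝓡 M.dim) (𝓡 B.dim) π (s b) w, ?_⟩
  have h1 := hs.mfderiv_section hπ hb (mfderiv (𝓡 M.dim) (𝓡 B.dim) π (s b) w)
  have h2 := (hF (s b)).1 (a₁ := ⟨_, hs.tangent b hb (mfderiv (𝓡 M.dim) (𝓡 B.dim) π (s b) w)⟩)
    (a₂ := ⟨w, hw⟩) h1
  exact congrArg Subtype.val h2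

namespace Foliation

open SmoothMfd.openProd

variable (T : SmoothMfd.{u}) (O : TopologicalSpace.Opens (T × M))

/-- The fibres of the foliation `0 × F` on an open subset of `T × M`. -/
noncomputable def openProdSpace (F : Foliation M) (z : SmoothMfd.openProd T M O) :
    Submodule ℝ (TangentSpace (𝓡 (SmoothMfd.openProd T M O).dim) z) :=
  (mfderiv (𝓡 (SmoothMfd.openProd T M O).dim) (𝓡 T.dim) fst z).toLinearMap.ker ⊓
    (F.space (snd z)).comap
      (mfderiv (𝓡 (SmoothMfd.openProd T M O).dim) (𝓡 M.dim) snd z).toLinearMap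

variable {T O}

theorem mem_openProdSpace {F : Foliation M} {z : SmoothMfd.openProd T M O}
    {v : TangentSpace (𝓡 (SmoothMfd.openProd T M O).dim) z} :
    v ∈ openProdSpace T O F z ↔
      mfderiv (𝓡 (SmoothMfd.openProd T M O).dim) (𝓡 T.dim) fst z v = 0 ∧
        mfderiv (𝓡 (SmoothMfd.openProd T M O).dim) (𝓡 M.dim) snd z v ∈ F.space (snd z) :=
  Iff.rfl

/-- The foliation `0 × F` has integral manifolds, obtained from the plaques of `F`. -/
theorem exists_openProd_plaque {π : M → B} (hπ : ContMDiff (𝓡 M.dim) (𝓡 B.dim) ∞ π)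
    {F : Foliation M} (hF : IsFlatEhresmannConnection π F) (z : SmoothMfd.openProd T M O) :
    ∃ (σ : EuclideanSpace ℝ (Fin B.dim) → SmoothMfd.openProd T M O)
      (ρ : SmoothMfd.openProd T M O → EuclideanSpace ℝ (Fin B.dim))
      (u₀ : EuclideanSpace ℝ (Fin B.dim)), σ u₀ = z ∧
      (∀ᶠ u in 𝓝 u₀, ContMDiffAt (𝓡 B.dim) (𝓡 (SmoothMfd.openProd T M O).dim) ∞ σ u) ∧
      ContMDiffAt (𝓡 (SmoothMfd.openProd T M O).dim) (𝓡 B.dim) ∞ ρ z ∧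
      (∀ᶠ u in 𝓝 u₀, ρ (σ u) = u) ∧
      ∀ᶠ u in 𝓝 u₀, (mfderiv (𝓡 B.dim) (𝓡 (SmoothMfd.openProd T M O).dim) σ u).toLinearMap.range =
        openProdSpace T O F (σ u) := by
  obtain ⟨s, U, hs, hU, hsx⟩ := exists_isPlaque hπ F hF (snd z)
  set ψ := extChartAt (𝓡 B.dim) (π (snd z)) with hψ
  have hsrc : π (snd z) ∈ ψ.source := mem_extChartAt_source _
  have hu₀ : ψ (π (snd z)) ∈ ψ.target := mem_extChartAt_target _
  have hψs : ContinuousAt ψ.symm (ψ (π (snd z))) := continuousAt_extChartAt_symm _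
  have hU' : ∀ᶠ u in 𝓝 (ψ (π (snd z))), ψ.symm u ∈ U := by
    refine hψs.preimage_mem_nhds ?_
    rw [ψ.left_inv hsrc]
    exact hs.isOpen.mem_nhds hU
  have hO : ∀ᶠ u in 𝓝 (ψ (π (snd z))), (fst z, s (ψ.symm u)) ∈ O := by
    have h1 : ContinuousAt s (ψ.symm (ψ (π (snd z)))) := by
      rw [ψ.left_inv hsrc]; exact (hs.contMDiffAt _ hU).continuousAt
    have h2 : ContinuousAt (fun u => (fst z, s (ψ.symm u))) (ψ (π (snd z))) :=
      continuousAt_const.prodMk (ContinuousAt.comp (g := s) h1 hψs)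
    refine h2.preimage_mem_nhds (O.isOpen.mem_nhds ?_)
    rw [ψ.left_inv hsrc, hsx]
    exact mem z
  have hT : ∀ᶠ u in 𝓝 (ψ (π (snd z))), u ∈ ψ.target := extChartAt_target_mem_nhds _
  -- The integral manifold is the plaque through `snd z`, placed in the slice where the first
  -- component is `fst z`.
  let σ : EuclideanSpace ℝ (Fin B.dim) → SmoothMfd.openProd T M O :=
    fun u => extend z (fst z, s (ψ.symm u))
  have hσ : ∀ u, (fst z, s (ψ.symm u)) ∈ O → fst (σ u) = fst z ∧ snd (σ u) = s (ψ.symm u) := by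
    intro u hu
    have : σ u = SmoothMfd.openProd.mk (fst z) (s (ψ.symm u)) hu := extend_eq z hu
    rw [this]; exact ⟨rfl, rfl⟩
  have hsm : ∀ u, ψ.symm u ∈ U → u ∈ ψ.target →
      ContMDiffAt (𝓡 B.dim) (𝓡 M.dim) ∞ (fun u => s (ψ.symm u)) u := fun u hu hut =>
    ContMDiffAt.comp u (hs.contMDiffAt _ hu) (extChartAt_symm_contMDiffAt B _ hut)
  have hσsm : ∀ u, (fst z, s (ψ.symm u)) ∈ O → ψ.symm u ∈ U → u ∈ ψ.target →
      ContMDiffAt (𝓡 B.dim) (𝓡 (SmoothMfd.openProd T M O).dim) ∞ σ u := fun u hu hu' hut =>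
    (contMDiffAt_extend z hu).comp u (contMDiffAt_const.prodMk (hsm u hu' hut))
  refine ⟨σ, fun z' => ψ (π (snd z')), ψ (π (snd z)), ?_, ?_, ?_, ?_, ?_⟩
  · change extend z (fst z, s (ψ.symm (ψ (π (snd z))))) = z
    rw [ψ.left_inv hsrc, hsx, extend_fst_snd]
  · filter_upwards [hU', hO, hT] with u h1 h2 h3 using hσsm u h2 h1 h3
  · exact (extChartAt_contMDiffAt B _ hsrc).comp z (hπ.contMDiffAt.comp z contMDiff_snd.contMDiffAt)
  · filter_upwards [hU', hO, hT] with u h1 h2 h3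
    rw [(hσ u h2).2, hs.section_eq _ h1, ψ.right_inv h3]
  · filter_upwards [hU', hT, hO.eventually_nhds] with u h1 h3 h2
    have hσd := (hσsm u h2.self_of_nhds h1 h3).mdifferentiableAt (by simp)
    have e1 : ∀ w, mfderiv (𝓡 (SmoothMfd.openProd T M O).dim) (𝓡 T.dim) fst (σ u)
        (mfderiv (𝓡 B.dim) (𝓡 (SmoothMfd.openProd T M O).dim) σ u w) = 0 := by
      intro w
      have h4 := mfderiv_comp_apply u (mdifferentiableAt_fst (σ u)) hσd w
      have h5 : fst ∘ σ =ᶠ[𝓝 u] fun _ => fst z := h2.mono fun u' hu' => (hσ u' hu').1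
      have h6 := h5.mfderiv_eq (I := 𝓡 B.dim) (I' := 𝓡 T.dim)
      rw [mfderiv_const] at h6
      exact h4.symm.trans (congrArg (fun L => L w) h6)
    have e2 : ∀ w, (mfderiv (𝓡 (SmoothMfd.openProd T M O).dim) (𝓡 M.dim) snd (σ u)
        (mfderiv (𝓡 B.dim) (𝓡 (SmoothMfd.openProd T M O).dim) σ u w) :
          EuclideanSpace ℝ (Fin M.dim)) =
        mfderiv (𝓡 B.dim) (𝓡 M.dim) s (ψ.symm u)
          (mfderiv (𝓡 B.dim) (𝓡 B.dim) ψ.symm u w) := by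
      intro w
      have h4 := mfderiv_comp_apply u (mdifferentiableAt_snd (σ u)) hσd w
      have h5 : snd ∘ σ =ᶠ[𝓝 u] s ∘ ψ.symm := h2.mono fun u' hu' => (hσ u' hu').2
      have h6 := h5.mfderiv_eq (I := 𝓡 B.dim) (I' := 𝓡 M.dim)
      have h7 := mfderiv_comp_apply u ((hs.contMDiffAt _ h1).mdifferentiableAt (by simp))
        ((extChartAt_symm_contMDiffAt B _ h3).mdifferentiableAt (by simp)) w
      exact h4.symm.trans ((congrArg (fun L => L w) h6).trans h7)
    have hq := (hσ u h2.self_of_nhds).2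
    have e3 : ∀ q : M, q = s (ψ.symm u) → ∀ w : TangentSpace (𝓡 B.dim) (ψ.symm u),
        (mfderiv (𝓡 B.dim) (𝓡 M.dim) s (ψ.symm u) w : EuclideanSpace ℝ (Fin M.dim)) ∈
          F.space q := by
      rintro q rfl w; exact hs.tangent _ h1 w
    ext v
    constructor
    · rintro ⟨w, rfl⟩
      refine mem_openProdSpace.mpr ⟨e1 w, ?_⟩
      exact Eq.mpr (congrArg (· ∈ F.space (snd (σ u))) (e2 w)) (e3 _ hq _)
    · intro hv
      obtain ⟨w', hw'⟩ := hs.exists_mfderiv_eq hπ hF h1 hq (mem_openProdSpace.mp hv).2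
      have h8 := mfderiv_extChartAt_symm_mfderiv B (π (snd z)) (ψ.map_target h3) w'
      rw [ψ.right_inv h3] at h8
      refine ⟨_, tangent_ext ((e1 _).trans (mem_openProdSpace.mp hv).1.symm)
        ((e2 (mfderiv (𝓡 B.dim) (𝓡 B.dim) ψ (ψ.symm u) w')).trans ?_)⟩
      exact (congrArg _ h8).trans hw'

/-- The foliation `0 × F` on an open subset of `T × M`, where `F` is a flat connection. -/
noncomputable def openProd (T : SmoothMfd.{u}) (O : TopologicalSpace.Opens (T × M)) {π : M → B}
    (hπ : ContMDiff (𝓡 M.dim) (𝓡 B.dim) ∞ π) (F : Foliation M)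
    (hF : IsFlatEhresmannConnection π F) : Foliation (SmoothMfd.openProd T M O) where
  space := openProdSpace T O F
  subbundle := by
    obtain ⟨r, hr⟩ := F.subbundle
    refine ⟨r, fun z => ?_⟩
    obtain ⟨U, hU, hzU, X, hX, hspan⟩ := hr (snd z)
    refine ⟨snd ⁻¹' U, hU.preimage contMDiff_snd.continuous, hzU, fun i => liftField (X i),
      fun i => smoothFieldOn_liftField hU (hX i), fun q hq => ⟨?_, ?_⟩⟩
    · refine LinearIndependent.of_comp
        (mfderiv (𝓡 (SmoothMfd.openProd T M O).dim) (𝓡 M.dim) snd q).toLinearMap ?_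
      convert! (hspan (snd q) hq).1 using 1
      exact funext fun i => (mfderiv_liftField (X i) q).2
    · apply le_antisymm
      · rw [Submodule.span_le]
        rintro _ ⟨i, rfl⟩
        refine mem_openProdSpace.mpr ⟨(mfderiv_liftField (X i) q).1, ?_⟩
        rw [(mfderiv_liftField (X i) q).2, ← (hspan (snd q) hq).2]
        exact Submodule.subset_span ⟨i, rfl⟩
      · intro v hv
        obtain ⟨hv1, hv2⟩ := mem_openProdSpace.mp hv
        rw [← (hspan (snd q) hq).2, Submodule.mem_span_range_iff_exists_fun] at hv2
        obtain ⟨c, hc⟩ := hv2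
        rw [Submodule.mem_span_range_iff_exists_fun]
        refine ⟨c, tangent_ext ?_ ?_⟩
        · rw [hv1, map_sum]
          exact Finset.sum_eq_zero fun i _ => by rw [map_smul, (mfderiv_liftField (X i) q).1,
            smul_zero]
        · rw [map_sum, ← hc]
          exact Finset.sum_congr rfl fun i _ => by rw [map_smul, (mfderiv_liftField (X i) q).2]
  -- Fields tangent to `0 × F` are tangent to the slices `{t} × plaque`, hence so is their bracket.
  involutive U hU V W hV hW hVF hWF z hz := by
    obtain ⟨σ, ρ, u₀, rfl, hσ, hρ, hρσ, hr⟩ := exists_openProd_plaque hπ hF z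
    have hUn : ∀ᶠ u in 𝓝 u₀, σ u ∈ U :=
      hσ.self_of_nhds.continuousAt.preimage_mem_nhds (hU.mem_nhds hz)
    rw [← hr.self_of_nhds]
    refine mlieBracket_mem_range hσ hρ hρσ hU hz hV hW ?_ ?_
    · filter_upwards [hr, hUn] with u hu huU
      rw [hu]; exact hVF _ huU
    · filter_upwards [hr, hUn] with u hu huU
      rw [hu]; exact hWF _ huU

end Foliation

end OpenProdFoliation

/-! ### Categorical products with manifolds foliated by points -/

namespace FMn

open SmoothMfd.openProd

/-- All leaves are points. -/
def IsDiscrete (G : FMn.{u}) : Prop := ∀ p, G.fol.space p = ⊥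

/-- A manifold with its foliation by points. -/
@[reducible] noncomputable def zero (X : SmoothMfd.{u}) : FMn.{u} := ⟨X, Foliation.zero X⟩

theorem isDiscrete_zero (X : SmoothMfd.{u}) : (zero X).IsDiscrete := fun _ => rfl

theorem isDiscrete_point : (total SmoothMfd.point.{u}).IsDiscrete :=
  fun p => SmoothMfd.point_submodule_eq p _ _

/-- The morphism to the one-point manifold. -/
noncomputable def toPoint (M : FMn.{u}) : M ⟶ total SmoothMfd.point.{u} := isTerminalPoint.from M

theorem toFun_congr {M N : FMn.{u}} {f g : M ⟶ N} (h : f = g) (x : M.mfd) :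
    f.toFun x = g.toFun x := by rw [h]

theorem hom_ext' {M N : FMn.{u}} {f g : M ⟶ N} (h : ∀ x, f.toFun x = g.toFun x) : f = g :=
  FMn.Hom.ext (funext h)

/-- Morphisms to a manifold foliated by points. -/
noncomputable def homOfDiscrete {M G : FMn.{u}} (hG : G.IsDiscrete) (f : M.mfd → G.mfd)
    (hf : ContMDiff (𝓡 M.mfd.dim) (𝓡 G.mfd.dim) ∞ f)
    (h : ∀ p, ∀ v ∈ M.fol.space p, mfderiv (𝓡 M.mfd.dim) (𝓡 G.mfd.dim) f p v = 0) : M ⟶ G :=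
  { toFun := f
    smooth := hf
    map_space := fun p => by
      rw [hG, eq_bot_iff]
      rintro _ ⟨v, hv, rfl⟩
      exact h p v hv }

/-- Constant morphisms to a manifold foliated by points. -/
noncomputable def const (M : FMn.{u}) {G : FMn.{u}} (hG : G.IsDiscrete) (g : G.mfd) : M ⟶ G :=
  homOfDiscrete hG (fun _ => g) contMDiff_const fun p v _ => by rw [mfderiv_const]; rfl

theorem mfderiv_eq_zero {M G : FMn.{u}} (hG : G.IsDiscrete) (f : M ⟶ G) {p : M.mfd}
    {v : TangentSpace (𝓡 M.mfd.dim) p} (hv : v ∈ M.fol.space p) :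
    mfderiv (𝓡 M.mfd.dim) (𝓡 G.mfd.dim) f.toFun p v = 0 := by
  have h := f.mfderiv_mem hv
  rw [hG] at h
  exact (Submodule.mem_bot ℝ).mp h

/-- This lets a discrete `G` serve as the second factor of `FMn.prod`, so that `G × G` is one of the
products constructed below. -/
theorem isFlat_toPoint {G : FMn.{u}} (hG : G.IsDiscrete) :
    IsFlatEhresmannConnection (toPoint G).toFun G.fol := by
  intro p
  rw [hG]
  have h : Subsingleton (TangentSpace (𝓡 SmoothMfd.point.{u}.dim) ((toPoint G).toFun p)) :=
    inferInstanceAs (Subsingleton (EuclideanSpace ℝ (Fin 0)))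
  exact ⟨Function.injective_of_subsingleton _, fun y => ⟨0, Subsingleton.elim _ _⟩⟩

variable {G M Z : FMn.{u}} {B : SmoothMfd.{u}} {π : M ⟶ total B}
  (hF : IsFlatEhresmannConnection π.toFun M.fol)

/-- An open subset of the product of `G` and `M`, with the foliation induced from `M`. -/
noncomputable def prod (G : FMn.{u}) (hF : IsFlatEhresmannConnection π.toFun M.fol)
    (O : TopologicalSpace.Opens (G.mfd × M.mfd)) : FMn.{u} :=
  ⟨SmoothMfd.openProd G.mfd M.mfd O, Foliation.openProd G.mfd O π.smooth M.fol hF⟩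

variable {O : TopologicalSpace.Opens (G.mfd × M.mfd)}

theorem exists_tangent (z : SmoothMfd.openProd G.mfd M.mfd O)
    (a : TangentSpace (𝓡 G.mfd.dim) (fst z)) (b : TangentSpace (𝓡 M.mfd.dim) (snd z)) :
    ∃ v, mfderiv (𝓡 (SmoothMfd.openProd G.mfd M.mfd O).dim) (𝓡 G.mfd.dim) fst z v = a ∧
      mfderiv (𝓡 (SmoothMfd.openProd G.mfd M.mfd O).dim) (𝓡 M.mfd.dim) snd z v = b := by
  have h1 := (isInvertible_mfderiv_toProd z).self_apply_inverse (a, b)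
  have h2 := (mfderiv_toProd z _).symm.trans h1
  exact ⟨_, congrArg Prod.fst h2, congrArg Prod.snd h2⟩

/-- The first projection. -/
noncomputable def prodFst (hG : G.IsDiscrete) : prod G hF O ⟶ G :=
  homOfDiscrete hG fst contMDiff_fst fun _ _ hv => (Foliation.mem_openProdSpace.mp hv).1

/-- The second projection. -/
noncomputable def prodSnd : prod G hF O ⟶ M :=
  { toFun := snd
    smooth := contMDiff_snd
    map_space := fun z => by
      apply le_antisymm
      · rintro _ ⟨v, hv, rfl⟩
        exact (Foliation.mem_openProdSpace.mp hv).2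
      · intro w hw
        obtain ⟨v, hv1, hv2⟩ := exists_tangent z 0 w
        exact ⟨v, Foliation.mem_openProdSpace.mpr ⟨hv1, by rw [hv2]; exact hw⟩, hv2⟩ }

/-- The morphism with given components. -/
noncomputable def prodLift (hG : G.IsDiscrete) (a : Z ⟶ G) (b : Z ⟶ M)
    (h : ∀ z, (a.toFun z, b.toFun z) ∈ O) : Z ⟶ prod G hF O :=
  have hsm : ContMDiff (𝓡 Z.mfd.dim) (𝓡 (SmoothMfd.openProd G.mfd M.mfd O).dim) ∞
      (fun z => SmoothMfd.openProd.mk (a.toFun z) (b.toFun z) (h z)) := contMDiff_iff.mpr ⟨a.smooth, b.smooth⟩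
  { toFun := fun z => SmoothMfd.openProd.mk (a.toFun z) (b.toFun z) (h z)
    smooth := hsm
    map_space := fun z => by
      have hd := hsm.mdifferentiable (by simp) z
      have e1 := fun v => mfderiv_comp_apply z
        (SmoothMfd.openProd.mdifferentiableAt_fst (SmoothMfd.openProd.mk (a.toFun z) (b.toFun z) (h z))) hd v
      have e2 := fun v => mfderiv_comp_apply z
        (SmoothMfd.openProd.mdifferentiableAt_snd (SmoothMfd.openProd.mk (a.toFun z) (b.toFun z) (h z))) hd v
      apply le_antisymm
      · rintro _ ⟨v, hv, rfl⟩
        refine Foliation.mem_openProdSpace.mpr ⟨(e1 v).symm.trans (mfderiv_eq_zero hG a hv), ?_⟩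
        exact Eq.mpr (congrArg (· ∈ M.fol.space (b.toFun z)) (e2 v).symm) (b.mfderiv_mem hv)
      -- As `G` is discrete, `a` has zero derivative along the leaves, so on leaf directions the
      -- differential is `(0, d b)` and reaches all of `0 × 𝓕`.
      · intro w hw
        obtain ⟨hw1, hw2⟩ := Foliation.mem_openProdSpace.mp hw
        have hw3 : mfderiv (𝓡 (SmoothMfd.openProd G.mfd M.mfd O).dim) (𝓡 M.mfd.dim) snd
          (SmoothMfd.openProd.mk (a.toFun z) (b.toFun z) (h z)) w ∈ (Z.fol.space z).map
            (mfderiv (𝓡 Z.mfd.dim) (𝓡 M.mfd.dim) b.toFun z).toLinearMap := by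
          rw [b.map_space]; exact hw2
        obtain ⟨v, hv, hvw⟩ := hw3
        exact ⟨v, hv, tangent_ext
          (((e1 v).symm.trans (mfderiv_eq_zero hG a hv)).trans hw1.symm) ((e2 v).symm.trans hvw)⟩ }

theorem prod_hom_ext (hG : G.IsDiscrete) {f g : Z ⟶ prod G hF O}
    (h₁ : f ≫ prodFst hF hG = g ≫ prodFst hF hG) (h₂ : f ≫ prodSnd hF = g ≫ prodSnd hF) : f = g :=
  hom_ext' fun z => SmoothMfd.openProd.ext (toFun_congr h₁ z) (toFun_congr h₂ z)

/-- The product of a manifold foliated by points and a flat connection. -/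
noncomputable def isLimitProd (hG : G.IsDiscrete) :
    IsLimit (BinaryFan.mk (prodFst (O := ⊤) hF hG) (prodSnd hF)) :=
  BinaryFan.isLimitMk (fun s => prodLift hF hG s.fst s.snd fun _ => trivial)
    (fun _ => rfl) (fun _ => rfl) fun _ _ h₁ h₂ => prod_hom_ext hF hG h₁ h₂

end FMn

/-! ### Division in principal bundles -/

section PrincipalBundles

variable {G H : LieGrp.{u}} {M B : SmoothMfd.{u}} {α : LieAction G M} {π : M → B}

/-- In a trivialization `g` multiplies the group component from the left, so it can be read off from
one point. -/
theorem IsPrincipalBundle.act_injective (h : IsPrincipalBundle α π) {g g' : G} {x : M}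
    (hx : α.act g x = α.act g' x) : g = g' := by
  obtain ⟨U, Φ, -, hb, hs, -, -, -, -, hact⟩ := h.2 (π x)
  have hxs : x ∈ Φ.source := by rw [hs]; exact hb
  have h1 := hact g x hxs
  rw [hx, hact g' x hxs] at h1
  exact (mul_right_cancel h1).symm

theorem IsPrincipalBundle.exists_act_eq (h : IsPrincipalBundle α π) {x y : M} (hxy : π x = π y) :
    ∃ g, α.act g x = y := by
  obtain ⟨U, Φ, -, hb, hs, -, -, -, hfst, hact⟩ := h.2 (π x)
  have hxs : x ∈ Φ.source := by rw [hs]; exact hb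
  have hys : y ∈ Φ.source := by rw [hs, Set.mem_preimage, ← hxy]; exact hb
  refine ⟨(Φ y).2 * (Φ x).2⁻¹, ?_⟩
  have has : α.act ((Φ y).2 * (Φ x).2⁻¹) x ∈ Φ.source := by
    rw [hs, Set.mem_preimage, h.1]; exact hb
  refine Φ.injOn has hys (Prod.ext ?_ ?_)
  · rw [hfst _ has, hfst _ hys, h.1, hxy]
  · rw [hact _ _ hxs, inv_mul_cancel_right]

/-- The map `N → G` comparing two maps into a principal bundle with the same projection is
smooth. -/
theorem IsPrincipalBundle.contMDiff_division (h : IsPrincipalBundle α π) {N : SmoothMfd.{u}}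
    {a b : N → M} (ha : ContMDiff (𝓡 N.dim) (𝓡 M.dim) ∞ a)
    (hb : ContMDiff (𝓡 N.dim) (𝓡 M.dim) ∞ b) {δ : N → G} (hδ : ∀ n, α.act (δ n) (a n) = b n) :
    ContMDiff (𝓡 N.dim) (𝓡 G.dim) ∞ δ := by
  intro n
  obtain ⟨U, Φ, hU, hn, hs, -, hΦ, -, -, hact⟩ := h.2 (π (a n))
  have hb' : ∀ n, π (b n) = π (a n) := fun n => by rw [← hδ n, h.1]
  have hΦs : ∀ c : N → M, ContMDiff (𝓡 N.dim) (𝓡 M.dim) ∞ c → c n ∈ Φ.source →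
      ContMDiffAt (𝓡 N.dim) (𝓡 G.dim) ∞ (fun m => (Φ (c m)).2) n := fun c hc hcs =>
    contMDiffAt_snd.comp n (ContMDiffAt.comp n (g := Φ)
      (hΦ.contMDiffAt (Φ.open_source.mem_nhds hcs)) hc.contMDiffAt)
  have has : a n ∈ Φ.source := by rw [hs]; exact hn
  have hbs : b n ∈ Φ.source := by rw [hs, Set.mem_preimage, hb']; exact hn
  refine ((hΦs b hb hbs).mul (hΦs a ha has).inv).congr_of_eventuallyEq ?_
  filter_upwards [ha.continuous.continuousAt.preimage_mem_nhds (Φ.open_source.mem_nhds has)]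
    with m hm
  change δ m = (Φ (b m)).2 * ((Φ (a m)).2)⁻¹
  rw [← hδ m, hact _ _ hm, mul_inv_cancel_right]

theorem LieAction.contMDiff_act (α : LieAction G M) (g : G) :
    ContMDiff (𝓡 M.dim) (𝓡 M.dim) ∞ (α.act g) :=
  α.smooth.comp (contMDiff_const.prodMk contMDiff_id)

theorem LieAction.contMDiff_orbit (α : LieAction G M) (x : M) :
    ContMDiff (𝓡 G.dim) (𝓡 M.dim) ∞ (fun g => α.act g x) :=
  α.smooth.comp (contMDiff_id.prodMk contMDiff_const)

end PrincipalBundles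

/-! ### The structure group as the group of automorphisms over the base -/

section Translations

variable {G H : LieGrp.{u}} {M : FMn.{u}} {B : SmoothMfd.{u}} {α : LieAction G M.mfd}
  {β : LieAction H M.mfd} {π : M ⟶ FMn.total B}

/-- The translation by a group element, as a morphism of foliated manifolds. -/
noncomputable def translation (hα : IsInvariantFoliation α M.fol) (g : G) : M ⟶ M :=
  { toFun := α.act g
    smooth := α.contMDiff_act g
    map_space := hα g }

/-- The homomorphism `g ↦ L_g` to the automorphisms over the base. -/
noncomputable def translationHom (h : IsPrincipalWithConnection α π.toFun M.fol) :
    G →* AutOver π where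
  toFun g := ⟨
    { hom := translation h.2.2 g
      inv := translation h.2.2 g⁻¹
      hom_inv_id := FMn.hom_ext' fun x => by
        change α.act g⁻¹ (α.act g x) = x
        rw [← α.mul_act, inv_mul_cancel, α.one_act]
      inv_hom_id := FMn.hom_ext' fun x => by
        change α.act g (α.act g⁻¹ x) = x
        rw [← α.mul_act, mul_inv_cancel, α.one_act] }, FMn.hom_ext' fun x => h.1.1 g x⟩
  map_one' := Subtype.ext (Aut.ext (FMn.hom_ext' fun x => α.one_act x))
  map_mul' g g' := Subtype.ext (Aut.ext (FMn.hom_ext' fun x => α.mul_act g g' x))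

theorem translationHom_apply (h : IsPrincipalWithConnection α π.toFun M.fol) (g : G) (x : M.mfd) :
    (translationHom h g).1.hom.toFun x = α.act g x := rfl

/-- Injectivity is freeness. For surjectivity, some `g` moves `p` to `σ p`, both being in one fibre;
then `L_g` and `σ` agree at a point with dense leaf and so everywhere. -/
theorem translationHom_bijective (hM : M.IsIrreducible)
    (h : IsPrincipalWithConnection α π.toFun M.fol) : Function.Bijective (translationHom h) := by
  obtain ⟨p, hp⟩ := hM
  constructor
  · intro g g' hgg
    refine h.1.act_injective (x := p) ?_
    rw [← translationHom_apply h, hgg, translationHom_apply]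
  · intro σ
    have hσ : σ.1.hom ≫ π = π := σ.2
    obtain ⟨g, hg⟩ := h.1.exists_act_eq (x := p) (y := σ.1.hom.toFun p)
      (FMn.toFun_congr hσ p).symm
    refine ⟨g, Subtype.ext (Aut.ext ?_)⟩
    exact FMn.hom_ext_of_dense_leaf h.2.1 hp ((translationHom h g).2.trans hσ.symm) hg

/-- The isomorphism of a structure group with the group of automorphisms over the base. -/
noncomputable def translationEquiv (hM : M.IsIrreducible)
    (h : IsPrincipalWithConnection α π.toFun M.fol) : G ≃* AutOver π :=
  MulEquiv.ofBijective (translationHom h) (translationHom_bijective hM h)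

theorem translationEquiv_apply (hM : M.IsIrreducible)
    (h : IsPrincipalWithConnection α π.toFun M.fol) (g : G) (x : M.mfd) :
    (translationEquiv hM h g).1.hom.toFun x = α.act g x := rfl

theorem act_translationEquiv_symm (hM : M.IsIrreducible)
    (h : IsPrincipalWithConnection α π.toFun M.fol)
    (h' : IsPrincipalWithConnection β π.toFun M.fol) (g : G) (x : M.mfd) :
    β.act ((translationEquiv hM h').symm (translationEquiv hM h g)) x = α.act g x := by
  rw [← translationEquiv_apply hM h' _ x, MulEquiv.apply_symm_apply, translationEquiv_apply]

/-- Both groups are identified with `Aut_B(M)`. The resulting isomorphism `ψ` satisfies `ψ g · p = g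
· p`, so it divides an orbit map by a constant map and is smooth; its inverse likewise. -/
theorem IsPrincipalWithConnection.conjugate (hM : M.IsIrreducible)
    (h : IsPrincipalWithConnection α π.toFun M.fol)
    (h' : IsPrincipalWithConnection β π.toFun M.fol) : α.Conjugate β := by
  obtain ⟨p, -⟩ := id hM
  refine ⟨(translationEquiv hM h).trans (translationEquiv hM h').symm, ?_, ?_,
    act_translationEquiv_symm hM h h'⟩
  · exact h'.1.contMDiff_division contMDiff_const (α.contMDiff_orbit p)
      fun g => act_translationEquiv_symm hM h h' g p
  · exact h.1.contMDiff_division contMDiff_const (β.contMDiff_orbit p)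
      fun g => act_translationEquiv_symm hM h' h g p

end Translations

/-! ### Splitting actions as pullback squares -/

section SplittingActions

variable {C : Type w} [Category.{v} C] {M B : C} {π : M ⟶ B} {G : GroupObj C} {A : ActionObj G M}

/-- An isomorphism of groupoids over `M` respects source and target, so it transports the limit
property to `(snd, act)`. -/
theorem IsSplittingAction.isPullback (h : IsSplittingAction π A) : IsPullback A.snd A.act π π := by
  obtain ⟨K, s, t, hK, ⟨e⟩⟩ := h
  exact IsPullback.of_iso hK e.iso.symm (Iso.refl M) (Iso.refl M) (Iso.refl B)
    ((Category.comp_id s).trans ((Iso.eq_inv_comp e.iso).mpr e.src))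
    ((Category.comp_id t).trans ((Iso.eq_inv_comp e.iso).mpr e.tgt)) (by simp) (by simp)

/-- Compatibility with composition is automatic, since arrows into a kernel pair are determined by
source and target. -/
theorem isSplittingAction_of_isPullback (h : IsPullback A.snd A.act π π) :
    IsSplittingAction π A := by
  refine ⟨A.prod, A.snd, A.act, h, ⟨⟨Iso.refl _, Category.id_comp _, Category.id_comp _, ?_⟩⟩⟩
  intro Z b a hab
  have e : ∀ (c : Z ⟶ A.prod) {Y : C} (f : A.prod ⟶ Y), (c ≫ 𝟙 A.prod) ≫ f = c ≫ f :=
    fun c _ f => congrArg (· ≫ f) (Category.comp_id c)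
  refine h.hom_ext ((e _ A.snd).trans ?_) ((e _ A.act).trans ?_)
  · exact ((A.groupoid.comp_src b a hab).trans (e a A.snd).symm).trans
      ((kernelPairGroupoid h).comp_src _ _ _).symm
  · exact ((A.groupoid.comp_tgt b a hab).trans (e b A.act).symm).trans
      ((kernelPairGroupoid h).comp_tgt _ _ _).symm

end SplittingActions

/-! ### From a principal bundle to a splitting action -/

section Derivatives

variable {T M N Z : SmoothMfd.{u}}

theorem mfderiv_comp_prodMk {f : T × M → N} {a : Z → T} {b : Z → M} {z : Z}
    (hf : MDifferentiableAt ((𝓡 T.dim).prod (𝓡 M.dim)) (𝓡 N.dim) f (a z, b z))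
    (ha : MDifferentiableAt (𝓡 Z.dim) (𝓡 T.dim) a z)
    (hb : MDifferentiableAt (𝓡 Z.dim) (𝓡 M.dim) b z) (v : TangentSpace (𝓡 Z.dim) z) :
    mfderiv (𝓡 Z.dim) (𝓡 N.dim) (fun z => f (a z, b z)) z v =
      mfderiv (𝓡 T.dim) (𝓡 N.dim) (fun t => f (t, b z)) (a z) (mfderiv (𝓡 Z.dim) (𝓡 T.dim) a z v) +
        mfderiv (𝓡 M.dim) (𝓡 N.dim) (fun m => f (a z, m)) (b z)
          (mfderiv (𝓡 Z.dim) (𝓡 M.dim) b z v) := by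
  have h1 := mfderiv_comp_apply (f := fun z => (a z, b z)) z hf (ha.prodMk hb) v
  have h2 := congrArg (fun L => L v) (mfderiv_prodMk ha hb)
  exact h1.trans ((congrArg _ h2).trans (mfderiv_prod_eq_add_apply hf))

end Derivatives

section ActionOfPrincipalBundle

variable {G H : LieGrp.{u}} {M : FMn.{u}} {B : SmoothMfd.{u}} {α : LieAction G M.mfd}
  {π : M ⟶ FMn.total B}

/-- Differentiating `δ · a = b` along `v` gives a term from moving `δ` and a term from moving `a`.
The second is in `𝓕` by invariance, so the first is too. Being tangent to an orbit it is vertical,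
hence zero, and orbit maps are immersions. -/
theorem mfderiv_division (h : IsPrincipalWithConnection α π.toFun M.fol) {N : SmoothMfd.{u}}
    {a b : N → M.mfd} (ha : ContMDiff (𝓡 N.dim) (𝓡 M.mfd.dim) ∞ a)
    (hb : ContMDiff (𝓡 N.dim) (𝓡 M.mfd.dim) ∞ b) {δ : N → G} (hδ : ∀ n, α.act (δ n) (a n) = b n)
    {n : N} {v : TangentSpace (𝓡 N.dim) n}
    (hav : mfderiv (𝓡 N.dim) (𝓡 M.mfd.dim) a n v ∈ M.fol.space (a n))
    (hbv : mfderiv (𝓡 N.dim) (𝓡 M.mfd.dim) b n v ∈ M.fol.space (b n)) :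
    mfderiv (𝓡 N.dim) (𝓡 G.dim) δ n v = 0 := by
  have hδs := h.1.contMDiff_division ha hb hδ
  obtain rfl : (fun n => α.act (δ n) (a n)) = b := funext hδ
  have h1 := mfderiv_comp_prodMk (f := fun p : G × M.mfd => α.act p.1 p.2)
    (α.smooth.mdifferentiable (by simp) _) (hδs.mdifferentiable (by simp) n)
    (ha.mdifferentiable (by simp) n) v
  have h2 : mfderiv (𝓡 M.mfd.dim) (𝓡 M.mfd.dim) (α.act (δ n)) (a n)
      (mfderiv (𝓡 N.dim) (𝓡 M.mfd.dim) a n v) ∈ M.fol.space (α.act (δ n) (a n)) := by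
    rw [← h.2.2]
    exact Submodule.mem_map_of_mem hav
  set w := mfderiv (𝓡 G.dim) (𝓡 M.mfd.dim) (fun g => α.act g (a n)) (δ n)
    (mfderiv (𝓡 N.dim) (𝓡 G.dim) δ n v) with hw
  have h3 : w ∈ M.fol.space (α.act (δ n) (a n)) := by
    have h4 := Submodule.sub_mem _ hbv h2
    have h5 := eq_sub_of_add_eq h1.symm
    exact Eq.mpr (congrArg (· ∈ M.fol.space (α.act (δ n) (a n))) h5) h4
  have hor := (α.contMDiff_orbit (a n)).mdifferentiable (by simp) (δ n)
  have h6 : mfderiv (𝓡 M.mfd.dim) (𝓡 B.dim) π.toFun (α.act (δ n) (a n)) w = 0 := by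
    have h7 := mfderiv_comp_apply (δ n) (f := fun g => α.act g (a n))
      (π.mdifferentiableAt (α.act (δ n) (a n))) hor
      (mfderiv (𝓡 N.dim) (𝓡 G.dim) δ n v)
    have h8 : π.toFun ∘ (fun g => α.act g (a n)) = fun _ => π.toFun (a n) :=
      funext fun g => h.1.1 g (a n)
    refine h7.symm.trans ?_
    rw [h8, mfderiv_const]
    rfl
  have h9 : w = 0 := congrArg Subtype.val ((h.2.1 (α.act (δ n) (a n))).1 (a₁ := ⟨w, h3⟩)
    (a₂ := 0) (h6.trans (map_zero _).symm))
  obtain ⟨U, Φ, hU, hn, hs, -, hΦ, -, -, hact⟩ := h.1.2 (π.toFun (a n))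
  have has : a n ∈ Φ.source := by rw [hs]; exact hn
  have has' : α.act (δ n) (a n) ∈ Φ.source := by rw [hs, Set.mem_preimage, h.1.1]; exact hn
  -- A local left inverse of the orbit map, read off in the trivialization, so that `w = 0` forces
  -- the derivative of `δ` to vanish.
  have hρ : ContMDiffAt (𝓡 M.mfd.dim) (𝓡 G.dim) ∞ (fun y => (Φ y).2 * (Φ (a n)).2⁻¹)
      (α.act (δ n) (a n)) :=
    ContMDiffAt.mul (contMDiffAt_snd.comp _ (hΦ.contMDiffAt (Φ.open_source.mem_nhds has')))
      contMDiffAt_const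
  have h10 := mfderiv_mfderiv_of_leftInverse (f := fun g => α.act g (a n))
    (hρ.mdifferentiableAt (by simp)) hor
    (Filter.Eventually.of_forall fun g => by rw [hact _ _ has, mul_inv_cancel_right])
    (mfderiv (𝓡 N.dim) (𝓡 G.dim) δ n v)
  exact h10.symm.trans ((congrArg _ h9).trans (map_zero _))

/-- A Lie group as a group object: the manifold is foliated by points. -/
noncomputable def LieGrp.groupObj (G : LieGrp.{u}) : GroupObj FMn.{u} where
  X := FMn.zero G.toSmoothMfd
  grp Z :=
    letI : Mul (Z ⟶ FMn.zero G.toSmoothMfd) := ⟨fun a b =>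
      FMn.homOfDiscrete (FMn.isDiscrete_zero _) (fun z => (a.toFun z * b.toFun z : G))
        (ContMDiff.mul (G := G) a.smooth b.smooth) fun p v hv => by
        refine (mfderiv_comp_prodMk (T := G.toSmoothMfd) (M := G.toSmoothMfd)
          (f := fun p : G × G => p.1 * p.2) ((contMDiff_mul (𝓡 G.dim) ∞).mdifferentiable (by simp) _)
          (a.mdifferentiableAt p) (b.mdifferentiableAt p) v).trans ?_
        refine (congrArg₂ (· + ·) ((congrArg _ (FMn.mfderiv_eq_zero (FMn.isDiscrete_zero _) a hv)).trans
          (map_zero _)) ((congrArg _ (FMn.mfderiv_eq_zero (FMn.isDiscrete_zero _) b hv)).trans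
          (map_zero _))).trans (add_zero 0)⟩
    letI : One (Z ⟶ FMn.zero G.toSmoothMfd) := ⟨FMn.const Z (FMn.isDiscrete_zero _) (1 : G)⟩
    letI : Inv (Z ⟶ FMn.zero G.toSmoothMfd) := ⟨fun a =>
      FMn.homOfDiscrete (FMn.isDiscrete_zero _) (fun z => (a.toFun z : G)⁻¹)
        (ContMDiff.inv (G := G) a.smooth) fun p v hv => by
        refine (mfderiv_comp_apply p (g := fun g : G => g⁻¹)
          ((contMDiff_inv (𝓡 G.dim) ∞).mdifferentiable (by simp) _) (a.mdifferentiableAt p) v).trans ?_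
        exact (congrArg _ (FMn.mfderiv_eq_zero (FMn.isDiscrete_zero _) a hv)).trans (map_zero _)⟩
    Group.ofLeftAxioms (fun a b c => FMn.hom_ext' fun z => mul_assoc (G := G) _ _ _)
      (fun a => FMn.hom_ext' fun z => one_mul (M := G) _)
      (fun a => FMn.hom_ext' fun z => inv_mul_cancel (G := G) _)
  comp_mul f a b := rfl

/-- The action morphism `G × M → M`. -/
noncomputable def actHom (h : IsPrincipalWithConnection α π.toFun M.fol) :
    FMn.prod (FMn.zero G.toSmoothMfd) h.2.1 ⊤ ⟶ M :=
  have hsm : ContMDiff (𝓡 (SmoothMfd.openProd G.toSmoothMfd M.mfd ⊤).dim) (𝓡 M.mfd.dim) ∞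
      (fun z : SmoothMfd.openProd G.toSmoothMfd M.mfd ⊤ =>
        α.act (SmoothMfd.openProd.fst z) (SmoothMfd.openProd.snd z)) :=
    α.smooth.comp (SmoothMfd.openProd.contMDiff_fst.prodMk SmoothMfd.openProd.contMDiff_snd)
  { toFun := fun z => α.act (SmoothMfd.openProd.fst z) (SmoothMfd.openProd.snd z)
    smooth := hsm
    map_space := fun z => by
      have e : ∀ v, mfderiv (𝓡 (SmoothMfd.openProd G.toSmoothMfd M.mfd ⊤).dim) (𝓡 G.dim)
            SmoothMfd.openProd.fst z v = 0 →
          mfderiv (𝓡 (SmoothMfd.openProd G.toSmoothMfd M.mfd ⊤).dim) (𝓡 M.mfd.dim)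
            (fun z : SmoothMfd.openProd G.toSmoothMfd M.mfd ⊤ =>
              α.act (SmoothMfd.openProd.fst z) (SmoothMfd.openProd.snd z)) z v =
            mfderiv (𝓡 M.mfd.dim) (𝓡 M.mfd.dim) (α.act (SmoothMfd.openProd.fst z))
              (SmoothMfd.openProd.snd z) (mfderiv (𝓡 (SmoothMfd.openProd G.toSmoothMfd M.mfd ⊤).dim)
                (𝓡 M.mfd.dim) SmoothMfd.openProd.snd z v) := by
        intro v hv
        refine (mfderiv_comp_prodMk (f := fun p : G × M.mfd => α.act p.1 p.2)
          (α.smooth.mdifferentiable (by simp) _) (SmoothMfd.openProd.mdifferentiableAt_fst z)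
          (SmoothMfd.openProd.mdifferentiableAt_snd z) v).trans ?_
        exact (congrArg (· + _) ((congrArg _ hv).trans (map_zero _))).trans (zero_add _)
      apply le_antisymm
      · rintro _ ⟨v, hv, rfl⟩
        obtain ⟨hv1, hv2⟩ := Foliation.mem_openProdSpace.mp hv
        rw [← h.2.2]
        exact ⟨_, hv2, (e v hv1).symm⟩
      · intro w hw
        rw [← h.2.2] at hw
        obtain ⟨u, hu, rfl⟩ := hw
        obtain ⟨v, hv1, hv2⟩ := FMn.exists_tangent (G := FMn.zero G.toSmoothMfd) z 0 u
        refine ⟨v, Foliation.mem_openProdSpace.mpr ⟨hv1, by rw [hv2]; exact hu⟩, ?_⟩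
        exact (e v hv1).trans (congrArg _ hv2) }

/-- The action of the group object of `G`. -/
noncomputable def actionObj (h : IsPrincipalWithConnection α π.toFun M.fol) :
    ActionObj G.groupObj M where
  prod := FMn.prod (FMn.zero G.toSmoothMfd) h.2.1 ⊤
  fst := FMn.prodFst h.2.1 (FMn.isDiscrete_zero _)
  snd := FMn.prodSnd h.2.1
  isLimit := FMn.isLimitProd h.2.1 (FMn.isDiscrete_zero _)
  act := actHom h
  one_act x := FMn.hom_ext' fun z => α.one_act (x.toFun z)
  mul_act g k x := FMn.hom_ext' fun z => α.mul_act (g.toFun z) (k.toFun z) (x.toFun z)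

/-- For a cone over `π, π` transitivity gives a pointwise quotient `δ`. It is smooth by local
triviality and is a morphism to the discrete `G` because its derivative vanishes along the leaves;
freeness gives uniqueness. -/
theorem isPullback_actionObj (h : IsPrincipalWithConnection α π.toFun M.fol) :
    IsPullback (actionObj h).snd (actionObj h).act π π := by
  have hex : ∀ s : PullbackCone π π, ∀ z, ∃ g : G, α.act g (s.fst.toFun z) = s.snd.toFun z :=
    fun s z => h.1.exists_act_eq (FMn.toFun_congr s.condition z)
  choose δ hδ using hex
  refine ⟨⟨FMn.hom_ext' fun z => (h.1.1 _ _).symm⟩, ⟨PullbackCone.IsLimit.mk _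
    (fun s => (actionObj h).pair (FMn.homOfDiscrete (FMn.isDiscrete_zero _) (δ s)
      (h.1.contMDiff_division s.fst.smooth s.snd.smooth (hδ s)) fun p v hv =>
        mfderiv_division h s.fst.smooth s.snd.smooth (hδ s) (s.fst.mfderiv_mem hv)
          (s.snd.mfderiv_mem hv)) s.fst)
    (fun s => (actionObj h).pair_snd _ _) (fun s => FMn.hom_ext' fun z => hδ s z) ?_⟩⟩
  intro s m h1 h2
  refine (actionObj h).hom_ext ?_ (h1.trans ((actionObj h).pair_snd _ _).symm)
  refine FMn.hom_ext' fun z => h.1.act_injective (x := s.fst.toFun z) ?_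
  refine Eq.trans ?_ ((FMn.toFun_congr h2 z).trans (hδ s z).symm)
  exact congrArg (α.act _) (FMn.toFun_congr h1 z).symm

end ActionOfPrincipalBundle

/-! ### From group objects to Lie groups and their actions -/

section PullbackActions

variable {C : Type w} [Category.{v} C] {M B Z : C} {π : M ⟶ B} {G : GroupObj C} {A : ActionObj G M}

theorem ActionObj.app_comp_of_isPullback (h : IsPullback A.snd A.act π π) (g : Z ⟶ G.X)
    (a : Z ⟶ M) : A.app g a ≫ π = a ≫ π := by
  rw [ActionObj.app, Category.assoc, ← h.w, ← Category.assoc, ActionObj.pair_snd]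

/-- This and the next lemma are transitivity and freeness on generalized elements: a pair with equal
projections is one arrow of the kernel pair. -/
theorem ActionObj.exists_app_eq (h : IsPullback A.snd A.act π π) {a b : Z ⟶ M}
    (hab : a ≫ π = b ≫ π) : ∃ g, A.app g a = b := by
  refine ⟨h.lift a b hab ≫ A.fst, ?_⟩
  have h1 := A.comp_act (h.lift a b hab)
  rw [h.lift_fst, h.lift_snd] at h1
  exact h1.symm

theorem ActionObj.app_left_injective (h : IsPullback A.snd A.act π π) {g g' : Z ⟶ G.X} {a : Z ⟶ M}
    (hg : A.app g a = A.app g' a) : g = g' := by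
  have h1 : A.pair g a = A.pair g' a := h.hom_ext (by simp) hg
  rw [← A.pair_fst g a, h1, A.pair_fst]

end PullbackActions

section LieGroupOfGroupObject

open FMn

theorem Foliation.eq_bot_of_eq_bot {M : SmoothMfd.{u}} (F : Foliation M) {p : M}
    (hp : F.space p = ⊥) (q : M) : F.space q = ⊥ := by
  obtain ⟨r, hr⟩ := F.subbundle
  have h1 : ∀ q, Module.finrank ℝ (F.space q) = r := by
    intro q
    obtain ⟨U, -, hq, X, -, hX⟩ := hr q
    rw [← (hX q hq).2, finrank_span_eq_card (hX q hq).1, Fintype.card_fin]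
  have h2 := h1 p
  rw [hp, finrank_bot] at h2
  have : FiniteDimensional ℝ (TangentSpace (𝓡 M.dim) q) :=
    inferInstanceAs (FiniteDimensional ℝ (EuclideanSpace ℝ (Fin M.dim)))
  exact Submodule.finrank_eq_zero.mp ((h1 q).trans h2.symm)

namespace GroupObj

variable (G : GroupObj FMn.{u})

/-- The unit maps the zero foliation of the point onto the fibre at the identity, which is therefore
zero; constancy of the rank does the rest. -/
theorem isDiscrete : G.X.IsDiscrete := by
  refine G.X.fol.eq_bot_of_eq_bot (p := (1 : total SmoothMfd.point.{u} ⟶ G.X).toFun SmoothMfd.star) ?_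
  rw [← (1 : total SmoothMfd.point.{u} ⟶ G.X).map_space, isDiscrete_point, Submodule.map_bot]

/-- The points of a group object are its global elements. -/
noncomputable def pointsEquiv : G.X.mfd ≃ (total SmoothMfd.point.{u} ⟶ G.X) where
  toFun g := const _ G.isDiscrete g
  invFun f := f.toFun SmoothMfd.star
  left_inv _ := rfl
  right_inv _ := rfl

noncomputable instance : Group G.X.mfd := G.pointsEquiv.group

theorem mul_def (g h : G.X.mfd) :
    g * h = (const _ G.isDiscrete g * const _ G.isDiscrete h :
      total SmoothMfd.point.{u} ⟶ G.X).toFun SmoothMfd.star := rfl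

/-- The multiplication morphism. -/
noncomputable def mulHom : FMn.prod G.X (isFlat_toPoint G.isDiscrete) ⊤ ⟶ G.X :=
  prodFst _ G.isDiscrete * prodSnd _

/-- By naturality every product of generalized elements comes from that of the two projections of `G
× G`. Multiplication is thereby a single smooth map and can be computed pointwise. -/
theorem mul_eq {Z : FMn.{u}} (a b : Z ⟶ G.X) :
    a * b = prodLift (isFlat_toPoint G.isDiscrete) (O := ⊤) G.isDiscrete a b (fun _ => trivial) ≫
      G.mulHom := by
  rw [mulHom, G.comp_mul]
  rfl

theorem mulHom_toFun (g h : G.X.mfd) :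
    G.mulHom.toFun (SmoothMfd.openProd.mk g h trivial) = g * h := by
  rw [mul_def, mul_eq]
  rfl

theorem mul_toFun {Z : FMn.{u}} (a b : Z ⟶ G.X) (z : Z.mfd) :
    (a * b).toFun z = a.toFun z * b.toFun z := by
  rw [mul_eq, ← mulHom_toFun]
  rfl

theorem one_toFun {Z : FMn.{u}} (z : Z.mfd) : (1 : Z ⟶ G.X).toFun z = 1 := by
  rw [← G.comp_one (toPoint Z)]
  rfl

theorem inv_toFun {Z : FMn.{u}} (a : Z ⟶ G.X) (z : Z.mfd) : (a⁻¹).toFun z = (a.toFun z)⁻¹ := by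
  rw [eq_inv_iff_mul_eq_one, ← mul_toFun, inv_mul_cancel, one_toFun]

/-- The Lie group of points of a group object. -/
noncomputable def lieGrp : LieGrp.{u} :=
  { G.X.mfd with
    lieGroup :=
      { contMDiff_mul := by
          have h : ContMDiff ((𝓡 G.X.mfd.dim).prod (𝓡 G.X.mfd.dim))
              (𝓡 (SmoothMfd.openProd G.X.mfd G.X.mfd ⊤).dim) ∞
              (fun p : G.X.mfd × G.X.mfd =>
                (SmoothMfd.openProd.mk p.1 p.2 trivial : SmoothMfd.openProd G.X.mfd G.X.mfd ⊤)) :=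
            SmoothMfd.openProd.contMDiff_iff.mpr ⟨contMDiff_fst, contMDiff_snd⟩
          refine (G.mulHom.smooth.comp h).congr fun p => ?_
          exact (G.mulHom_toFun p.1 p.2).symm
        contMDiff_inv := (𝟙 G.X : G.X ⟶ G.X)⁻¹.smooth.congr fun g =>
          (G.inv_toFun (𝟙 G.X) g).symm } }

theorem const_mul_const (Z : FMn.{u}) (g h : G.X.mfd) :
    (const Z G.isDiscrete (g * h) : Z ⟶ G.X) = const Z G.isDiscrete g * const Z G.isDiscrete h :=
  hom_ext' fun z => (G.mul_toFun (const Z G.isDiscrete g) (const Z G.isDiscrete h) z).symm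

theorem const_one (Z : FMn.{u}) : (const Z G.isDiscrete 1 : Z ⟶ G.X) = 1 :=
  hom_ext' fun z => (G.one_toFun z).symm

end GroupObj

variable {G : GroupObj FMn.{u}} {M : FMn.{u}} {B : SmoothMfd.{u}} {π : M ⟶ total B}
  (A : ActionObj G M) (hF : IsFlatEhresmannConnection π.toFun M.fol)

namespace ActionObj

/-- The action of a point of a group object. -/
noncomputable def translate (g : G.X.mfd) : M ⟶ M := A.app (const M G.isDiscrete g) (𝟙 M)

theorem app_const {Z : FMn.{u}} (g : G.X.mfd) (a : Z ⟶ M) :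
    A.app (const Z G.isDiscrete g) a = a ≫ A.translate g := by
  rw [translate, comp_app, Category.comp_id]
  rfl

/-- `A.prod` is an arbitrary product object. Naturality of `app` moves the action to the explicit
product, where its value at `z` depends only on the values of `a` and `b` at `z`. -/
theorem app_toFun_eq {Z : FMn.{u}} (a : Z ⟶ G.X) (b : Z ⟶ M) (z : Z.mfd) :
    (A.app a b).toFun z = (A.app (prodFst (O := ⊤) hF G.isDiscrete) (prodSnd hF)).toFun
      (SmoothMfd.openProd.mk (a.toFun z) (b.toFun z) trivial) := by
  rw [show A.app a b = prodLift hF (O := ⊤) G.isDiscrete a b (fun _ => trivial) ≫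
    A.app (prodFst hF G.isDiscrete) (prodSnd hF) by rw [comp_app]; rfl]
  rfl

include hF in
theorem app_toFun {Z : FMn.{u}} (a : Z ⟶ G.X) (b : Z ⟶ M) (z : Z.mfd) :
    (A.app a b).toFun z = (A.translate (a.toFun z)).toFun (b.toFun z) :=
  (A.app_toFun_eq hF a b z).trans (A.app_toFun_eq hF (const M G.isDiscrete (a.toFun z)) (𝟙 M) (b.toFun z)).symm

theorem translate_mul (g h : G.X.mfd) (x : M.mfd) :
    (A.translate (g * h)).toFun x = (A.translate g).toFun ((A.translate h).toFun x) := by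
  rw [translate, G.const_mul_const, app_mul, app_const]
  rfl

/-- The action of the Lie group of points of a group object. -/
noncomputable def lieAction : LieAction G.lieGrp M.mfd where
  act g x := (A.translate g).toFun x
  one_act x := by
    change (A.app (const M G.isDiscrete 1) (𝟙 M)).toFun x = x
    rw [G.const_one, app_one]
    rfl
  mul_act g h x := A.translate_mul g h x
  smooth := by
    have h : ContMDiff ((𝓡 G.X.mfd.dim).prod (𝓡 M.mfd.dim))
        (𝓡 (SmoothMfd.openProd G.X.mfd M.mfd ⊤).dim) ∞
        (fun p : G.X.mfd × M.mfd =>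
          (SmoothMfd.openProd.mk p.1 p.2 trivial : SmoothMfd.openProd G.X.mfd M.mfd ⊤)) :=
      SmoothMfd.openProd.contMDiff_iff.mpr ⟨contMDiff_fst, contMDiff_snd⟩
    refine ((A.app (prodFst (O := ⊤) hF G.isDiscrete) (prodSnd hF)).smooth.comp h).congr
      fun p => ?_
    exact A.app_toFun_eq hF (const M G.isDiscrete p.1) (𝟙 M) p.2

end ActionObj

end LieGroupOfGroupObject

/-! ### Plaques as generalized elements -/

section PlaqueMorphisms

open FMn

variable {M Z : FMn.{u}} {B : SmoothMfd.{u}} {π : M ⟶ total B}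

theorem isFlat_id (B : SmoothMfd.{u}) :
    IsFlatEhresmannConnection (𝟙 (total B) : total B ⟶ total B).toFun (Foliation.total B) := by
  intro p
  rw [FMn.id_toFun, mfderiv_id]
  exact ⟨fun x y h => Subtype.ext h, fun y => ⟨⟨y, trivial⟩, rfl⟩⟩

theorem IsPlaque.mono {M B : SmoothMfd.{u}} {π : M → B} {F : Foliation M} {s : B → M} {U V : Set B}
    (hs : IsPlaque π F s U) (hV : IsOpen V) (hVU : V ⊆ U) : IsPlaque π F s V :=
  ⟨hV, fun b hb => hs.contMDiffAt b (hVU hb), fun b hb => hs.section_eq b (hVU hb),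
    fun b hb => hs.tangent b (hVU hb)⟩

/-- The lift to a plaque of a morphism to the base. -/
noncomputable def IsPlaque.lift {s : B → M.mfd} {U : Set B} (hs : IsPlaque π.toFun M.fol s U)
    (hF : IsFlatEhresmannConnection π.toFun M.fol) (c : Z ⟶ total B) (hc : ∀ z, c.toFun z ∈ U) :
    Z ⟶ M :=
  { toFun := fun z => s (c.toFun z)
    smooth := fun z => (hs.contMDiffAt _ (hc z)).comp z c.smooth.contMDiffAt
    map_space := fun z => by
      have e := fun v => mfderiv_comp_apply z
        ((hs.contMDiffAt _ (hc z)).mdifferentiableAt (by simp)) (c.mdifferentiableAt z) v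
      apply le_antisymm
      · rintro _ ⟨v, hv, rfl⟩
        exact Eq.mpr (congrArg (· ∈ M.fol.space (s (c.toFun z))) (e v))
          (hs.tangent _ (hc z) _)
      · intro w hw
        obtain ⟨u, hu⟩ := hs.exists_mfderiv_eq π.smooth hF (hc z) rfl hw
        have h1 : u ∈ (Foliation.total B).space (c.toFun z) := trivial
        have h2 := c.map_space z
        have h3 : u ∈ (Z.fol.space z).map
          (mfderiv (𝓡 Z.mfd.dim) (𝓡 B.dim) c.toFun z).toLinearMap := by rw [h2]; exact h1
        obtain ⟨v, hv, rfl⟩ := h3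
        exact ⟨v, hv, (e v).trans hu⟩ }

/-- The part of a flat connection over an open subset of the base. -/
noncomputable def restrict (hF : IsFlatEhresmannConnection π.toFun M.fol)
    (U : TopologicalSpace.Opens B) : FMn.{u} :=
  FMn.prod (total SmoothMfd.point.{u}) hF ⟨{z | π.toFun z.2 ∈ U},
    U.isOpen.preimage (π.smooth.continuous.comp continuous_snd)⟩

/-- The inclusion of the part over an open set. -/
noncomputable def restrictIncl (hF : IsFlatEhresmannConnection π.toFun M.fol)
    (U : TopologicalSpace.Opens B) : restrict hF U ⟶ M := prodSnd hF

theorem restrictIncl_mem (hF : IsFlatEhresmannConnection π.toFun M.fol)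
    (U : TopologicalSpace.Opens B) (z : (restrict hF U).mfd) :
    π.toFun ((restrictIncl hF U).toFun z) ∈ U := SmoothMfd.openProd.mem z

theorem exists_restrictIncl_eq (hF : IsFlatEhresmannConnection π.toFun M.fol)
    (U : TopologicalSpace.Opens B) {x : M.mfd} (hx : π.toFun x ∈ U) :
    ∃ z, (restrictIncl hF U).toFun z = x :=
  ⟨SmoothMfd.openProd.mk SmoothMfd.star x hx, rfl⟩

/-- Maps on the part over `U` extend to `M`. -/
theorem exists_extension (hF : IsFlatEhresmannConnection π.toFun M.fol)
    (U : TopologicalSpace.Opens B) {x₀ : M.mfd} (hx₀ : π.toFun x₀ ∈ U) {N : SmoothMfd.{u}}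
    {f : (restrict hF U).mfd → N} (hf : ContMDiff (𝓡 (restrict hF U).mfd.dim) (𝓡 N.dim) ∞ f) :
    ∃ f' : M.mfd → N, (∀ z, f' ((restrictIncl hF U).toFun z) = f z) ∧
      ContMDiffOn (𝓡 M.mfd.dim) (𝓡 N.dim) ∞ f' (π.toFun ⁻¹' U) := by
  let z₀ : (restrict hF U).mfd := SmoothMfd.openProd.mk SmoothMfd.star x₀ hx₀
  refine ⟨fun x => f (SmoothMfd.openProd.extend z₀ (SmoothMfd.star, x)), fun z => ?_,
    fun x hx => ?_⟩
  · exact congrArg f (SmoothMfd.openProd.extend_fst_snd z₀ z)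
  · refine ContMDiffAt.contMDiffWithinAt (hf.contMDiffAt.comp x ?_)
    exact (SmoothMfd.openProd.contMDiffAt_extend z₀ (p := (SmoothMfd.star, x)) hx).comp x
      (contMDiffAt_const.prodMk contMDiffAt_id)

/-- A morphism over the base fixing a point fixes the plaque through this point. -/
theorem IsPlaque.eventually_fixed (hF : IsFlatEhresmannConnection π.toFun M.fol)
    {s : B → M.mfd} {U : Set B} (hs : IsPlaque π.toFun M.fol s U) {σ : M ⟶ M} (hσ : σ ≫ π = π)
    {b : B} (hb : b ∈ U) (hsb : σ.toFun (s b) = s b) : ∀ᶠ c in 𝓝 b, σ.toFun (s c) = s c := by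
  -- `restrict (isFlat_id B) U'` is `U` with its full tangent bundle as foliation. The plaque is a
  -- morphism `f` from it, and `f` and `f ≫ σ` are tangent lifts of the same map.
  let U' : TopologicalSpace.Opens B := ⟨U, hs.isOpen⟩
  let i := restrictIncl (isFlat_id B) U'
  let f : restrict (isFlat_id B) U' ⟶ M := hs.lift hF i fun z => restrictIncl_mem (isFlat_id B) U' z
  have ht : ∀ n, ∀ v : TangentSpace (𝓡 (restrict (isFlat_id B) U').mfd.dim) n,
      v ∈ (restrict (isFlat_id B) U').fol.space n := fun n v =>
    Foliation.mem_openProdSpace.mpr ⟨Subsingleton.elim (α := EuclideanSpace ℝ (Fin 0)) _ _, trivial⟩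
  obtain ⟨n, hn⟩ := exists_restrictIncl_eq (isFlat_id B) U' hb
  have h1 := eventuallyEq_of_tangent (N := (restrict (isFlat_id B) U').mfd) π.smooth hF
    (f ≫ σ).smooth f.smooth
    (fun n v => (f ≫ σ).mfderiv_mem (ht n v)) (fun n v => f.mfderiv_mem (ht n v))
    (congrArg (fun τ => (f ≫ τ).toFun) hσ) (n := n)
    (by change σ.toFun (s (i.toFun n)) = s (i.toFun n); rw [hn, hsb])
  -- The agreement near `n` is carried back to a neighbourhood of `b` in `B` along the local
  -- identification of `B` with this manifold.
  have h2 : ContinuousAt (fun c => (SmoothMfd.openProd.extend n (SmoothMfd.star, c) :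
      (restrict (isFlat_id B) U').mfd)) b :=
    ContinuousAt.comp (SmoothMfd.openProd.contMDiffAt_extend n
      (p := (SmoothMfd.star, b)) hb).continuousAt (continuousAt_const.prodMk continuousAt_id)
  have h3 : SmoothMfd.openProd.extend n (SmoothMfd.star, b) = n := by
    rw [← hn]; exact SmoothMfd.openProd.extend_fst_snd n n
  have h4 := h2.eventually (p := fun z => (f ≫ σ).toFun z = f.toFun z) ((congrArg 𝓝 h3).symm ▸ h1)
  filter_upwards [h4, hs.isOpen.mem_nhds hb] with c hc hcU
  have h5 : SmoothMfd.openProd.extend n (SmoothMfd.star, c) =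
    SmoothMfd.openProd.mk SmoothMfd.star c hcU := SmoothMfd.openProd.extend_eq n hcU
  rw [h5] at hc
  exact hc

end PlaqueMorphisms

/-! ### From a splitting action to a principal bundle -/

section PrincipalBundleOfAction

open FMn

variable {M : FMn.{u}} {B : SmoothMfd.{u}} {π : M ⟶ total B} {G : GroupObj FMn.{u}}
  {A : ActionObj G M} (hF : IsFlatEhresmannConnection π.toFun M.fol)
  (h : IsPullback A.snd A.act π π)

include h in
theorem translate_comp (g : G.X.mfd) : A.translate g ≫ π = π :=
  (A.app_comp_of_isPullback h _ _).trans (Category.id_comp π)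

-- The kernel pair sees only morphisms, and a point of `M` need not be one. By unique lifting the
-- translation by `g` also fixes the plaque near `x`; on this generalized element `g` and `1` act
-- alike, so they are equal.
include hF h in
theorem eq_one_of_translate_eq {g : G.X.mfd} {x : M.mfd} (hg : (A.translate g).toFun x = x) :
    g = 1 := by
  obtain ⟨s, U, hs, hxU, hsx⟩ := exists_isPlaque π.smooth M.fol hF x
  obtain ⟨V, hVs, hV, hxV⟩ := eventually_nhds_iff.mp ((hs.eventually_fixed hF
    (translate_comp h g) hxU (by rw [hsx, hg])).and (hs.isOpen.mem_nhds hxU))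
  let V' : TopologicalSpace.Opens B := ⟨V, hV⟩
  let f := (hs.mono hV fun c hc => (hVs c hc).2).lift hF (restrictIncl (isFlat_id B) V')
    fun z => restrictIncl_mem (isFlat_id B) V' z
  obtain ⟨n, hn⟩ := exists_restrictIncl_eq (isFlat_id B) V' hxV
  have h1 : A.app (const _ G.isDiscrete g) f = A.app 1 f := by
    rw [A.app_const, A.app_one]
    exact hom_ext' fun z => (hVs _ (restrictIncl_mem (isFlat_id B) V' z)).1
  rw [← G.one_toFun n, ← A.app_left_injective h h1]
  rfl

include h in
theorem lieAction_act_injective {g g' : G.lieGrp} {x : M.mfd}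
    (hg : (A.lieAction hF).act g x = (A.lieAction hF).act g' x) : g = g' := by
  have h1 : (A.lieAction hF).act (g'⁻¹ * g) x = x := by
    rw [(A.lieAction hF).mul_act, hg, ← (A.lieAction hF).mul_act, inv_mul_cancel,
      (A.lieAction hF).one_act]
  exact (inv_mul_eq_one.mp (eq_one_of_translate_eq hF h h1)).symm

-- The inclusion of `π⁻¹(U)` and `x ↦ s (π x)` are morphisms with the same projection, so the kernel
-- pair supplies their quotient. The point `x₀` is needed only for default values in extending it to
-- `M`.
include h in
theorem exists_division {s : B → M.mfd} {U : Set B} (hs : IsPlaque π.toFun M.fol s U) {x₀ : M.mfd}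
    (hx₀ : π.toFun x₀ ∈ U) :
    ∃ δ : M.mfd → G.lieGrp, ContMDiffOn (𝓡 M.mfd.dim) (𝓡 G.lieGrp.dim) ∞ δ (π.toFun ⁻¹' U) ∧
      ∀ x, π.toFun x ∈ U → (A.lieAction hF).act (δ x) x = s (π.toFun x) := by
  let U' : TopologicalSpace.Opens B := ⟨U, hs.isOpen⟩
  let b : restrict hF U' ⟶ M := hs.lift hF (restrictIncl hF U' ≫ π) fun z => restrictIncl_mem hF U' z
  have hb : restrictIncl hF U' ≫ π = b ≫ π :=
    hom_ext' fun z => (hs.section_eq _ (restrictIncl_mem hF U' z)).symm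
  obtain ⟨δ, hδ⟩ := A.exists_app_eq h hb
  obtain ⟨δ', hδ', hsm⟩ := exists_extension hF U' hx₀ δ.smooth
  refine ⟨δ', hsm, fun x hx => ?_⟩
  obtain ⟨z, rfl⟩ := exists_restrictIncl_eq hF U' hx
  have h1 := (A.app_toFun hF δ (restrictIncl hF U') z).symm.trans (toFun_congr hδ z)
  rw [← hδ' z] at h1
  exact h1

-- The trivialization is `x ↦ (π x, (δ x)⁻¹)` with inverse `(c, g) ↦ g · s c`. Inverting `δ` makes
-- it equivariant, because freeness gives `δ (g · x) * g = δ x`.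
include h in
theorem isPrincipalBundle_lieAction (hπ : Function.Surjective π.toFun) :
    IsPrincipalBundle (A.lieAction hF) π.toFun := by
  have hinv : ∀ (g : G.lieGrp) x, π.toFun ((A.lieAction hF).act g x) = π.toFun x :=
    fun g x => toFun_congr (translate_comp h g) x
  refine ⟨hinv, fun b => ?_⟩
  obtain ⟨x₀, rfl⟩ := hπ b
  obtain ⟨s, U, hs, hU, -⟩ := exists_isPlaque π.smooth M.fol hF x₀
  obtain ⟨δ, hδs, hδ⟩ := exists_division hF h hs hU
  have hδact : ∀ (g : G.lieGrp) x, π.toFun x ∈ U →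
      δ ((A.lieAction hF).act g x) * g = δ x := by
    intro g x hx
    refine lieAction_act_injective hF h (x := x) ?_
    refine ((A.lieAction hF).mul_act _ _ _).trans ?_
    rw [hδ _ (by rw [hinv]; exact hx), hinv, hδ _ hx]
  have hΦ : ContMDiffOn (𝓡 M.mfd.dim) ((𝓡 B.dim).prod (𝓡 G.lieGrp.dim)) ∞
      (fun x => (π.toFun x, (δ x)⁻¹)) (π.toFun ⁻¹' U) :=
    π.smooth.contMDiffOn.prodMk hδs.inv
  have hΨ : ContMDiffOn ((𝓡 B.dim).prod (𝓡 G.lieGrp.dim)) (𝓡 M.mfd.dim) ∞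
      (fun p : B × G.lieGrp => (A.lieAction hF).act p.2 (s p.1)) (U ×ˢ Set.univ) := by
    rintro ⟨c, g⟩ ⟨hc, -⟩
    exact ((A.lieAction hF).smooth.contMDiffAt.comp (c, g) (contMDiffAt_snd.prodMk
      ((hs.contMDiffAt c hc).comp (c, g) contMDiffAt_fst))).contMDiffWithinAt
  refine ⟨U,
    { toFun := fun x => (π.toFun x, (δ x)⁻¹)
      invFun := fun p => (A.lieAction hF).act p.2 (s p.1)
      source := π.toFun ⁻¹' U
      target := U ×ˢ Set.univ
      map_source' := fun x hx => ⟨hx, trivial⟩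
      map_target' := ?_
      left_inv' := ?_
      right_inv' := ?_
      open_source := hs.isOpen.preimage π.smooth.continuous
      open_target := hs.isOpen.prod isOpen_univ
      continuousOn_toFun := hΦ.continuousOn
      continuousOn_invFun := hΨ.continuousOn }, hs.isOpen, hU, rfl, rfl, hΦ, hΨ,
      fun x hx => rfl, ?_⟩
  · rintro ⟨c, g⟩ ⟨hc, -⟩
    change π.toFun _ ∈ U
    rw [hinv]
    rw [hs.section_eq c hc]
    exact hc
  · intro x hx
    change (A.lieAction hF).act (δ x)⁻¹ (s (π.toFun x)) = x
    rw [← hδ x hx, ← (A.lieAction hF).mul_act, inv_mul_cancel, (A.lieAction hF).one_act]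
  · rintro ⟨c, g⟩ ⟨hc, -⟩
    have hsc := hs.section_eq c hc
    have h1 : δ (s c) = 1 := by
      refine lieAction_act_injective hF h (x := s c) ?_
      refine (hδ (s c) (by rw [hsc]; exact hc)).trans ?_
      rw [hsc]
      exact ((A.lieAction hF).one_act (s c)).symm
    have h2 := hδact g (s c) (by rw [hsc]; exact hc)
    rw [h1] at h2
    exact Prod.ext ((hinv g (s c)).trans hsc) (inv_eq_of_mul_eq_one_right h2)
  · intro g x hx
    change (δ ((A.lieAction hF).act g x))⁻¹ = g * (δ x)⁻¹
    rw [← hδact g x hx, mul_inv_rev, mul_inv_cancel_left]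

include h in
theorem isPrincipalWithConnection_lieAction (hπ : Function.Surjective π.toFun) :
    IsPrincipalWithConnection (A.lieAction hF) π.toFun M.fol :=
  ⟨isPrincipalBundle_lieAction hF h hπ, hF, fun g => (A.translate g).map_space⟩

end PrincipalBundleOfAction

/-! ### Quotients, Galois structures and their uniqueness -/

section Galois

open FMn

variable {G : LieGrp.{u}} {M : FMn.{u}} {B : SmoothMfd.{u}} {α : LieAction G M.mfd}
  {π : M ⟶ total B}

/-- A morphism to `(B, TB)` is onto on each fibre of the foliation, and equality of dimensions makes
it bijective. -/
theorem isFlatEhresmannConnection_of_finrank_eq (π : M ⟶ total B)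
    (hrank : ∀ p : M.mfd, Module.finrank ℝ (M.fol.space p) = B.dim) :
    IsFlatEhresmannConnection π.toFun M.fol := by
  intro p
  have h1 := π.map_space p
  have hs : Function.Surjective
      ((mfderiv (𝓡 M.mfd.dim) (𝓡 B.dim) π.toFun p).toLinearMap.domRestrict (M.fol.space p)) := by
    intro w
    have hw : w ∈ (M.fol.space p).map
        (mfderiv (𝓡 M.mfd.dim) (𝓡 B.dim) π.toFun p).toLinearMap := by
      rw [h1]; trivial
    obtain ⟨v, hv, rfl⟩ := hw
    exact ⟨⟨v, hv⟩, rfl⟩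
  have : FiniteDimensional ℝ (TangentSpace (𝓡 M.mfd.dim) p) :=
    inferInstanceAs (FiniteDimensional ℝ (EuclideanSpace ℝ (Fin M.mfd.dim)))
  have : FiniteDimensional ℝ (TangentSpace (𝓡 B.dim) (π.toFun p)) :=
    inferInstanceAs (FiniteDimensional ℝ (EuclideanSpace ℝ (Fin B.dim)))
  have h2 : Module.finrank ℝ (TangentSpace (𝓡 B.dim) (π.toFun p)) = B.dim :=
    finrank_euclideanSpace_fin
  exact ⟨(LinearMap.injective_iff_surjective_of_finrank_eq_finrank
    ((hrank p).trans h2.symm)).mpr hs, hs⟩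

/-- Maps that are constant on the fibres of a surjective flat connection descend to the base. -/
theorem exists_descent (hπ : Function.Surjective π.toFun)
    (hF : IsFlatEhresmannConnection π.toFun M.fol) {Z : FMn.{u}} (f : M ⟶ Z)
    (hf : ∀ x y, π.toFun x = π.toFun y → f.toFun x = f.toFun y) : ∃ f' : total B ⟶ Z, π ≫ f' = f := by
  obtain ⟨f', hf'⟩ : ∃ f' : B → Z.mfd, f.toFun = f' ∘ π.toFun :=
    ⟨fun b => f.toFun (Function.surjInv hπ b),
      funext fun x => hf _ _ (Function.surjInv_eq hπ _).symm⟩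
  have hsm : ContMDiff (𝓡 B.dim) (𝓡 Z.mfd.dim) ∞ f' := by
    intro b
    obtain ⟨x, rfl⟩ := hπ b
    -- Near `π x` the descended map is `f ∘ s` for a plaque `s`, hence smooth.
    obtain ⟨s, U, hs, hU, -⟩ := exists_isPlaque π.smooth M.fol hF x
    refine (f.smooth.contMDiffAt.comp _ (hs.contMDiffAt _ hU)).congr_of_eventuallyEq ?_
    filter_upwards [hs.isOpen.mem_nhds hU] with c hc
    change f' c = f.toFun (s c)
    rw [hf', Function.comp_apply, hs.section_eq c hc]
  -- As `π` maps `𝓕` onto `TB`, the image of `TB` under `f'` is the image of `𝓕` under `f' ∘ π`.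
  have key : ∀ f₀ : M.mfd → Z.mfd, f₀ = f' ∘ π.toFun → (∀ p, (M.fol.space p).map
      (mfderiv (𝓡 M.mfd.dim) (𝓡 Z.mfd.dim) f₀ p).toLinearMap = Z.fol.space (f₀ p)) →
      ∀ b, ((Foliation.total B).space b).map
        (mfderiv (𝓡 B.dim) (𝓡 Z.mfd.dim) f' b).toLinearMap = Z.fol.space (f' b) := by
    rintro _ rfl H b
    obtain ⟨x, rfl⟩ := hπ b
    refine Eq.trans ?_ (H x)
    rw [mfderiv_comp x (hsm.mdifferentiable (by simp) _) (π.mdifferentiableAt x)]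
    exact (congrArg (Submodule.map _) (π.map_space x).symm).trans (Submodule.map_comp _ _ _).symm
  exact ⟨{ toFun := f', smooth := hsm, map_space := key _ hf' f.map_space },
    FMn.Hom.ext hf'.symm⟩

/-- Translations are automorphisms over `B` and act transitively on fibres, so an invariant morphism
is constant on fibres and descends. -/
theorem isNormal_of_isPrincipalWithConnection (hπ : Function.Surjective π.toFun)
    (h : IsPrincipalWithConnection α π.toFun M.fol) : IsNormal π := by
  have := epi_of_surjective π hπ
  refine ⟨fun σ => σ.2, fun Z f hf => ?_⟩
  obtain ⟨f', hf'⟩ := exists_descent hπ h.2.1 f fun x y hxy => by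
    obtain ⟨g, rfl⟩ := h.1.exists_act_eq hxy
    exact (toFun_congr (hf (translationHom h g)) x).symm
  exact ⟨f', hf', fun f'' hf'' => (cancel_epi π).mp (hf''.trans hf'.symm)⟩

/-- The value of a global element. -/
noncomputable def globalValue {X : FMn.{u}} (g : ⊤_ FMn.{u} ⟶ X) : X.mfd :=
  (terminal.from (total SmoothMfd.point.{u}) ≫ g).toFun SmoothMfd.star

/-- The chosen terminal object is only isomorphic to the one-point manifold, so global elements are
evaluated by first mapping the point to it. -/
theorem terminal_from_toFun {X Z : FMn.{u}} (g : ⊤_ FMn.{u} ⟶ X) (z : Z.mfd) :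
    (terminal.from Z ≫ g).toFun z = globalValue g := by
  rw [show terminal.from Z = toPoint Z ≫ terminal.from _ from Subsingleton.elim _ _]
  rfl

theorem globalValue_injective {X : FMn.{u}} :
    Function.Injective (globalValue : (⊤_ FMn.{u} ⟶ X) → X.mfd) := by
  intro g g' h
  refine hom_ext' fun z => ?_
  have h1 := fun k : ⊤_ FMn.{u} ⟶ X => (toFun_congr (show terminal.from _ ≫ k = k by
    rw [show terminal.from (⊤_ FMn.{u}) = 𝟙 _ from Subsingleton.elim _ _, Category.id_comp])
      z).symm.trans (terminal_from_toFun k z)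
  rw [h1, h1, h]

theorem toAut_actionObj (h : IsPrincipalWithConnection α π.toFun M.fol)
    (g : ⊤_ FMn.{u} ⟶ G.groupObj.X) (x : M.mfd) :
    ((actionObj h).toAut g).hom.toFun x = α.act (globalValue g) x :=
  congrArg (α.act · x) (terminal_from_toFun g x)

/-- Global elements of `G` are its points, acting by translations, so the condition on `toAut`
reduces to freeness and `translationHom_bijective`. -/
theorem isGaloisStructure_actionObj (hM : M.IsIrreducible)
    (h : IsPrincipalWithConnection α π.toFun M.fol) : IsGaloisStructure π (actionObj h) := by
  obtain ⟨p, -⟩ := id hM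
  refine ⟨isSplittingAction_of_isPullback (isPullback_actionObj h), fun g g' hg => ?_, ?_⟩
  · refine globalValue_injective (h.1.act_injective (x := p) ?_)
    rw [← toAut_actionObj h, hg, toAut_actionObj]
  · ext σ
    constructor
    · rintro ⟨g, rfl⟩
      exact hom_ext' fun x => (congrArg π.toFun (toAut_actionObj h g x)).trans (h.1.1 _ x)
    · intro hσ
      obtain ⟨g, hg⟩ := (translationHom_bijective hM h).2 ⟨σ, hσ⟩
      refine ⟨const _ (isDiscrete_zero _) g, Aut.ext (hom_ext' fun x => ?_)⟩
      refine (toAut_actionObj h _ x).trans ?_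
      exact toFun_congr (congrArg (fun τ => τ.1.hom) hg) x

/-- Smooth maps between manifolds foliated by points. -/
noncomputable def homOfSmooth {X Y : FMn.{u}} (hX : X.IsDiscrete) (hY : Y.IsDiscrete)
    (f : X.mfd → Y.mfd) (hf : ContMDiff (𝓡 X.mfd.dim) (𝓡 Y.mfd.dim) ∞ f) : X ⟶ Y :=
  homOfDiscrete hY f hf fun p v hv => by
    rw [hX] at hv
    rw [(Submodule.mem_bot ℝ).mp hv, map_zero]

/-- Every splitting action yields a Lie group action of the kind considered, and two of these are
conjugate. Between discrete foliated manifolds a smooth isomorphism is a morphism in both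
directions. -/
theorem isomorphic_actionObj (hM : M.IsIrreducible) (hπ : Function.Surjective π.toFun)
    (h : IsPrincipalWithConnection α π.toFun M.fol) {H : GroupObj FMn.{u}} (A' : ActionObj H M)
    (hA' : IsPullback A'.snd A'.act π π) : (actionObj h).Isomorphic A' := by
  have h' := isPrincipalWithConnection_lieAction h.2.1 hA' hπ
  obtain ⟨ψ, hψ, hψ', hact⟩ := h.conjugate hM h'
  let φ : G.groupObj.X ⟶ H.X := homOfSmooth (isDiscrete_zero _) H.isDiscrete ψ hψ
  let φ' : H.X ⟶ G.groupObj.X := homOfSmooth H.isDiscrete (isDiscrete_zero _) ψ.symm hψ'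
  refine ⟨⟨φ, φ', hom_ext' fun x => ψ.symm_apply_apply x, hom_ext' fun x => ψ.apply_symm_apply x⟩,
    fun a b => hom_ext' fun z => ?_, fun g x => hom_ext' fun z => ?_⟩
  · exact (map_mul ψ _ _).trans (H.mul_toFun (a ≫ φ) (b ≫ φ) z).symm
  · exact (A'.app_toFun h.2.1 (g ≫ φ) x z).trans (hact _ _)

theorem isGalois_of_isPrincipalWithConnection (hM : M.IsIrreducible)
    (hπ : Function.Surjective π.toFun) (h : IsPrincipalWithConnection α π.toFun M.fol) :
    IsGalois π :=
  ⟨epi_of_surjective π hπ, isNormal_of_isPrincipalWithConnection hπ h, _, actionObj h,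
    isGaloisStructure_actionObj hM h, fun _ A' hA' => isomorphic_actionObj hM hπ h A' hA'.1.isPullback⟩

end Galois

end GaloisFol

/-! ### The equivalences -/

theorem mainTheorem6 (M : GaloisFol.FMn.{u}) (B : GaloisFol.SmoothMfd.{u})
    (π : M ⟶ GaloisFol.FMn.total B)
    (hπ : Function.Surjective π.toFun)
    (hM : M.IsIrreducible) (hB : (GaloisFol.FMn.total B).IsIrreducible)
    (hrank : ∀ p : M.mfd, Module.finrank ℝ (M.fol.space p) = B.dim) :
    [ GaloisFol.KernelPairSplits π,
      GaloisFol.IsGalois π,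
      ∃ (G : GaloisFol.LieGrp.{u}) (α : GaloisFol.LieAction G M.mfd),
        GaloisFol.IsPrincipalWithConnection α π.toFun M.fol,
      ∃ (G : GaloisFol.LieGrp.{u}) (α : GaloisFol.LieAction G M.mfd),
        GaloisFol.IsPrincipalWithConnection α π.toFun M.fol ∧
        ∀ (H : GaloisFol.LieGrp.{u}) (β : GaloisFol.LieAction H M.mfd),
          GaloisFol.IsPrincipalWithConnection β π.toFun M.fol → α.Conjugate β ].TFAE ∧
    ∀ (G : GaloisFol.LieGrp.{u}) (α : GaloisFol.LieAction G M.mfd),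
      GaloisFol.IsPrincipalWithConnection α π.toFun M.fol →
        ∃ e : G ≃* GaloisFol.AutOver π, ∀ (g : G) (x : M.mfd), (e g).1.hom.toFun x = α.act g x := by
  refine ⟨?_, fun G α h =>
    ⟨GaloisFol.translationEquiv hM h, GaloisFol.translationEquiv_apply hM h⟩⟩
  have hF := GaloisFol.isFlatEhresmannConnection_of_finrank_eq π hrank
  tfae_have 1 → 3 := by
    rintro ⟨K, s, t, hK, G, A, hA⟩
    have hA' : GaloisFol.IsSplittingAction π A := ⟨K, s, t, hK, hA⟩
    exact ⟨_, _, GaloisFol.isPrincipalWithConnection_lieAction hF hA'.isPullback hπ⟩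
  tfae_have 3 → 2 := fun ⟨_, _, h⟩ => GaloisFol.isGalois_of_isPrincipalWithConnection hM hπ h
  tfae_have 2 → 1 := fun ⟨_, _, G, A, ⟨⟨K, s, t, hK, hA⟩, _⟩, _⟩ => ⟨K, s, t, hK, G, A, hA⟩
  tfae_have 3 → 4 := fun ⟨G, α, h⟩ => ⟨G, α, h, fun _ _ h' => h.conjugate hM h'⟩
  tfae_have 4 → 3 := fun ⟨G, α, h, _⟩ => ⟨G, α, h⟩
  tfae_finish
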